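/- **Setting.** Let $\mathcal A=\mathbb C[x^{\pm1}]$. Let $k_0,k_1,u_0,u_1$ be non-zero complex numbers and $q\in\mathbb C$ with $0<|q|<1$, with a fixed square root $q^{1/2}$. Put $a=k_1u_1$, $b=-k_1u_1^{-1}$, $c=q^{1/2}k_0u_0$, $d=-q^{1/2}k_0u_0^{-1}$. For $m\in\mathbb Z$ let $\epsilon(m)=1$ if $m\ge 0$, $\epsilon(m)=-1$ if $m<0$, and $\gamma_m=(k_0k_1)^{\epsilon(m)}q^m$. Assume that $k_0^2,k_1^2,u_1^2\notin\pm q^{\mathbb Z}$, that $ef\notin q^{\mathbb Z}$ for all $e,f\in\{a,b,c,d\}$, and that the numbers $\gamma_m$ ($m\in\mathbb Z$) are pairwise different. Let $s_0(x^m)=q^mx^{-m}$, $s_1(x^m)=x^{-m}$, and define linear operators on $\mathcal A$ by $$T_0=k_0s_0+\frac{(k_0-k_0^{-1})+(u_0-u_0^{-1})q^{1/2}x^{-1}}{1-qx^{-2}}(\mathrm{id}-s_0),\qquad T_1=k_1s_1+\frac{(k_1-k_1^{-1})+(u_1-u_1^{-1})x}{1-x^{2}}(\mathrm{id}-s_1),$$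 $Y=T_1T_0$, $C_+=(1+k_1^2)^{-1}(1+k_1T_1)$, $C_-=(1+k_1^{-2})^{-1}(1-k_1^{-1}T_1)$. Order the monomials by $1\prec x^{-1}\prec x\prec x^{-2}\prec x^2\prec\cdots$, and call $f$ monic of degree $m$ if $f=x^m+$ lower order terms with respect to $\preceq$. For $m\in\mathbb Z$ let $P_m$ be the monic $f$ of degree $m$ with $Yf=\gamma_mf$. For $m\ge 0$ let $\mathcal A(m)=\mathrm{span}\{P_m,P_{-m}\}$, let $P_m^+$ be the monic element of degree $m$ of $C_+\mathcal A(m)$, and, for $m\geq 1$, let $P_m^-$ be the monic element of degree $m$ of $C_-\mathcal A(m)$. A prime denotes the same objects for the inverse parameters $(k_0^{-1},k_1^{-1},u_0^{-1},u_1^{-1},q^{-1})$, with $(q^{-1})^{1/2}=(q^{1/2})^{-1}$. Let $C$ be a rectifiable Jordan curve with counterclockwise orientation, not passing through $0$, with all $eq^k$ in its interior and all $e^{-1}q^{-k}$ in its exterior ($e\in\{a,b,c,d\}$, $k\in\mathbb Z_{\ge0}$). For $m\ge 0$ put $(t_m,v_m)=(k_1,u_1)$ if $m$ is even, $(t_m,v_m)=(k_0,u_0)$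 if $m$ is odd, and $$w_m(y)=\frac{1-q^my^2}{(1-t_mv_mq^{m/2}y)(1+t_mv_m^{-1}q^{m/2}y)},\qquad \Delta(x)=\prod_{m\ge0}w_m(x)\prod_{m\ge1}w_m(x^{-1}),\qquad \Delta_+(x)=\prod_{m\ge0}w_m(x)w_m(x^{-1}),$$ $$\langle f,g\rangle=\frac1{2\pi i}\int_Cf(x)g(x^{-1})\Delta(x)\frac{dx}{x},\qquad (f,g)=\frac1{2\pi i}\int_Cf(x)g(x^{-1})\Delta_+(x)\frac{dx}{x}\qquad(f,g\in\mathcal A).$$ **Proposition.** For the parameters and for the inverse parameters, the polynomials $P_m$ ($m\in\mathbb Z$), $P_m^+$ ($m\ge0$), $P_m^-$ ($m\ge1$) exist and are unique. The forms $\langle\cdot,\cdot\rangle$ and $(\cdot,\cdot)$ are bilinear and $\langle\cdot,\cdot\rangle$ is non-degenerate. The families $\mathcal B=(P_m^+)_{m\ge0}\cup(P_n^-)_{n\ge1}$ and $\mathcal B'=(P_m^{+\prime})_{m\ge0}\cup(P_n^{-\prime})_{n\ge1}$ are linear bases of $\mathcal A$, and $(\mathcal B,\mathcal B')$ is a bi-orthogonal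 system for $\langle\cdot,\cdot\rangle$: $$\langle P_m^+,P_n^{+\prime}\rangle=0\ (m\ne n),\quad\langle P_m^-,P_n^{-\prime}\rangle=0\ (m\ne n),\quad\langle P_m^+,P_n^{-\prime}\rangle=0,\quad\langle P_n^-,P_m^{+\prime}\rangle=0\ \text{ (all } m, n).$$ Moreover $P_m^{+\prime}=P_m^+$ for all $m\ge0$, and $\langle P_m^+,P_n^+\rangle=(P_m^+,P_n^+)=0$ for all $m,n\ge 0$ with $m\ne n$. -/

import Mathlib

open LaurentPolynomial

noncomputable section

namespace AskeyWilson

/-- The algebra `𝒜 = ℂ[x, x⁻¹]`; the monomial `x ^ m` is `LaurentPolynomial.T m`. -/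
abbrev Laurent : Type := LaurentPolynomial ℂ

/-- The value `f(x)` of a Laurent polynomial at a (non-zero) complex number. -/
def evalAt (f : Laurent) (x : ℂ) : ℂ := f.coeff.sum fun n c => c * x ^ n

/-- The linear endomorphism of `𝒜` with prescribed values on the monomials. -/
def ofMonomials (g : ℤ → Laurent) : Laurent →ₗ[ℂ] Laurent :=
  (Finsupp.linearCombination ℂ g).comp
    (AddMonoidAlgebra.coeffLinearEquiv ℂ : Laurent ≃ₗ[ℂ] (ℤ →₀ ℂ)).toLinearMap

/-! ### Parameters -/

/-- A multiplicity function `t`, given by its four values `k₀ = t_{a₀}`, `k₁ = t_{a₁}`,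
`u₀ = t_{a₀^∨}`, `u₁ = t_{a₁^∨}`, together with a square root `qh = q ^ (1/2)` of the
deformation parameter. -/
structure Params where
  k0 : ℂ
  k1 : ℂ
  u0 : ℂ
  u1 : ℂ
  qh : ℂ

namespace Params

/-- The deformation parameter `q`. -/
def q (p : Params) : ℂ := p.qh ^ 2

/-- The inverse parameters `(t⁻¹, q⁻¹)`. -/
def inv (p : Params) : Params := ⟨p.k0⁻¹, p.k1⁻¹, p.u0⁻¹, p.u1⁻¹, p.qh⁻¹⟩

/-- The Askey-Wilson parameter `a = k₁ u₁`. -/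
def a (p : Params) : ℂ := p.k1 * p.u1
/-- The Askey-Wilson parameter `b = - k₁ u₁⁻¹`. -/
def b (p : Params) : ℂ := -(p.k1 * p.u1⁻¹)
/-- The Askey-Wilson parameter `c = q ^ (1/2) k₀ u₀`. -/
def c (p : Params) : ℂ := p.qh * p.k0 * p.u0
/-- The Askey-Wilson parameter `d = - q ^ (1/2) k₀ u₀⁻¹`. -/
def d (p : Params) : ℂ := -(p.qh * p.k0 * p.u0⁻¹)

/-- `ε(m) = 1` for `m ≥ 0` and `ε(m) = -1` for `m < 0`. -/
def eps (m : ℤ) : ℤ := if 0 ≤ m then 1 else -1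

/-- `γ_m = k₀ ^ ε(m) k₁ ^ ε(m) q ^ m`. -/
def gam (p : Params) (m : ℤ) : ℂ := p.k0 ^ eps m * p.k1 ^ eps m * p.q ^ m

/-- The standing conditions on the parameters. -/
structure Generic (p : Params) : Prop where
  k0_ne : p.k0 ≠ 0
  k1_ne : p.k1 ≠ 0
  u0_ne : p.u0 ≠ 0
  u1_ne : p.u1 ≠ 0
  q_pos : 0 < ‖p.q‖
  q_lt : ‖p.q‖ < 1
  k0_sq : ∀ n : ℤ, p.k0 ^ 2 ≠ p.q ^ n ∧ p.k0 ^ 2 ≠ -p.q ^ n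
  k1_sq : ∀ n : ℤ, p.k1 ^ 2 ≠ p.q ^ n ∧ p.k1 ^ 2 ≠ -p.q ^ n
  u1_sq : ∀ n : ℤ, p.u1 ^ 2 ≠ p.q ^ n ∧ p.u1 ^ 2 ≠ -p.q ^ n
  /-- the `γ_m` are pairwise different -/
  gam_injective : Function.Injective p.gam
  /-- `e f ∉ q ^ ℤ` for all `e, f ∈ {a, b, c, d}` -/
  mul_ne : ∀ e ∈ ({p.a, p.b, p.c, p.d} : Set ℂ), ∀ f ∈ ({p.a, p.b, p.c, p.d} : Set ℂ),
    ∀ n : ℤ, e * f ≠ p.q ^ n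

end Params

/-! ### Difference-reflection operators

Below, `σ ∈ {1, -1}` and `h ≠ 0` stand for the affine root `α` with `x ^ (α/2) = h x ^ σ`,
hence `x ^ α = h² x ^ (2σ)`. The root `a₁ = 2` has `σ = 1`, `h = 1`, and `a₀ = δ - 2` has
`σ = -1`, `h = q ^ (1/2)`. -/

/-- The reflection `s_α`, that is `x ^ m ↦ x ^ (m - ⟨m, α^∨⟩ α) = h ^ (-2σm) x ^ (-m)`.
So `s₁ (x ^ m) = x ^ (-m)` and `s₀ (x ^ m) = q ^ m x ^ (-m)`. -/
def reflection (σ : ℤ) (h : ℂ) : Laurent →ₗ[ℂ] Laurent :=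
  ofMonomials fun m => C (h ^ (-2 * σ * m)) * T (-m)

/-- The divided difference operator `D_α f = (f - s_α f) / (1 - x ^ α)` on `𝒜`, through its
values on monomials: with `N = ⟨m, α^∨⟩ = σ m`, the image of `x ^ m` is
`-x ^ (m - α) - ⋯ - x ^ (m - N α)` if `N ≥ 0`, and
`x ^ m + x ^ (m + α) + ⋯ + x ^ (m + (-N - 1) α)` if `N < 0`.
It is shown in `dividedDifference_spec` that this is the quotient. -/
def dividedDifference (σ : ℤ) (h : ℂ) : Laurent →ₗ[ℂ] Laurent :=
  ofMonomials fun m =>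
    if 0 ≤ σ * m then
      -∑ j ∈ Finset.range (σ * m).toNat,
        C (h ^ (-2 * ((j : ℤ) + 1))) * T (m - 2 * σ * ((j : ℤ) + 1))
    else
      ∑ j ∈ Finset.range (-(σ * m)).toNat, C (h ^ (2 * (j : ℤ))) * T (m + 2 * σ * (j : ℤ))

lemma ofMonomials_T (g : ℤ → Laurent) (m : ℤ) : ofMonomials g (T m) = g m := by
  change Finsupp.linearCombination ℂ g (Finsupp.single m (1 : ℂ)) = g m
  simp

lemma ofMonomials_C_mul_T (g : ℤ → Laurent) (r : ℂ) (m : ℤ) :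
    ofMonomials g (C r * T m) = C r * g m := by
  rw [← smul_eq_C_mul, map_smul, ofMonomials_T, smul_eq_C_mul]

/-- The defining property of the divided difference operator. -/
theorem dividedDifference_spec {σ : ℤ} (hσ : σ = 1 ∨ σ = -1) {h : ℂ} (hh : h ≠ 0)
    (f : Laurent) :
    (1 - C (h ^ 2) * T (2 * σ)) * dividedDifference σ h f = f - reflection σ h f := by
  have hσ2 : σ * σ = 1 := by rcases hσ with rfl | rfl <;> norm_num
  have key : ∀ (i j e : ℤ),
      (C (h ^ (2 : ℕ)) * T e : Laurent) * (C (h ^ i) * T j) = C (h ^ (i + 2)) * T (j + e) := by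
    intro i j e
    rw [zpow_add₀ hh, T_add, C.map_mul]
    rw [show h ^ (2 : ℤ) = h ^ (2 : ℕ) by norm_cast]
    ring
  have mono : ∀ m : ℤ, (1 - C (h ^ 2) * T (2 * σ)) * dividedDifference σ h (T m)
      = T m - reflection σ h (T m) := by
    intro m
    simp only [dividedDifference, reflection, ofMonomials_T]
    split_ifs with hm
    · have hN : (((σ * m).toNat : ℕ) : ℤ) = σ * m := Int.toNat_of_nonneg hm
      have := Finset.sum_range_sub
        (fun j : ℕ => (C (h ^ (-2 * (j : ℤ))) * T (m - 2 * σ * (j : ℤ)) : Laurent)) (σ * m).toNat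
      rw [mul_neg, Finset.mul_sum, neg_eq_iff_eq_neg, neg_sub]
      convert this using 1
      · refine Finset.sum_congr rfl fun j _ => ?_
        rw [sub_mul, one_mul, key]
        push_cast
        congr 3 <;> ring_nf
      · rw [hN]
        have e1 : m - 2 * σ * (σ * m) = -m := by linear_combination (-2 * m) * hσ2
        rw [e1]
        simp [mul_assoc]
    · have hN : (((-(σ * m)).toNat : ℕ) : ℤ) = -(σ * m) := Int.toNat_of_nonneg (by omega)
      have := Finset.sum_range_sub'
        (fun j : ℕ => (C (h ^ (2 * (j : ℤ))) * T (m + 2 * σ * (j : ℤ)) : Laurent))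
        (-(σ * m)).toNat
      rw [Finset.mul_sum]
      convert this using 1
      · refine Finset.sum_congr rfl fun j _ => ?_
        rw [sub_mul, one_mul, key]
        push_cast
        congr 3; ring_nf
      · rw [hN]
        have e1 : m + 2 * σ * -(σ * m) = -m := by linear_combination (-2 * m) * hσ2
        rw [e1]
        simp [mul_assoc]
  induction f using LaurentPolynomial.induction_on' with
  | add f g hf hg => rw [map_add, map_add, mul_add, hf, hg]; ring
  | C_mul_T n r =>
    rw [← smul_eq_C_mul r, map_smul, map_smul, mul_smul_comm, mono, smul_sub]

/-- `k s_α + ((k - k⁻¹) + (u - u⁻¹) x ^ (α/2)) D_α`. -/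
def heckeOperator (σ : ℤ) (h k u : ℂ) : Laurent →ₗ[ℂ] Laurent :=
  k • reflection σ h +
    (LinearMap.mulLeft ℂ (C (k - k⁻¹) + C ((u - u⁻¹) * h) * T σ : Laurent)).comp
      (dividedDifference σ h)

namespace Params

variable (p : Params)

/-- The difference-reflection operator `T₀`. -/
def T0 : Laurent →ₗ[ℂ] Laurent := heckeOperator (-1) p.qh p.k0 p.u0

/-- The difference-reflection operator `T₁`. -/
def T1 : Laurent →ₗ[ℂ] Laurent := heckeOperator 1 1 p.k1 p.u1

/-- The Cherednik-Dunkl operator `Y = T₁ T₀`. -/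
def Y : Laurent →ₗ[ℂ] Laurent := p.T1.comp p.T0

/-- The idempotent `C₊ = (1 + k₁²)⁻¹ (1 + k₁ T₁)`. -/
def Cplus : Laurent →ₗ[ℂ] Laurent := (1 + p.k1 ^ 2)⁻¹ • (LinearMap.id + p.k1 • p.T1)

/-- The idempotent `C₋ = (1 + k₁⁻²)⁻¹ (1 - k₁⁻¹ T₁)`. -/
def Cminus : Laurent →ₗ[ℂ] Laurent :=
  (1 + (p.k1 ^ 2)⁻¹)⁻¹ • (LinearMap.id - p.k1⁻¹ • p.T1)

end Params

/-! ### Askey-Wilson polynomials -/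

/-- The position of `x ^ m` in the total order `1 ≺ x⁻¹ ≺ x ≺ x⁻² ≺ x² ≺ ⋯`. -/
def rank (m : ℤ) : ℤ := if 0 ≤ m then 2 * m else -2 * m - 1

/-- `f = x ^ m + ` lower order terms with respect to `≺`. -/
def IsMonicOfDegree (m : ℤ) (f : Laurent) : Prop :=
  f.coeff m = 1 ∧ ∀ n : ℤ, rank m < rank n → f.coeff n = 0

namespace Params

variable (p : Params)

/-- The characterization of the monic non-symmetric Askey-Wilson polynomial of degree `m`. -/
def IsNonsymmetric (m : ℤ) (f : Laurent) : Prop :=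
  IsMonicOfDegree m f ∧ p.Y f = p.gam m • f

/-- The monic non-symmetric Askey-Wilson polynomial `P_m`, `m ∈ ℤ`. -/
def nonsymmetric (m : ℤ) : Laurent := Classical.epsilon (p.IsNonsymmetric m)

/-- The module `𝒜(m) = span {P_m, P_{-m}}`, `m ≥ 0`. -/
def component (m : ℕ) : Submodule ℂ Laurent :=
  Submodule.span ℂ {p.nonsymmetric m, p.nonsymmetric (-m)}

/-- `f` is a monic element of degree `m` of `𝒜₊(m) = C₊ 𝒜(m)`. -/
def IsSymmetric (m : ℕ) (f : Laurent) : Prop :=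
  f ∈ (p.component m).map p.Cplus ∧ IsMonicOfDegree m f

/-- `f` is a monic element of degree `m` of `𝒜₋(m) = C₋ 𝒜(m)`. -/
def IsAntisymmetric (m : ℕ) (f : Laurent) : Prop :=
  f ∈ (p.component m).map p.Cminus ∧ IsMonicOfDegree m f

/-- The monic symmetric Askey-Wilson polynomial `P_m⁺`, `m ≥ 0`. -/
def Pplus (m : ℕ) : Laurent := Classical.epsilon (p.IsSymmetric m)

/-- The monic anti-symmetric Askey-Wilson polynomial `P_m⁻`, `m ≥ 1`. -/
def Pminus (m : ℕ) : Laurent := Classical.epsilon (p.IsAntisymmetric m)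

/-- The family `ℬ` consisting of the `P_m⁺` (`m ≥ 0`) and the `P_n⁻` (`n ≥ 1`). -/
def family : ℕ ⊕ ℕ → Laurent
  | Sum.inl m => p.Pplus m
  | Sum.inr n => p.Pminus (n + 1)

/-! ### Weight functions and bilinear forms -/

/-- The factor `(1 - x ^ α) / ((1 - t_α t_{α/2} x ^ (α/2)) (1 + t_α t_{α/2}⁻¹ x ^ (α/2)))`
for the root `α = ± 2 + m δ`, with `y = x ^ (± 1)`. The pair `(t_α, t_{α/2})` is `(k₁, u₁)` for
even `m` and `(k₀, u₀)` for odd `m`. -/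
def weightFactor (m : ℕ) (y : ℂ) : ℂ :=
  let t := if Even m then p.k1 else p.k0
  let u := if Even m then p.u1 else p.u0
  (1 - p.q ^ m * y ^ 2) / ((1 - t * u * (p.qh ^ m * y)) * (1 + t * u⁻¹ * (p.qh ^ m * y)))

/-- The weight `Δ(x)`: the product over the positive roots, which are `2 + m δ` (`m ≥ 0`) and
`-2 + m δ` (`m ≥ 1`). -/
def weight (x : ℂ) : ℂ :=
  (∏' m : ℕ, p.weightFactor m x) * ∏' m : ℕ, p.weightFactor (m + 1) x⁻¹

/-- The weight `Δ₊(x)`: the product over the roots `± 2 + m δ` with `m ≥ 0`. -/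
def weightPlus (x : ℂ) : ℂ :=
  (∏' m : ℕ, p.weightFactor m x) * ∏' m : ℕ, p.weightFactor m x⁻¹

end Params

/-- `∫ F(x) dx` along the curve `γ : [0,1] → ℂ`. -/
def curveInt (γ : ℝ → ℂ) (F : ℂ → ℂ) : ℂ := ∫ t in (0 : ℝ)..1, F (γ t) * deriv γ t

/-- The trace of a curve. -/
def trace (γ : ℝ → ℂ) : Set ℂ := γ '' Set.Icc 0 1

/-- The points in a bounded connected component of the complement of the curve. -/
def inside (γ : ℝ → ℂ) : Set ℂ :=
  {z | z ∉ trace γ ∧ Bornology.IsBounded (connectedComponentIn (trace γ)ᶜ z)}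

/-- The points in an unbounded connected component of the complement of the curve. -/
def outside (γ : ℝ → ℂ) : Set ℂ :=
  {z | z ∉ trace γ ∧ ¬ Bornology.IsBounded (connectedComponentIn (trace γ)ᶜ z)}

/-- A rectifiable Jordan curve with counterclockwise orientation. It is given by a Lipschitz
parametrization on `[0,1]`, such as the parametrization proportional to arc length, which every
rectifiable curve has; the orientation is expressed by the winding number. -/
structure IsJordanCurve (γ : ℝ → ℂ) : Prop where
  lipschitz : ∃ K, LipschitzOnWith K γ (Set.Icc 0 1)
  closed : γ 0 = γ 1
  simple : Set.InjOn γ (Set.Ico 0 1)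
  counterclockwise : ∀ z ∈ inside γ,
    (2 * Real.pi * Complex.I)⁻¹ * curveInt γ (fun x => (x - z)⁻¹) = 1

namespace Params

variable (p : Params)

/-- `γ` is an admissible contour for the parameters `p`: it avoids `0` (where the integrands below
have no meaning), the points `e q ^ k` are inside and the points `e⁻¹ q ^ (-k)` are outside
(`e ∈ {a, b, c, d}`, `k ≥ 0`). -/
structure IsContour (γ : ℝ → ℂ) : Prop where
  jordan : IsJordanCurve γ
  zero_notMem : (0 : ℂ) ∉ trace γ
  inner : ∀ e ∈ ({p.a, p.b, p.c, p.d} : Set ℂ), ∀ k : ℕ, e * p.q ^ k ∈ inside γ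
  outer : ∀ e ∈ ({p.a, p.b, p.c, p.d} : Set ℂ), ∀ k : ℕ, (e * p.q ^ k)⁻¹ ∈ outside γ

/-- `⟨f, g⟩ = (2πi)⁻¹ ∫_C f(x) g(x⁻¹) Δ(x) dx/x`. -/
def pairing (γ : ℝ → ℂ) (f g : Laurent) : ℂ :=
  (2 * Real.pi * Complex.I)⁻¹ *
    curveInt γ fun x => evalAt f x * evalAt g x⁻¹ * p.weight x / x

/-- `(f, g) = (2πi)⁻¹ ∫_C f(x) g(x⁻¹) Δ₊(x) dx/x`. -/
def pairingPlus (γ : ℝ → ℂ) (f g : Laurent) : ℂ :=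
  (2 * Real.pi * Complex.I)⁻¹ *
    curveInt γ fun x => evalAt f x * evalAt g x⁻¹ * p.weightPlus x / x

end Params

/-- The family `b` is a linear basis of `𝒜`. -/
def IsBasisOfLaurent {ι : Type} (b : ι → Laurent) : Prop :=
  LinearIndependent ℂ b ∧ Submodule.span ℂ (Set.range b) = ⊤

/-- `(b, b')` is a bi-orthogonal system of `𝒜` with respect to `B`: both are bases, and
`B (b i) (b' j) = 0` for `i ≠ j`. -/
def IsBiorthogonalSystem {ι : Type} (B : LinearMap.BilinForm ℂ Laurent) (b b' : ι → Laurent) :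
    Prop :=
  IsBasisOfLaurent b ∧ IsBasisOfLaurent b' ∧ ∀ i j, i ≠ j → B (b i) (b' j) = 0

end AskeyWilson

end

noncomputable section

namespace AskeyWilson

/-! ### Evaluation of Laurent polynomials -/

/-! With z = x^(α/2), both generators have the form T = k + k⁻¹ w⁻¹ (s − 1), where w = (1 − z²)/((1
− kuz)(1 + ku⁻¹z)). In this form (T − k)(T + k⁻¹) = 0 is a pointwise computation. Moreover w is a
factor of Δ, and the product of the other factors is invariant under s; this makes T adjoint to the
inverse of the operator T′ of the inverse parameters.

Algebra. Modulo the x^j with |j| < m, the operators T₀ and T₁ act on x^m, x^(-m) by explicit 2×2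
matrices. Hence Y is triangular for ≺ with distinct diagonal entries γ_m (`isTriangular_Y`), which
gives the P_m. Since Y + Y⁻¹ commutes with T₁, the space 𝒜(m) is T₁-stable (`T1_nonsymmetric_neg`).
For m ≥ 1 the idempotents C₊ and C₋ cut out of it one line each, spanned by P_m⁺ and P_m⁻; for m = 0
only constants occur.

Analysis. Adjointness (`form_T1`, `form_T0`) reduces to ∫ R dx/x = 0 for functions R antisymmetric
under x ↦ x⁻¹ or x ↦ q x⁻¹. After truncation of the infinite products R is rational with poles at
prescribed points, and the vanishing follows from a substitution, partial fractions and the winding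
numbers of C around the poles (`curveInt_div_eq_zero_of_antisymm`). Uniform convergence on C passes
to the limit.

Conclusion. From ⟨Yf, Y′g⟩ = ⟨f, g⟩ and γ′_j = γ_j⁻¹, different components are orthogonal; the
eigenvalues of T₁ separate the signs. For non-degeneracy, the denominators of Δ are absorbed into
test polynomials, and the numerators are treated on the unit circle, where ∫ |φ|² = 0 forces φ = 0.
Non-degeneracy makes the diagonal pairings non-zero, whence linear independence. On symmetric
polynomials ⟨·,·⟩ is a symmetric form, so P_m⁺ and P_m⁺′ are both orthogonal to everything symmetric
of lower degree, and they coincide. There (·,·) is also a multiple of ⟨·,·⟩, because w₀(x) + w₀(x⁻¹)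
= (1 + k₁²) w₀(x) w₀(x⁻¹). -/

lemma evalAt_add (f g : Laurent) (x : ℂ) : evalAt (f + g) x = evalAt f x + evalAt g x := by
  unfold evalAt
  rw [AddMonoidAlgebra.coeff_add, Finsupp.sum_add_index'] <;> intros <;> ring

lemma evalAt_smul (r : ℂ) (f : Laurent) (x : ℂ) : evalAt (r • f) x = r * evalAt f x := by
  unfold evalAt
  rw [AddMonoidAlgebra.coeff_smul, Finsupp.sum_smul_index' (by simp), Finsupp.mul_sum]
  simp [mul_assoc]

/-- Evaluation at a point, as a linear map. -/
def evalLin (x : ℂ) : Laurent →ₗ[ℂ] ℂ where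
  toFun f := evalAt f x
  map_add' f g := evalAt_add f g x
  map_smul' r f := evalAt_smul r f x

lemma evalAt_sub (f g : Laurent) (x : ℂ) : evalAt (f - g) x = evalAt f x - evalAt g x :=
  map_sub (evalLin x) f g

lemma evalAt_zero (x : ℂ) : evalAt 0 x = 0 := map_zero (evalLin x)

lemma evalAt_T (n : ℤ) (x : ℂ) : evalAt (T n) x = x ^ n := by
  change (Finsupp.single n (1 : ℂ)).sum (fun n c => c * x ^ n) = _
  simp

lemma evalAt_C_mul_T (r : ℂ) (n : ℤ) (x : ℂ) : evalAt (C r * T n) x = r * x ^ n := by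
  rw [← smul_eq_C_mul, evalAt_smul, evalAt_T]

lemma evalAt_C (r : ℂ) (x : ℂ) : evalAt (C r) x = r := by
  have := evalAt_C_mul_T r 0 x
  simpa using this

lemma evalAt_one (x : ℂ) : evalAt 1 x = 1 := by
  have := evalAt_T 0 x
  simpa using this

lemma evalAt_mul (f g : Laurent) {x : ℂ} (hx : x ≠ 0) :
    evalAt (f * g) x = evalAt f x * evalAt g x := by
  induction f using LaurentPolynomial.induction_on' with
  | add f f' hf hf' => rw [add_mul, evalAt_add, hf, hf', evalAt_add, add_mul]
  | C_mul_T n r =>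
    induction g using LaurentPolynomial.induction_on' with
    | add f f' hf hf' => rw [mul_add, evalAt_add, hf, hf', evalAt_add, mul_add]
    | C_mul_T m s =>
      rw [show (C r * T n * (C s * T m) : Laurent) = C (r * s) * T (n + m) by
        rw [T_add, C.map_mul]; ring]
      rw [evalAt_C_mul_T, evalAt_C_mul_T, evalAt_C_mul_T, zpow_add₀ hx]
      ring

/-- Evaluation at a non-zero point, as a ring homomorphism. -/
def evalHom {x : ℂ} (hx : x ≠ 0) : Laurent →+* ℂ where
  toFun f := evalAt f x
  map_add' f g := evalAt_add f g x
  map_mul' f g := evalAt_mul f g hx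
  map_one' := evalAt_one x
  map_zero' := evalAt_zero x

lemma evalAt_prod {ι : Type*} (s : Finset ι) (f : ι → Laurent) {x : ℂ} (hx : x ≠ 0) :
    evalAt (∏ i ∈ s, f i) x = ∏ i ∈ s, evalAt (f i) x :=
  map_prod (evalHom hx) f s

lemma evalAt_invert (f : Laurent) (x : ℂ) : evalAt (invert f) x = evalAt f x⁻¹ := by
  induction f using LaurentPolynomial.induction_on' with
  | add f g hf hg => rw [map_add, evalAt_add, hf, hg, evalAt_add]
  | C_mul_T n r => rw [map_mul, invert_C, invert_T, evalAt_C_mul_T, evalAt_C_mul_T]; simp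

lemma evalAt_reflection {σ : ℤ} (h : ℂ) (f : Laurent) (x : ℂ) :
    evalAt (reflection σ h f) x = evalAt f (h ^ (-2 * σ) * x⁻¹) := by
  induction f using LaurentPolynomial.induction_on' with
  | add f g hf hg => rw [map_add, evalAt_add, hf, hg, evalAt_add]
  | C_mul_T n r =>
    rw [reflection, ofMonomials_C_mul_T, ← mul_assoc, ← C.map_mul, evalAt_C_mul_T,
      evalAt_C_mul_T, mul_zpow, ← zpow_mul, inv_zpow', mul_assoc]

lemma exists_polynomial_eval (f : Laurent) : ∃ (n : ℕ) (P : Polynomial ℂ),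
    (f ≠ 0 → P ≠ 0) ∧ ∀ x : ℂ, x ≠ 0 → P.eval x = evalAt f x * x ^ n := by
  obtain ⟨n, P, hP⟩ := exists_T_pow f
  refine ⟨n, P, ?_, fun x hx => ?_⟩
  · rintro hf rfl
    apply hf
    rw [map_zero] at hP
    have := mul_T_assoc f n (-n)
    rwa [← hP, zero_mul, add_neg_cancel, T_zero, mul_one, eq_comm] at this
  · have h1 : ∀ P : Polynomial ℂ, evalAt (Polynomial.toLaurent P) x = P.eval x := by
      intro P
      induction P using Polynomial.induction_on' with
      | add p q hp hq => rw [map_add, evalAt_add, hp, hq, Polynomial.eval_add]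
      | monomial n a =>
        rw [← Polynomial.C_mul_X_pow_eq_monomial, Polynomial.toLaurent_C_mul_X_pow,
          evalAt_C_mul_T]
        simp
    rw [← h1, hP, evalAt_mul _ _ hx, evalAt_T, zpow_natCast]

/-- A power of x turns f into a polynomial with infinitely many roots. The point 0 is left out
because `evalAt f 0` is just the constant coefficient. -/
lemma eq_zero_of_infinite {f : Laurent} {s : Set ℂ} (hs : s.Infinite)
    (h : ∀ x ∈ s, x ≠ 0 → evalAt f x = 0) : f = 0 := by
  obtain ⟨n, P, hP, hev⟩ := exists_polynomial_eval f
  by_contra hf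
  refine hP hf (Polynomial.eq_zero_of_infinite_isRoot P ?_)
  refine (hs.sdiff (Set.finite_singleton 0)).mono ?_
  rintro x ⟨hx, hx0⟩
  have hx0' : x ≠ 0 := hx0
  simp only [Set.mem_ofPred_eq, Polynomial.IsRoot.def]
  rw [hev x hx0', h x hx hx0', zero_mul]

lemma eq_zero_of_mul_eq_zero {f g : Laurent} (hg : g ≠ 0)
    (h : ∀ x : ℂ, x ≠ 0 → evalAt g x * evalAt f x = 0) : f = 0 := by
  have : g * f = 0 := eq_zero_of_infinite Set.infinite_univ fun x _ hx => by
    rw [evalAt_mul _ _ hx, h x hx]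
  exact (mul_eq_zero.1 this).resolve_left hg

/-! ### The Hecke operators -/

section Hecke

variable {σ : ℤ} {h k u : ℂ}

/-- With z = h x^σ this is T = k + k⁻¹(1 − kuz)(1 + ku⁻¹z)(1 − z²)⁻¹(s − 1), multiplied by 1 − z² so
that it also holds at z² = 1. -/
lemma evalAt_heckeOperator (hσ : σ = 1 ∨ σ = -1) (hh : h ≠ 0) (hk : k ≠ 0) (hu : u ≠ 0)
    (f : Laurent) {x : ℂ} (hx : x ≠ 0) :
    (1 - (h * x ^ σ) ^ 2) * evalAt (heckeOperator σ h k u f) x =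
      (1 - (h * x ^ σ) ^ 2) * (k * evalAt f x) +
      k⁻¹ * ((1 - k * u * (h * x ^ σ)) * (1 + k * u⁻¹ * (h * x ^ σ))) *
        (evalAt f (h ^ (-2 * σ) * x⁻¹) - evalAt f x) := by
  have h1 := congrArg (evalAt · x) (dividedDifference_spec hσ hh f)
  simp only [evalAt_mul _ _ hx, evalAt_sub, evalAt_one, evalAt_C, evalAt_T,
    evalAt_reflection] at h1
  have h2 : x ^ (2 * σ) = (x ^ σ) ^ 2 := by rw [mul_comm, zpow_mul]; norm_cast
  rw [h2] at h1
  simp only [heckeOperator, LinearMap.add_apply, LinearMap.smul_apply, LinearMap.comp_apply,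
    LinearMap.mulLeft_apply, evalAt_add, evalAt_smul, evalAt_mul _ _ hx, evalAt_C, evalAt_T,
    evalAt_reflection]
  generalize evalAt (dividedDifference σ h f) x = D at *
  generalize evalAt f (h ^ (-2 * σ) * x⁻¹) = s at *
  generalize x ^ σ = y at *
  field_simp
  linear_combination (u * (k ^ 2 - 1) + k * (u ^ 2 - 1) * h * y) * h1

/-- The Laurent polynomial `1 - x ^ α`. -/
lemma one_sub_ne_zero (hσ : σ = 1 ∨ σ = -1) : (1 - C (h ^ 2) * T (2 * σ) : Laurent) ≠ 0 := by
  intro H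
  have := congrArg (fun f : Laurent => f.coeff 0) H
  rw [← T_zero, ← smul_eq_C_mul] at this
  rcases hσ with rfl | rfl <;> simp at this

lemma evalAt_one_sub (x : ℂ) :
    evalAt (1 - C (h ^ 2) * T (2 * σ)) x = 1 - (h * x ^ σ) ^ 2 := by
  rw [evalAt_sub, evalAt_one, evalAt_C_mul_T, mul_comm 2 σ, zpow_mul, mul_pow]
  norm_cast

lemma reflection_point_ne_zero (hh : h ≠ 0) {x : ℂ} (hx : x ≠ 0) : h ^ (-2 * σ) * x⁻¹ ≠ 0 :=
  mul_ne_zero (zpow_ne_zero _ hh) (inv_ne_zero hx)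

lemma reflection_point_invol (hh : h ≠ 0) (x : ℂ) :
    h ^ (-2 * σ) * (h ^ (-2 * σ) * x⁻¹)⁻¹ = x := by
  have := zpow_ne_zero (-2 * σ) hh
  rw [mul_inv, inv_inv, mul_inv_cancel_left₀ this]

lemma root_reflection (hσ : σ = 1 ∨ σ = -1) (hh : h ≠ 0) (x : ℂ) :
    h * (h ^ (-2 * σ) * x⁻¹) ^ σ = (h * x ^ σ)⁻¹ := by
  rw [mul_zpow, ← zpow_mul, show -2 * σ * σ = -2 by rcases hσ with rfl | rfl <;> norm_num,
    inv_zpow, mul_inv]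
  have : h ^ (-2 : ℤ) = h⁻¹ * h⁻¹ := by rw [zpow_neg]; norm_cast; rw [pow_two, mul_inv]
  rw [this]
  field_simp

/-- Only the values of f at x and at its reflection enter, so the relation is an identity of
rational functions in z. Two applications of T cost the factor (1 − z²)². -/
theorem heckeOperator_sq (hσ : σ = 1 ∨ σ = -1) (hh : h ≠ 0) (hk : k ≠ 0) (hu : u ≠ 0)
    (f : Laurent) :
    heckeOperator σ h k u (heckeOperator σ h k u f) =
      (k - k⁻¹) • heckeOperator σ h k u f + f := by
  rw [← sub_eq_zero]
  have h0 := one_sub_ne_zero (h := h) hσ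
  refine eq_zero_of_mul_eq_zero (pow_ne_zero 2 h0) fun x hx => ?_
  set H := heckeOperator σ h k u with hH
  have hx' := reflection_point_ne_zero (σ := σ) hh hx
  have e1 := evalAt_heckeOperator hσ hh hk hu f hx
  have e2 := evalAt_heckeOperator hσ hh hk hu (H f) hx
  have e3 := evalAt_heckeOperator hσ hh hk hu f hx'
  rw [reflection_point_invol hh, root_reflection hσ hh] at e3
  rw [pow_two, evalAt_mul _ _ hx, evalAt_one_sub, evalAt_sub, evalAt_add, evalAt_smul]
  have hz : h * x ^ σ ≠ 0 := mul_ne_zero hh (zpow_ne_zero _ hx)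
  rw [← hH] at e1 e2 e3
  generalize evalAt (H (H f)) x = A2 at *
  generalize evalAt (H f) x = A1 at *
  generalize evalAt (H f) (h ^ (-2 * σ) * x⁻¹) = B1 at *
  generalize evalAt f (h ^ (-2 * σ) * x⁻¹) = B at *
  generalize evalAt f x = A at *
  generalize h * x ^ σ = z at *
  -- At the reflected point z becomes z⁻¹; multiplication by −z² restores the factor 1 − z².
  have e3' : (1 - z ^ 2) * B1 = (1 - z ^ 2) * (k * B) -
      k⁻¹ * ((z - k * u) * (z + k * u⁻¹)) * (A - B) := by
    linear_combination (norm := (field_simp; ring)) (-z ^ 2) * e3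
  linear_combination (norm := (field_simp; ring)) (1 - z ^ 2) * e2 +
    ((1 - z ^ 2) * k⁻¹ - k⁻¹ * ((1 - k * u * z) * (1 + k * u⁻¹ * z))) * e1 +
    k⁻¹ * ((1 - k * u * z) * (1 + k * u⁻¹ * z)) * e3'

/-- An element with `T f = k f` is invariant under the reflection. -/
lemma reflection_eq_self_of_eigen (hσ : σ = 1 ∨ σ = -1) (hh : h ≠ 0) (hk : k ≠ 0) (hu : u ≠ 0)
    {f : Laurent} (hf : heckeOperator σ h k u f = k • f) : reflection σ h f = f := by
  -- Tf = kf leaves (1 − kuz)(1 + ku⁻¹z)(sf − f) = 0. Both linear factors have the form 1 + r x^σ,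
  -- and 𝒜 is a domain.
  have h1 : ∀ r : ℂ, (1 + C r * T σ : Laurent) ≠ 0 := by
    intro r H
    have := congrArg (fun f : Laurent => f.coeff 0) H
    rw [← T_zero, ← smul_eq_C_mul] at this
    rcases hσ with rfl | rfl <;> simp at this
  rw [← sub_eq_zero]
  refine eq_zero_of_mul_eq_zero (mul_ne_zero (h1 (-(k * u * h))) (h1 (k * u⁻¹ * h)))
    fun x hx => ?_
  have e1 := evalAt_heckeOperator hσ hh hk hu f hx
  rw [hf, evalAt_smul] at e1
  rw [evalAt_mul _ _ hx, evalAt_add, evalAt_add, evalAt_one, evalAt_C_mul_T, evalAt_C_mul_T,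
    evalAt_sub, evalAt_reflection]
  linear_combination (norm := (field_simp; ring)) (-k) * e1

end Hecke

/-! ### The filtration by degree and triangular operators -/

/-- The Laurent polynomials supported on the monomials of rank `< N`. -/
def filt (N : ℤ) : Submodule ℂ Laurent where
  carrier := {f | ∀ j, N ≤ rank j → f.coeff j = 0}
  add_mem' := by
    intro f g hf hg j hj
    rw [AddMonoidAlgebra.coeff_add, Finsupp.add_apply, hf j hj, hg j hj, add_zero]
  zero_mem' := by intro j _; simp
  smul_mem' := by
    intro r f hf j hj
    rw [AddMonoidAlgebra.coeff_smul, Finsupp.smul_apply, hf j hj, smul_zero]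

lemma filt_mono {M N : ℤ} (h : M ≤ N) : filt M ≤ filt N := fun _ hf j hj => hf j (h.trans hj)

lemma T_mem_filt {N j : ℤ} (h : rank j < N) : (T j : Laurent) ∈ filt N := by
  intro i hi
  rw [T_apply, if_neg]
  rintro rfl
  omega

lemma C_mul_T_mem_filt {N j : ℤ} (r : ℂ) (h : rank j < N) : (C r * T j : Laurent) ∈ filt N := by
  rw [← smul_eq_C_mul]
  exact (filt N).smul_mem r (T_mem_filt h)

lemma sum_coeff_smul_T (f : Laurent) : f.coeff.sum (fun j c => c • (T j : Laurent)) = f := by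
  induction f using LaurentPolynomial.induction_on' with
  | add f g hf hg =>
    rw [AddMonoidAlgebra.coeff_add, Finsupp.sum_add_index' (by simp) (by intros; rw [add_smul]),
      hf, hg]
  | C_mul_T n r =>
    change (Finsupp.sum (AddMonoidAlgebra.coeff (C r * T n : Laurent)) _) = _
    rw [← single_eq_C_mul_T, AddMonoidAlgebra.coeff_single, Finsupp.sum_single_index (by simp),
      single_eq_C_mul_T, smul_eq_C_mul]

lemma filt_le {N : ℤ} {S : Submodule ℂ Laurent} (h : ∀ j, rank j < N → (T j : Laurent) ∈ S) :
    filt N ≤ S := by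
  intro f hf
  rw [← sum_coeff_smul_T f]
  refine S.sum_mem fun j hj => S.smul_mem _ (h j ?_)
  by_contra hN
  exact Finsupp.mem_support_iff.1 hj (hf j (not_lt.1 hN))

lemma rank_nonneg (m : ℤ) : 0 ≤ rank m := by unfold rank; split_ifs <;> omega

lemma rank_injective : Function.Injective rank := by
  intro a b h
  unfold rank at h
  split_ifs at h <;> omega

lemma exists_rank_eq (N : ℕ) : ∃ j, rank j = N := by
  rcases Nat.even_or_odd' N with ⟨n, rfl | rfl⟩
  · exact ⟨n, by simp [rank]⟩
  · exact ⟨-n - 1, by unfold rank; split_ifs <;> omega⟩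

/-- For N ≥ 1, `filt (2 * N - 1)` is the span of the x^j with |j| < N; `filt (2 * N)` adds x^(-N),
and `filt (2 * N + 1)` adds x^N as well. -/
lemma rank_lt_of_abs_lt {j N : ℤ} (h : |j| < N) : rank j < 2 * N - 1 := by
  rw [abs_lt] at h
  unfold rank; split_ifs <;> omega

lemma rank_coe (m : ℕ) : rank m = 2 * m := by simp [rank]

lemma rank_neg_coe {m : ℕ} (hm : 1 ≤ m) : rank (-m) = 2 * m - 1 := by
  unfold rank; split_ifs <;> omega

lemma filt_zero {f : Laurent} (hf : f ∈ filt 0) : f = 0 := by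
  ext j
  simpa using hf j (rank_nonneg j)

lemma exists_mem_filt (f : Laurent) : ∃ N : ℕ, f ∈ filt N := by
  induction f using LaurentPolynomial.induction_on' with
  | add f g hf hg =>
    obtain ⟨M, hM⟩ := hf
    obtain ⟨N, hN⟩ := hg
    exact ⟨max M N, (filt _).add_mem (filt_mono (by simp) hM) (filt_mono (by simp) hN)⟩
  | C_mul_T n r =>
    refine ⟨(rank n).toNat + 1, C_mul_T_mem_filt r ?_⟩
    push_cast
    have := Int.self_le_toNat (rank n)
    omega

lemma sub_coeff_smul_mem_filt {j : ℤ} {f g : Laurent} (hf : f ∈ filt (rank j + 1))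
    (hg : g - T j ∈ filt (rank j)) : f - f.coeff j • g ∈ filt (rank j) := by
  have key : f - f.coeff j • (T j : Laurent) ∈ filt (rank j) := by
    intro i hi
    rw [AddMonoidAlgebra.coeff_sub, AddMonoidAlgebra.coeff_smul, Finsupp.sub_apply,
      Finsupp.smul_apply, T_apply]
    split_ifs with h
    · rw [h]; simp
    · rw [hf i, smul_zero, sub_zero]
      have : rank i ≠ rank j := fun h' => h (rank_injective h').symm
      omega
  have := (filt (rank j)).sub_mem key ((filt (rank j)).smul_mem (f.coeff j) hg)
  convert this using 1
  rw [smul_sub]; abel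

lemma isMonicOfDegree_iff {m : ℤ} {f : Laurent} :
    IsMonicOfDegree m f ↔ f - T m ∈ filt (rank m) := by
  constructor
  · rintro ⟨h1, h2⟩ j hj
    rw [AddMonoidAlgebra.coeff_sub, Finsupp.sub_apply, T_apply]
    split_ifs with h
    · rw [← h, h1, sub_self]
    · rw [h2 j, sub_zero]
      have : rank m ≠ rank j := fun h' => h (rank_injective h')
      omega
  · intro h
    have h' : ∀ j, rank m ≤ rank j → f.coeff j = if m = j then 1 else 0 := by
      intro j hj
      have := h j hj
      rw [AddMonoidAlgebra.coeff_sub, Finsupp.sub_apply, T_apply] at this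
      exact sub_eq_zero.1 this
    refine ⟨by simpa using h' m le_rfl, fun n hn => ?_⟩
    rw [h' n hn.le, if_neg]
    rintro rfl
    omega

lemma IsMonicOfDegree.mem_filt {m : ℤ} {f : Laurent} (h : IsMonicOfDegree m f) :
    f ∈ filt (rank m + 1) := fun j hj => h.2 j (by omega)

/-- `L` is triangular with respect to the monomials, with eigenvalues `g`. -/
def IsTriangular (L : Laurent →ₗ[ℂ] Laurent) (g : ℤ → ℂ) : Prop :=
  ∀ m, L (T m) - g m • T m ∈ filt (rank m)

namespace IsTriangular

variable {L : Laurent →ₗ[ℂ] Laurent} {g : ℤ → ℂ}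

lemma map_filt (hL : IsTriangular L g) {N : ℤ} {f : Laurent} (hf : f ∈ filt N) :
    L f ∈ filt N := by
  have : filt N ≤ (filt N).comap L := filt_le fun j hj => by
    rw [Submodule.mem_comap, ← sub_add_cancel (L (T j)) (g j • T j)]
    exact (filt N).add_mem (filt_mono hj.le (hL j)) ((filt N).smul_mem _ (T_mem_filt hj))
  exact this hf

lemma coeff_top (hL : IsTriangular L g) {j : ℤ} {f : Laurent} (hf : f ∈ filt (rank j + 1)) :
    (L f).coeff j = g j * f.coeff j := by
  have h1 : f - f.coeff j • T j ∈ filt (rank j) :=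
    sub_coeff_smul_mem_filt hf (by simp)
  have h2 := hL.map_filt h1 j le_rfl
  have h3 := hL j j le_rfl
  rw [map_sub, map_smul, AddMonoidAlgebra.coeff_sub, AddMonoidAlgebra.coeff_smul,
    Finsupp.sub_apply, Finsupp.smul_apply, smul_eq_mul] at h2
  rw [AddMonoidAlgebra.coeff_sub, AddMonoidAlgebra.coeff_smul,
    Finsupp.sub_apply, Finsupp.smul_apply, T_apply, if_pos rfl, smul_eq_mul, mul_one] at h3
  linear_combination h2 + f.coeff j * h3

/-- Induction from the top monomial x^j: comparing its coefficients in Lf = μf gives (g j − μ) f_j =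
0. -/
lemma eq_zero (hL : IsTriangular L g) {μ : ℂ} (N : ℕ) (hμ : ∀ j, rank j < N → g j ≠ μ)
    {f : Laurent} (hf : f ∈ filt N) (h : L f = μ • f) : f = 0 := by
  induction N with
  | zero => exact filt_zero (by simpa using hf)
  | succ N ih =>
    obtain ⟨j, hj⟩ := exists_rank_eq N
    refine ih (fun i hi => hμ i (by push_cast; omega)) ?_
    have hf' : f ∈ filt (rank j + 1) := by rw [hj]; exact_mod_cast hf
    have h1 := hL.coeff_top hf'
    rw [h, AddMonoidAlgebra.coeff_smul, Finsupp.smul_apply, smul_eq_mul] at h1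
    have h2 : f.coeff j = 0 := by
      have : (g j - μ) * f.coeff j = 0 := by linear_combination -h1
      exact (mul_eq_zero.1 this).resolve_left (sub_ne_zero.2 (hμ j (by push_cast; omega)))
    have := sub_coeff_smul_mem_filt (g := T j) hf' (by simp)
    rw [h2, zero_smul, sub_zero, hj] at this
    exact this

/-- Back substitution: on `filt N` the operator L − μ is triangular with non-zero diagonal entries g
j − μ. -/
lemma exists_solution (hL : IsTriangular L g) {μ : ℂ} (N : ℕ) (hμ : ∀ j, rank j < N → g j ≠ μ)
    {f : Laurent} (hf : f ∈ filt N) : ∃ e ∈ filt N, L e - μ • e = f := by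
  induction N generalizing f with
  | zero => exact ⟨0, zero_mem _, by simp [filt_zero (by simpa using hf : f ∈ filt 0)]⟩
  | succ N ih =>
    obtain ⟨j, hj⟩ := exists_rank_eq N
    have hgj : g j - μ ≠ 0 := sub_ne_zero.2 (hμ j (by push_cast; omega))
    have hf' : f ∈ filt (rank j + 1) := by rw [hj]; exact_mod_cast hf
    have h0 := sub_coeff_smul_mem_filt (g := T j) hf' (by simp)
    have h1 := (filt (rank j)).sub_mem h0
      ((filt (rank j)).smul_mem (f.coeff j / (g j - μ)) (hL j))
    rw [hj] at h1
    obtain ⟨e, he, hLe⟩ := ih (fun i hi => hμ i (by push_cast; omega)) h1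
    refine ⟨e + (f.coeff j / (g j - μ)) • T j, ?_, ?_⟩
    · exact (filt _).add_mem (filt_mono (by push_cast; omega) he)
        ((filt _).smul_mem _ (T_mem_filt (by push_cast; omega)))
    · rw [map_add, map_smul]
      have h2 : f.coeff j • (T j : Laurent) =
          (f.coeff j / (g j - μ)) • (g j • T j - μ • T j) := by
        rw [← sub_smul, smul_smul, div_mul_cancel₀ _ hgj]
      rw [h2] at hLe
      rw [smul_add, smul_comm μ, add_sub_add_comm, hLe]
      simp only [smul_sub]
      abel

/-- For f = x^m + e the eigenvalue equation reads (L − g m) e = −(L x^m − g m x^m). This lives on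
the monomials below x^m, where L − g m is bijective because g is injective. -/
lemma existsUnique_monic (hL : IsTriangular L g) (hg : Function.Injective g) (m : ℤ) :
    ∃! f, IsMonicOfDegree m f ∧ L f = g m • f := by
  obtain ⟨N, hN⟩ := Int.eq_ofNat_of_zero_le (rank_nonneg m)
  have hμ : ∀ j, rank j < N → g j ≠ g m := fun j hj h => by
    rw [hg h] at hj; omega
  obtain ⟨e, he, hLe⟩ := hL.exists_solution N hμ (f := -(L (T m) - g m • T m))
    ((filt _).neg_mem (hN ▸ hL m))
  refine ⟨T m + e, ⟨isMonicOfDegree_iff.2 (by rw [add_sub_cancel_left, hN]; exact he), ?_⟩, ?_⟩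
  · rw [map_add, smul_add]
    have h2 : L e = g m • e + -(L (T m) - g m • T m) := by rw [← hLe]; abel
    rw [h2]; abel
  · rintro f ⟨h1, h2⟩
    rw [← sub_eq_zero]
    refine hL.eq_zero N hμ ?_ (μ := g m) ?_
    · have := (filt (rank m)).sub_mem (isMonicOfDegree_iff.1 h1) (hN ▸ he)
      rw [← hN]; convert this using 1; abel
    · have h3 : L e = g m • e + -(L (T m) - g m • T m) := by rw [← hLe]; abel
      rw [map_sub, map_add, h2, h3]
      simp only [smul_sub, smul_add]
      abel

end IsTriangular

/-! ### Action of the Hecke operators on monomials -/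

section Hecke

variable {σ : ℤ} (h k u : ℂ)

lemma smul_add_C_mul_T_mul_mem {S : Submodule ℂ Laurent} {ι : Type*} (s : Finset ι) (r r' : ℂ)
    (f : ι → Laurent) (h1 : ∀ i ∈ s, f i ∈ S) (h2 : ∀ i ∈ s, T σ * f i ∈ S) :
    (C r + C r' * T σ) * ∑ i ∈ s, f i ∈ S := by
  rw [add_mul, mul_assoc, ← smul_eq_C_mul, ← smul_eq_C_mul, Finset.mul_sum]
  exact S.add_mem (S.smul_mem _ (S.sum_mem h1)) (S.smul_mem _ (S.sum_mem h2))

lemma T_mul_C_mul_T (i j : ℤ) (r : ℂ) : (T i * (C r * T j) : Laurent) = C r * T (i + j) := by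
  rw [T_add]; ring

/-- Modulo smaller |j| only the last summand of the divided difference, a multiple of x^(-m),
survives. Its factor −(k − k⁻¹) and the k of the reflection add up to k⁻¹. -/
lemma heckeOperator_T_of_pos (hσ : σ = 1 ∨ σ = -1) (m : ℤ) (hm : 0 < σ * m) :
    heckeOperator σ h k u (T m) - (k⁻¹ * h ^ (-2 * σ * m)) • T (-m) ∈ filt (2 * |m| - 1) := by
  obtain ⟨M, hM⟩ : ∃ M : ℕ, σ * m = M + 1 := ⟨(σ * m - 1).toNat, by omega⟩
  have hN : (σ * m).toNat = M + 1 := by omega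
  have habs : |m| = M + 1 := by
    rcases hσ with rfl | rfl
    · rw [abs_of_pos (by omega)]; omega
    · rw [abs_of_neg (by omega)]; omega
  rw [habs]
  simp only [heckeOperator, LinearMap.add_apply, LinearMap.smul_apply, LinearMap.comp_apply,
    LinearMap.mulLeft_apply, dividedDifference, reflection, ofMonomials_T, if_pos hm.le, hN]
  rw [Finset.sum_range_succ]
  have e1 : m - 2 * σ * ((M : ℤ) + 1) = -m := by
    rcases hσ with rfl | rfl <;> omega
  have e2 : -2 * ((M : ℤ) + 1) = -2 * σ * m := by rw [← hM]; ring
  rw [e1, e2]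
  have hS : (C (k - k⁻¹) + C ((u - u⁻¹) * h) * T σ) * ∑ j ∈ Finset.range M,
      C (h ^ (-2 * ((j : ℤ) + 1))) * T (m - 2 * σ * ((j : ℤ) + 1)) ∈ filt (2 * ((M : ℤ) + 1) - 1) := by
    refine smul_add_C_mul_T_mul_mem _ _ _ _ (fun j hj => C_mul_T_mem_filt _ ?_) fun j hj => ?_
    · have := Finset.mem_range.1 hj
      refine rank_lt_of_abs_lt (abs_lt.2 ?_)
      rcases hσ with rfl | rfl <;> constructor <;> omega
    · rw [T_mul_C_mul_T]
      refine C_mul_T_mem_filt _ ?_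
      have := Finset.mem_range.1 hj
      refine rank_lt_of_abs_lt (abs_lt.2 ?_)
      rcases hσ with rfl | rfl <;> constructor <;> omega
  have hT : (C ((u - u⁻¹) * h) * C (h ^ (-2 * σ * m)) * T (σ + -m) : Laurent)
      ∈ filt (2 * ((M : ℤ) + 1) - 1) := by
    rw [← C.map_mul]
    refine C_mul_T_mem_filt _ ?_
    refine rank_lt_of_abs_lt (abs_lt.2 ?_)
    rcases hσ with rfl | rfl <;> constructor <;> omega
  have := (filt (2 * ((M : ℤ) + 1) - 1)).neg_mem ((filt _).add_mem hS hT)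
  convert this using 1
  rw [T_add σ]
  simp only [smul_eq_C_mul, C.map_mul, map_sub]
  ring

/-- Here the surviving summand of the divided difference is the first one, x^m itself, and x^(-m)
comes from the reflection alone. -/
lemma heckeOperator_T_of_neg (hσ : σ = 1 ∨ σ = -1) (m : ℤ) (hm : σ * m < 0) :
    heckeOperator σ h k u (T m) - (k * h ^ (-2 * σ * m)) • T (-m) - (k - k⁻¹) • T m ∈
      filt (2 * |m| - 1) := by
  obtain ⟨M, hM⟩ : ∃ M : ℕ, -(σ * m) = M + 1 := ⟨(-(σ * m) - 1).toNat, by omega⟩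
  have hN : (-(σ * m)).toNat = M + 1 := by omega
  have habs : |m| = M + 1 := by
    rcases hσ with rfl | rfl
    · rw [abs_of_neg (by omega)]; omega
    · rw [abs_of_pos (by omega)]; omega
  rw [habs]
  simp only [heckeOperator, LinearMap.add_apply, LinearMap.smul_apply, LinearMap.comp_apply,
    LinearMap.mulLeft_apply, dividedDifference, reflection, ofMonomials_T, if_neg hm.not_ge, hN]
  rw [Finset.sum_range_succ', Nat.cast_zero, mul_zero, mul_zero, zpow_zero, C.map_one, one_mul,
    add_zero]
  have hS : (C (k - k⁻¹) + C ((u - u⁻¹) * h) * T σ) * ∑ j ∈ Finset.range M,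
      C (h ^ (2 * (((j + 1 : ℕ) : ℤ)))) * T (m + 2 * σ * (((j + 1 : ℕ) : ℤ))) ∈
        filt (2 * ((M : ℤ) + 1) - 1) := by
    refine smul_add_C_mul_T_mul_mem _ _ _ _ (fun j hj => C_mul_T_mem_filt _ ?_) fun j hj => ?_
    · have := Finset.mem_range.1 hj
      refine rank_lt_of_abs_lt (abs_lt.2 ?_)
      rcases hσ with rfl | rfl <;> constructor <;> push_cast <;> omega
    · rw [T_mul_C_mul_T]
      refine C_mul_T_mem_filt _ ?_
      have := Finset.mem_range.1 hj
      refine rank_lt_of_abs_lt (abs_lt.2 ?_)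
      rcases hσ with rfl | rfl <;> constructor <;> push_cast <;> omega
  have hT : (C ((u - u⁻¹) * h) * T (σ + m) : Laurent) ∈ filt (2 * ((M : ℤ) + 1) - 1) := by
    refine C_mul_T_mem_filt _ ?_
    refine rank_lt_of_abs_lt (abs_lt.2 ?_)
    rcases hσ with rfl | rfl <;> constructor <;> omega
  have := (filt (2 * ((M : ℤ) + 1) - 1)).add_mem hS hT
  convert this using 1
  rw [T_add σ]
  simp only [smul_eq_C_mul, C.map_mul, map_sub]
  ring

lemma heckeOperator_one : heckeOperator σ h k u 1 = k • 1 := by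
  have h1 : reflection σ h 1 = 1 := by
    rw [← T_zero, reflection, ofMonomials_T, mul_zero, zpow_zero, C.map_one, one_mul, neg_zero]
  have h2 : dividedDifference σ h 1 = 0 := by
    rw [← T_zero]
    simp only [dividedDifference, ofMonomials_T]
    simp
  simp only [heckeOperator, LinearMap.add_apply, LinearMap.smul_apply, LinearMap.comp_apply, h1, h2,
    map_zero, add_zero]

end Hecke

/-! ### Admissible parameters, triangularity of Y, and the centre -/

namespace Params

/-- The conditions under which the polynomials `P_m`, `P_m⁺`, `P_m⁻` are well defined. -/
structure Admissible (r : Params) : Prop where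
  k0_ne : r.k0 ≠ 0
  k1_ne : r.k1 ≠ 0
  u0_ne : r.u0 ≠ 0
  u1_ne : r.u1 ≠ 0
  qh_ne : r.qh ≠ 0
  one_add_ne : 1 + r.k1 ^ 2 ≠ 0
  gam_injective : Function.Injective r.gam

variable {r : Params}

lemma Generic.qh_ne (hp : r.Generic) : r.qh ≠ 0 := by
  intro h
  have := hp.q_pos
  simp [q, h] at this

lemma Generic.admissible (hp : r.Generic) : r.Admissible where
  k0_ne := hp.k0_ne
  k1_ne := hp.k1_ne
  u0_ne := hp.u0_ne
  u1_ne := hp.u1_ne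
  qh_ne := hp.qh_ne
  one_add_ne h := (hp.k1_sq 0).2 (by rw [zpow_zero]; linear_combination h)
  gam_injective := hp.gam_injective

lemma gam_inv (r : Params) (m : ℤ) : r.inv.gam m = (r.gam m)⁻¹ := by
  simp [gam, inv, q, mul_comm]

/-- `Generic` is lost under inversion, since |q⁻¹| > 1. The algebraic part therefore rests on
`Admissible`, which is stable and so serves both families at once. -/
lemma Admissible.inv (hr : r.Admissible) : r.inv.Admissible where
  k0_ne := inv_ne_zero hr.k0_ne
  k1_ne := inv_ne_zero hr.k1_ne
  u0_ne := inv_ne_zero hr.u0_ne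
  u1_ne := inv_ne_zero hr.u1_ne
  qh_ne := inv_ne_zero hr.qh_ne
  one_add_ne h := hr.one_add_ne (by
    have h0 := hr.k1_ne
    have h' : 1 + (r.k1⁻¹) ^ 2 = 0 := h
    field_simp at h'
    linear_combination h')
  gam_injective a b h := hr.gam_injective (inv_injective (by rwa [gam_inv, gam_inv] at h))

namespace Admissible

variable (hr : r.Admissible)
include hr

lemma gam_ne_zero (m : ℤ) : r.gam m ≠ 0 := by
  have h1 := zpow_ne_zero (eps m) hr.k0_ne
  have h2 := zpow_ne_zero (eps m) hr.k1_ne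
  have h3 : r.q ^ m ≠ 0 := zpow_ne_zero m (pow_ne_zero 2 hr.qh_ne)
  exact mul_ne_zero (mul_ne_zero h1 h2) h3

omit hr in
lemma gam_neg {m : ℕ} (hm : 1 ≤ m) : r.gam (-m) = (r.gam m)⁻¹ := by
  have h1 : eps (-(m : ℤ)) = -1 := by unfold eps; rw [if_neg]; omega
  have h2 : eps (m : ℤ) = 1 := by unfold eps; rw [if_pos]; omega
  simp [gam, h1, h2, mul_comm]

lemma T1_sq (f : Laurent) : r.T1 (r.T1 f) = (r.k1 - r.k1⁻¹) • r.T1 f + f :=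
  heckeOperator_sq (Or.inl rfl) one_ne_zero hr.k1_ne hr.u1_ne f

lemma T0_sq (f : Laurent) : r.T0 (r.T0 f) = (r.k0 - r.k0⁻¹) • r.T0 f + f :=
  heckeOperator_sq (Or.inr rfl) hr.qh_ne hr.k0_ne hr.u0_ne f

omit hr in
lemma T1_T {m : ℕ} (hm : 1 ≤ m) : r.T1 (T m) - r.k1⁻¹ • T (-m) ∈ filt (2 * m - 1) := by
  simpa [T1] using heckeOperator_T_of_pos 1 r.k1 r.u1 (Or.inl rfl) m (by omega)

omit hr in
lemma T1_T_neg {m : ℕ} (hm : 1 ≤ m) :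
    r.T1 (T (-m)) - r.k1 • T m - (r.k1 - r.k1⁻¹) • T (-m) ∈ filt (2 * m - 1) := by
  simpa [T1] using heckeOperator_T_of_neg 1 r.k1 r.u1 (Or.inl rfl) (-m) (by omega)

omit hr in
lemma T1_one : r.T1 1 = r.k1 • 1 := heckeOperator_one _ _ _

omit hr in
lemma T0_one : r.T0 1 = r.k0 • 1 := heckeOperator_one _ _ _

omit hr in
lemma qh_zpow (m : ℤ) : r.qh ^ (2 * m) = r.q ^ m := by
  rw [zpow_mul]; rfl

omit hr in
lemma T0_T {m : ℕ} (hm : 1 ≤ m) :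
    r.T0 (T m) - (r.k0 * r.q ^ (m : ℤ)) • T (-m) - (r.k0 - r.k0⁻¹) • T m
      ∈ filt (2 * m - 1) := by
  have := heckeOperator_T_of_neg r.qh r.k0 r.u0 (Or.inr rfl) m (by omega)
  rw [show -2 * (-1) * (m : ℤ) = 2 * m by ring, qh_zpow, Nat.abs_cast] at this
  exact this

omit hr in
lemma T0_T_neg {m : ℕ} (hm : 1 ≤ m) :
    r.T0 (T (-m)) - (r.k0⁻¹ * r.q ^ (-m : ℤ)) • T m ∈ filt (2 * m - 1) := by
  have := heckeOperator_T_of_pos r.qh r.k0 r.u0 (Or.inr rfl) (-m) (by omega)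
  rw [show -2 * (-1) * (-m : ℤ) = 2 * -m by ring, qh_zpow, abs_neg, Nat.abs_cast, neg_neg] at this
  exact this

omit hr in
-- `filt (2 * m + 1)` is spanned by the x^j with |j| ≤ m. T₁ respects these spaces but not the order
-- ≺, as T₁ x^(-m) contains k₁ x^m.
lemma T1_mem_filt (m : ℕ) {f : Laurent} (hf : f ∈ filt (2 * m + 1)) : r.T1 f ∈ filt (2 * m + 1) := by
  have : filt (2 * m + 1) ≤ (filt (2 * m + 1)).comap r.T1 := filt_le fun j hj => by
    rw [Submodule.mem_comap]
    obtain ⟨n, rfl | rfl⟩ := Int.eq_nat_or_neg j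
    · rcases Nat.eq_zero_or_pos n with rfl | hn
      · rw [Nat.cast_zero, T_zero, T1_one, ← T_zero]
        exact Submodule.smul_mem _ _ (T_mem_filt (by simpa using hj))
      rw [rank_coe] at hj
      have h1 := filt_mono (by omega : 2 * (n : ℤ) - 1 ≤ 2 * m + 1) (T1_T (r := r) hn)
      have h2 := (filt (2 * m + 1)).smul_mem r.k1⁻¹
        (T_mem_filt (j := -n) (by rw [rank_neg_coe hn]; omega))
      simpa using add_mem h1 h2
    · rcases Nat.eq_zero_or_pos n with rfl | hn
      · rw [Nat.cast_zero, neg_zero, T_zero, T1_one, ← T_zero]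
        exact Submodule.smul_mem _ _ (T_mem_filt (by simpa using hj))
      rw [rank_neg_coe hn] at hj
      have h1 := filt_mono (by omega : 2 * (n : ℤ) - 1 ≤ 2 * m + 1) (T1_T_neg (r := r) hn)
      have h2 := (filt (2 * m + 1)).smul_mem r.k1
        (T_mem_filt (j := n) (by rw [rank_coe]; omega))
      have h3 := (filt (2 * m + 1)).smul_mem (r.k1 - r.k1⁻¹)
        (T_mem_filt (j := -n) (by rw [rank_neg_coe hn]; omega))
      simpa using add_mem (add_mem h1 h3) h2
  exact this hf

omit hr in
-- Modulo smaller |j|, T₀ sends x^(-m) to k₀⁻¹q^(-m) x^m and T₁ sends x^m to k₁⁻¹ x^(-m), so Y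
-- multiplies x^(-m) by γ_{-m}. The x^m-coefficient of Y x^m arises only along x^m → x^(-m) → x^m
-- and equals k₀k₁q^m. The rest is a multiple of x^(-m), which precedes x^m.
lemma isTriangular_Y : IsTriangular r.Y r.gam := by
  intro m
  obtain ⟨n, rfl | rfl⟩ := Int.eq_nat_or_neg m
  · rcases Nat.eq_zero_or_pos n with rfl | hn
    · rw [Nat.cast_zero, T_zero, Y, LinearMap.comp_apply, T0_one, map_smul, T1_one, smul_smul]
      simp [gam, eps]
    have hr1 : ∀ f ∈ filt (2 * (n : ℤ) - 1), r.T1 f ∈ filt (2 * (n : ℤ) - 1) := fun f hf => by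
      have := T1_mem_filt (r := r) (n - 1) (f := f) (by convert hf using 2; omega)
      convert this using 2; omega
    rw [rank_coe]
    have hsub : filt (2 * (n : ℤ) - 1) ≤ filt (2 * n) := filt_mono (by omega)
    have h1 := hsub (hr1 _ (T0_T (r := r) hn))
    have h2 := (filt (2 * (n : ℤ))).smul_mem (r.k0 * r.q ^ (n : ℤ)) (hsub (T1_T_neg (r := r) hn))
    have h3 := (filt (2 * (n : ℤ))).smul_mem (r.k0 - r.k0⁻¹) (hsub (T1_T (r := r) hn))
    have h4 : (T (-n) : Laurent) ∈ filt (2 * n) := T_mem_filt (by rw [rank_neg_coe hn]; omega)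
    have h5 := (filt (2 * (n : ℤ))).smul_mem
      (r.k0 * r.q ^ (n : ℤ) * (r.k1 - r.k1⁻¹) + (r.k0 - r.k0⁻¹) * r.k1⁻¹) h4
    have := add_mem (add_mem (add_mem h1 h2) h3) h5
    convert this using 1
    have he : eps (n : ℤ) = 1 := by unfold eps; rw [if_pos]; omega
    simp only [Y, LinearMap.comp_apply, map_sub, map_smul, gam, he, zpow_one]
    module
  · rcases Nat.eq_zero_or_pos n with rfl | hn
    · rw [Nat.cast_zero, neg_zero, T_zero, Y, LinearMap.comp_apply, T0_one, map_smul, T1_one,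
        smul_smul]
      simp [gam, eps]
    have hr1 : ∀ f ∈ filt (2 * (n : ℤ) - 1), r.T1 f ∈ filt (2 * (n : ℤ) - 1) := fun f hf => by
      have := T1_mem_filt (r := r) (n - 1) (f := f) (by convert hf using 2; omega)
      convert this using 2; omega
    rw [rank_neg_coe hn]
    have h1 := hr1 _ (T0_T_neg (r := r) hn)
    have h2 := (filt (2 * (n : ℤ) - 1)).smul_mem (r.k0⁻¹ * r.q ^ (-n : ℤ)) (T1_T (r := r) hn)
    have := add_mem h1 h2
    convert this using 1
    have he : eps (-n : ℤ) = -1 := by unfold eps; rw [if_neg]; omega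
    simp only [Y, LinearMap.comp_apply, map_sub, map_smul, gam, he, zpow_neg_one]
    module

theorem existsUnique_nonsymmetric (m : ℤ) : ∃! f, r.IsNonsymmetric m f :=
  isTriangular_Y.existsUnique_monic hr.gam_injective m

lemma nonsymmetric_spec (m : ℤ) : r.IsNonsymmetric m (r.nonsymmetric m) :=
  Classical.epsilon_spec (hr.existsUnique_nonsymmetric m).exists

/-- The eigenspaces of the central element `Y + Y⁻¹` are stable under `T₁`. -/
lemma central_T1_apply {f : Laurent} {c : ℂ}
    (hf : r.T1 (r.T0 f) + r.T0 (r.T1 f) = (r.k1 - r.k1⁻¹) • r.T0 f +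
      (r.k0 - r.k0⁻¹) • r.T1 f + c • f) :
    r.T1 (r.T0 (r.T1 f)) + r.T0 (r.T1 (r.T1 f)) = (r.k1 - r.k1⁻¹) • r.T0 (r.T1 f) +
      (r.k0 - r.k0⁻¹) • r.T1 (r.T1 f) + c • r.T1 f := by
  have h := congrArg r.T1 hf
  simp only [map_add, map_smul, hr.T1_sq] at h ⊢
  linear_combination (exp := 1) h

/-- The quadratic relations give Y⁻¹ = (T₀ − (k₀ − k₀⁻¹))(T₁ − (k₁ − k₁⁻¹)). The conclusion is (Y +
Y⁻¹) f = (c + c⁻¹) f with this product expanded, so that no inverse operator has to be introduced.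
-/
lemma central_of_eigen {f : Laurent} {c : ℂ} (hc : c ≠ 0) (hf : r.Y f = c • f) :
    r.T1 (r.T0 f) + r.T0 (r.T1 f) = (r.k1 - r.k1⁻¹) • r.T0 f +
      (r.k0 - r.k0⁻¹) • r.T1 f + (c + c⁻¹ - (r.k0 - r.k0⁻¹) * (r.k1 - r.k1⁻¹)) • f := by
  rw [Y, LinearMap.comp_apply] at hf
  have h1 : r.T0 f = c • r.T1 f - ((r.k1 - r.k1⁻¹) * c) • f := by
    have h := hr.T1_sq (r.T0 f)
    rw [hf, map_smul] at h
    rw [h]; module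
  have h2 := congrArg r.T0 h1
  rw [hr.T0_sq, map_sub, map_smul, map_smul] at h2
  have h3 : r.T0 (r.T1 f) = c⁻¹ • ((r.k0 - r.k0⁻¹) • r.T0 f + f +
      ((r.k1 - r.k1⁻¹) * c) • r.T0 f) := by
    rw [h2, sub_add_cancel, smul_smul, inv_mul_cancel₀ hc, one_smul]
  rw [hf, h3, h1]
  match_scalars <;> field_simp <;> ring

/-- Applying Y to (Y + Y⁻¹) f = (c + c⁻¹) f gives (Y − c)(Y − c⁻¹) f = 0. -/
lemma quadratic_of_central {f : Laurent} {c : ℂ} (hc : c ≠ 0)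
    (hf : r.T1 (r.T0 f) + r.T0 (r.T1 f) = (r.k1 - r.k1⁻¹) • r.T0 f +
      (r.k0 - r.k0⁻¹) • r.T1 f + (c + c⁻¹ - (r.k0 - r.k0⁻¹) * (r.k1 - r.k1⁻¹)) • f) :
    r.Y (r.Y f - c⁻¹ • f) = c • (r.Y f - c⁻¹ • f) := by
  have h1 : r.T1 (r.T0 (r.T1 (r.T0 f))) = (c + c⁻¹) • r.T1 (r.T0 f) - f := by
    have h := congrArg (fun e => r.T1 (r.T0 e)) hf
    simp only [map_add, map_smul, hr.T1_sq, hr.T0_sq] at h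
    linear_combination (norm := module) h
  simp only [Y, LinearMap.comp_apply, map_sub, map_smul, h1, smul_sub, smul_smul,
    mul_inv_cancel₀ hc, one_smul]
  module

/-! ### The components `𝒜(m)` -/

lemma sub_mem_filt (m : ℕ) : r.nonsymmetric m - T m ∈ filt (2 * m) := by
  rw [← rank_coe]
  exact isMonicOfDegree_iff.1 (hr.nonsymmetric_spec m).1

lemma sub_mem_filt_neg {m : ℕ} (hm : 1 ≤ m) :
    r.nonsymmetric (-m) - T (-m) ∈ filt (2 * m - 1) := by
  rw [← rank_neg_coe hm]
  exact isMonicOfDegree_iff.1 (hr.nonsymmetric_spec (-m)).1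

lemma neg_mem_filt {m : ℕ} (hm : 1 ≤ m) : r.nonsymmetric (-m) ∈ filt (2 * m) := by
  have := (hr.nonsymmetric_spec (-m)).1.mem_filt
  rwa [rank_neg_coe hm, sub_add_cancel] at this

/-- T₁ P_{-m} has leading term k₁ x^m. Subtracting k₁ P_m and the right multiple of P_{-m} leaves d
supported on |j| < m. By centrality (Y − γ_m)(Y − γ_m⁻¹) d = 0, but neither γ_m nor γ_m⁻¹ = γ_{-m}
is a diagonal entry of Y on these monomials, so d = 0. -/
lemma T1_nonsymmetric_neg {m : ℕ} (hm : 1 ≤ m) :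
    ∃ β : ℂ, r.T1 (r.nonsymmetric (-m)) = r.k1 • r.nonsymmetric m + β • r.nonsymmetric (-m) := by
  have hc := hr.gam_ne_zero m
  set c := r.gam m with hcdef
  set P := r.nonsymmetric m with hP
  set P' := r.nonsymmetric (-m) with hP'
  have hY : r.Y P = c • P := (hr.nonsymmetric_spec m).2
  have hY' : r.Y P' = c⁻¹ • P' := by
    have := (hr.nonsymmetric_spec (-m)).2
    rwa [gam_neg hm] at this
  have h0 : r.T1 P' - r.k1 • P ∈ filt (2 * m) := by
    have h1 := T1_mem_filt (r := r) (m - 1) (f := P' - T (-m))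
      (by convert hr.sub_mem_filt_neg hm using 2; omega)
    have hle : filt (2 * (m : ℤ) - 1) ≤ filt (2 * m) := filt_mono (by omega)
    have h1' := filt_mono (by omega : 2 * ((m - 1 : ℕ) : ℤ) + 1 ≤ 2 * m) h1
    have h2 := hle (T1_T_neg (r := r) hm)
    have h3 : (T (-m) : Laurent) ∈ filt (2 * m) := T_mem_filt (by rw [rank_neg_coe hm]; omega)
    have h4 := hr.sub_mem_filt m
    have := sub_mem (add_mem (add_mem h1' h2) ((filt (2 * (m : ℤ))).smul_mem (r.k1 - r.k1⁻¹) h3))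
      ((filt (2 * (m : ℤ))).smul_mem r.k1 h4)
    convert this using 1
    rw [map_sub]; module
  refine ⟨(r.T1 P' - r.k1 • P).coeff (-m), ?_⟩
  set β := (r.T1 P' - r.k1 • P).coeff (-m)
  have h1 : r.T1 P' - r.k1 • P - β • P' ∈ filt (2 * m - 1) := by
    rw [← rank_neg_coe hm]
    refine sub_coeff_smul_mem_filt (by rwa [rank_neg_coe hm, sub_add_cancel]) ?_
    rw [rank_neg_coe hm]
    exact hr.sub_mem_filt_neg hm
  obtain ⟨N, hN⟩ : ∃ N : ℕ, (N : ℤ) = 2 * m - 1 := ⟨2 * m - 1, by omega⟩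
  rw [← hN] at h1
  have hne : ∀ j, rank j < N → r.gam j ≠ c := fun j hj h => by
    rw [hr.gam_injective h, rank_coe] at hj; omega
  have hne' : ∀ j, rank j < N → r.gam j ≠ c⁻¹ := fun j hj h => by
    rw [← gam_neg hm] at h
    rw [hr.gam_injective h, rank_neg_coe hm] at hj; omega
  have hq : r.Y (r.Y (r.T1 P') - c⁻¹ • r.T1 P') = c • (r.Y (r.T1 P') - c⁻¹ • r.T1 P') := by
    refine hr.quadratic_of_central hc (hr.central_T1_apply ?_)
    -- The central condition is symmetric in c and c⁻¹, so the eigenvalue c⁻¹ of P_{-m} may be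
    -- exchanged for c.
    have := hr.central_of_eigen (inv_ne_zero hc) hY'
    rwa [inv_inv, add_comm c⁻¹] at this
  set d := r.T1 P' - r.k1 • P - β • P' with hd
  have he : r.Y d - c⁻¹ • d = 0 := by
    refine (isTriangular_Y (r := r)).eq_zero N hne
      (sub_mem ((isTriangular_Y (r := r)).map_filt h1) (Submodule.smul_mem _ _ h1)) ?_
    have : r.Y d - c⁻¹ • d = (r.Y (r.T1 P') - c⁻¹ • r.T1 P') - (r.k1 * (c - c⁻¹)) • P := by
      rw [hd, map_sub, map_sub, map_smul, map_smul, hY, hY']; module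
    rw [this, map_sub, hq, map_smul, hY]; module
  have hd0 : d = 0 := (isTriangular_Y (r := r)).eq_zero N hne' h1 (sub_eq_zero.1 he)
  rw [← sub_eq_zero, ← hd0, hd]; abel

lemma T1_mem_component (m : ℕ) {f : Laurent} (hf : f ∈ r.component m) :
    r.T1 f ∈ r.component m := by
  suffices r.component m ≤ (r.component m).comap r.T1 from this hf
  have hP : r.nonsymmetric m ∈ r.component m := Submodule.subset_span (by simp)
  have hP' : r.nonsymmetric (-m) ∈ r.component m := Submodule.subset_span (by simp)
  rcases Nat.eq_zero_or_pos m with rfl | hm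
  · have h1 : r.nonsymmetric (0 : ℕ) = 1 := by
      have := hr.sub_mem_filt 0
      rw [Nat.cast_zero, mul_zero] at this
      simpa [sub_eq_zero] using filt_zero this
    refine Submodule.span_le.2 ?_
    have : r.T1 1 ∈ r.component 0 := by
      rw [T1_one, ← h1]; exact Submodule.smul_mem _ _ hP
    rintro x (rfl | rfl)
    · rw [h1]; exact this
    · simp only [Nat.cast_zero, neg_zero] at *; rw [h1]; exact this
  · obtain ⟨β, hβ⟩ := hr.T1_nonsymmetric_neg hm
    have h1 : r.T1 (r.nonsymmetric (-m)) ∈ r.component m := by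
      rw [hβ]; exact add_mem (Submodule.smul_mem _ _ hP) (Submodule.smul_mem _ _ hP')
    refine Submodule.span_le.2 ?_
    rintro x (rfl | rfl)
    · have h2 : r.nonsymmetric m =
          r.k1⁻¹ • (r.T1 (r.nonsymmetric (-m)) - β • r.nonsymmetric (-m)) := by
        rw [hβ, add_sub_cancel_right, smul_smul, inv_mul_cancel₀ hr.k1_ne, one_smul]
      change r.T1 _ ∈ r.component m
      rw [h2, map_smul, map_sub, map_smul, hr.T1_sq]
      exact (r.component m).smul_mem _ (sub_mem (add_mem ((r.component m).smul_mem _ h1) hP')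
        ((r.component m).smul_mem _ h1))
    · exact h1

/-! ### The idempotents C₊, C₋ and the polynomials P_m⁺, P_m⁻ -/

section Idempotent

variable {E : Laurent →ₗ[ℂ] Laurent} {a b l : ℂ}

omit hr in
lemma eq_of_mem_component {m : ℕ} {f : Laurent} (hf : f ∈ r.component m) :
    ∃ s t : ℂ, f = s • r.nonsymmetric m + t • r.nonsymmetric (-m) := by
  obtain ⟨s, t, h⟩ := Submodule.mem_span_pair.1 hf
  exact ⟨s, t, h.symm⟩

/-- Such an f is a multiple of P_{-m}, which is not an eigenvector because T₁ P_{-m} contains k₁ P_m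
with k₁ ≠ 0. Hence a T₁-eigenvector in 𝒜(m) is determined by its eigenvalue and its x^m-coefficient.
-/
lemma eq_zero_of_mem_component {m : ℕ} (hm : 1 ≤ m) {f : Laurent} (hf : f ∈ r.component m)
    (hT : r.T1 f = l • f) (h0 : f.coeff m = 0) : f = 0 := by
  obtain ⟨s, t, rfl⟩ := eq_of_mem_component hf
  obtain ⟨β, hβ⟩ := hr.T1_nonsymmetric_neg hm
  have h1 : (r.nonsymmetric m).coeff m = 1 := (hr.nonsymmetric_spec m).1.1
  have h2 : (r.nonsymmetric (-m)).coeff m = 0 := hr.neg_mem_filt hm m (by rw [rank_coe])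
  have hs : s = 0 := by
    simpa [AddMonoidAlgebra.coeff_add, AddMonoidAlgebra.coeff_smul, h1, h2] using h0
  subst hs
  rw [zero_smul, zero_add, map_smul, hβ] at hT
  have := congrArg (fun f : Laurent => f.coeff m) hT
  simp only [AddMonoidAlgebra.coeff_add, AddMonoidAlgebra.coeff_smul, Finsupp.add_apply,
    Finsupp.smul_apply, h1, h2, smul_eq_mul, mul_zero, mul_one, add_zero] at this
  rw [(mul_eq_zero.1 this).resolve_right hr.k1_ne]
  simp

lemma map_le_component (hE : ∀ f, E f = a • (f + b • r.T1 f)) (m : ℕ) :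
    (r.component m).map E ≤ r.component m := by
  rintro _ ⟨f, hf, rfl⟩
  rw [hE]
  exact Submodule.smul_mem _ _ (add_mem hf (Submodule.smul_mem _ _ (hr.T1_mem_component m hf)))

/-- Treats C₊ and C₋ together as E = a(1 + bT₁). The x^m-coefficient of E P_{-m} is abk₁, which
explains the normalization of the witness. -/
lemma existsUnique_monic_map (ha : a ≠ 0) (hb : b ≠ 0) (hE : ∀ f, E f = a • (f + b • r.T1 f))
    (hT : ∀ f, r.T1 (E f) = l • E f) {m : ℕ} (hm : 1 ≤ m) :
    ∃! f, f ∈ (r.component m).map E ∧ IsMonicOfDegree m f := by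
  obtain ⟨β, hβ⟩ := hr.T1_nonsymmetric_neg hm
  have hk := hr.k1_ne
  refine ⟨(a * b * r.k1)⁻¹ • E (r.nonsymmetric (-m)), ⟨?_, ?_⟩, ?_⟩
  · exact Submodule.smul_mem _ _ (Submodule.mem_map_of_mem (Submodule.subset_span (by simp)))
  · rw [isMonicOfDegree_iff, rank_coe]
    have := add_mem (hr.sub_mem_filt m) ((filt (2 * (m : ℤ))).smul_mem
      ((a * b * r.k1)⁻¹ * (a * (1 + b * β))) (hr.neg_mem_filt hm))
    convert this using 1
    rw [hE, hβ]
    match_scalars <;> field_simp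
  · rintro g ⟨hg1, hg2⟩
    set f := (a * b * r.k1)⁻¹ • E (r.nonsymmetric (-m))
    have hf1 : f ∈ (r.component m).map E :=
      Submodule.smul_mem _ _ (Submodule.mem_map_of_mem (Submodule.subset_span (by simp)))
    have hf2 : f.coeff m = 1 := by
      have hc : (r.nonsymmetric m).coeff m = 1 := (hr.nonsymmetric_spec m).1.1
      have hc2 : (r.nonsymmetric (-m)).coeff m = 0 := hr.neg_mem_filt hm m (by rw [rank_coe])
      simp only [f, hE, hβ, AddMonoidAlgebra.coeff_add, AddMonoidAlgebra.coeff_smul,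
        Finsupp.add_apply, Finsupp.smul_apply, hc, hc2, smul_eq_mul]
      field_simp
      ring
    have hsub := sub_mem hg1 hf1
    obtain ⟨e, -, he⟩ := hsub
    refine sub_eq_zero.1 (hr.eq_zero_of_mem_component hm (hr.map_le_component hE m
      (sub_mem hg1 hf1)) (l := l) ?_ ?_)
    · rw [← he, hT]
    · rw [AddMonoidAlgebra.coeff_sub, Finsupp.sub_apply, hg2.1, hf2, sub_self]

end Idempotent

omit hr in
lemma Cplus_apply (f : Laurent) : r.Cplus f = (1 + r.k1 ^ 2)⁻¹ • (f + r.k1 • r.T1 f) := rfl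

omit hr in
lemma Cminus_apply (f : Laurent) :
    r.Cminus f = (1 + (r.k1 ^ 2)⁻¹)⁻¹ • (f + (-r.k1⁻¹) • r.T1 f) := by
  simp only [Cminus, LinearMap.smul_apply, LinearMap.sub_apply, LinearMap.id_apply]
  module

lemma T1_Cplus (f : Laurent) : r.T1 (r.Cplus f) = r.k1 • r.Cplus f := by
  have hk := hr.k1_ne
  rw [Cplus_apply, map_smul, map_add, map_smul, hr.T1_sq]
  match_scalars <;> field_simp
  ring

lemma T1_Cminus (f : Laurent) : r.T1 (r.Cminus f) = (-r.k1⁻¹) • r.Cminus f := by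
  have hk := hr.k1_ne
  rw [Cminus_apply, map_smul, map_add, map_smul, hr.T1_sq]
  match_scalars <;> field_simp
  ring

lemma one_add_inv_ne : 1 + (r.k1 ^ 2)⁻¹ ≠ 0 := by
  intro h
  have hk := hr.k1_ne
  field_simp at h
  exact hr.one_add_ne (by linear_combination h)

lemma Cplus_add_Cminus (f : Laurent) : r.Cplus f + r.Cminus f = f := by
  have hk := hr.k1_ne
  have h1 := hr.one_add_ne
  have h2 : (1 + (r.k1 ^ 2)⁻¹)⁻¹ = r.k1 ^ 2 * (1 + r.k1 ^ 2)⁻¹ := by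
    have h3 : r.k1 ^ 2 + 1 ≠ 0 := by rwa [add_comm]
    field_simp
    ring
  rw [Cplus_apply, Cminus_apply, h2]
  match_scalars <;> field_simp
  ring

lemma nonsymmetric_zero : r.nonsymmetric 0 = 1 := by
  have := hr.sub_mem_filt 0
  rw [Nat.cast_zero, mul_zero] at this
  simpa [sub_eq_zero] using filt_zero this

theorem existsUnique_symmetric (m : ℕ) : ∃! f, r.IsSymmetric m f := by
  rcases Nat.eq_zero_or_pos m with rfl | hm
  · refine ⟨1, ⟨⟨1, Submodule.subset_span (by simp [hr.nonsymmetric_zero]), ?_⟩, ?_⟩, ?_⟩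
    · rw [Cplus_apply, T1_one, smul_smul]
      have h1 := hr.one_add_ne
      match_scalars
      field_simp
    · rw [isMonicOfDegree_iff]; simp
    · rintro f ⟨-, hf⟩
      rw [isMonicOfDegree_iff, rank_coe, Nat.cast_zero, mul_zero] at hf
      simpa [sub_eq_zero] using filt_zero hf
  · exact hr.existsUnique_monic_map (inv_ne_zero hr.one_add_ne) hr.k1_ne Cplus_apply hr.T1_Cplus hm

theorem existsUnique_antisymmetric {m : ℕ} (hm : 1 ≤ m) : ∃! f, r.IsAntisymmetric m f :=
  hr.existsUnique_monic_map (inv_ne_zero hr.one_add_inv_ne)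
    (neg_ne_zero.2 (inv_ne_zero hr.k1_ne)) Cminus_apply hr.T1_Cminus hm

lemma Pplus_spec (m : ℕ) : r.IsSymmetric m (r.Pplus m) :=
  Classical.epsilon_spec (hr.existsUnique_symmetric m).exists

lemma Pminus_spec {m : ℕ} (hm : 1 ≤ m) : r.IsAntisymmetric m (r.Pminus m) :=
  Classical.epsilon_spec (hr.existsUnique_antisymmetric hm).exists

lemma Pplus_mem (m : ℕ) : r.Pplus m ∈ r.component m :=
  hr.map_le_component Cplus_apply m (hr.Pplus_spec m).1

lemma Pminus_mem {m : ℕ} (hm : 1 ≤ m) : r.Pminus m ∈ r.component m :=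
  hr.map_le_component Cminus_apply m (hr.Pminus_spec hm).1

lemma T1_Pplus (m : ℕ) : r.T1 (r.Pplus m) = r.k1 • r.Pplus m := by
  obtain ⟨f, -, hf⟩ := (hr.Pplus_spec m).1
  rw [← hf, hr.T1_Cplus]

lemma T1_Pminus {m : ℕ} (hm : 1 ≤ m) : r.T1 (r.Pminus m) = (-r.k1⁻¹) • r.Pminus m := by
  obtain ⟨f, -, hf⟩ := (hr.Pminus_spec hm).1
  rw [← hf, hr.T1_Cminus]

lemma Cplus_mem_span {m : ℕ} {f : Laurent} (hf : f ∈ r.component m) :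
    ∃ s : ℂ, r.Cplus f = s • r.Pplus m := by
  refine ⟨(r.Cplus f).coeff m, ?_⟩
  have h1 := (hr.Pplus_spec m).2.1
  rcases Nat.eq_zero_or_pos m with rfl | hm
  · obtain ⟨s, t, rfl⟩ := eq_of_mem_component hf
    have hP : r.Pplus 0 = 1 := by
      have := (hr.Pplus_spec 0).2
      rw [isMonicOfDegree_iff, rank_coe, Nat.cast_zero, mul_zero] at this
      simpa [sub_eq_zero] using filt_zero this
    have hC : r.Cplus 1 = 1 := by
      rw [Cplus_apply, T1_one, smul_smul]
      have h1 := hr.one_add_ne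
      match_scalars
      field_simp
    have h11 : (1 : Laurent).coeff 0 = 1 := by rw [← T_zero]; simp
    rw [Nat.cast_zero, neg_zero, hr.nonsymmetric_zero, hP, ← add_smul, map_smul, hC,
      AddMonoidAlgebra.coeff_smul, Finsupp.smul_apply, h11, smul_eq_mul, mul_one]
  · rw [← sub_eq_zero]
    refine hr.eq_zero_of_mem_component hm (l := r.k1) ?_ ?_ ?_
    · exact sub_mem (hr.map_le_component Cplus_apply m ⟨f, hf, rfl⟩)
        (Submodule.smul_mem _ _ (hr.Pplus_mem m))
    · rw [map_sub, map_smul, hr.T1_Cplus, hr.T1_Pplus]; module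
    · rw [AddMonoidAlgebra.coeff_sub, AddMonoidAlgebra.coeff_smul, Finsupp.sub_apply,
        Finsupp.smul_apply, h1, smul_eq_mul, mul_one, sub_self]

lemma Cminus_mem_span {m : ℕ} (hm : 1 ≤ m) {f : Laurent} (hf : f ∈ r.component m) :
    ∃ s : ℂ, r.Cminus f = s • r.Pminus m := by
  refine ⟨(r.Cminus f).coeff m, ?_⟩
  have h1 := (hr.Pminus_spec hm).2.1
  rw [← sub_eq_zero]
  refine hr.eq_zero_of_mem_component hm (l := -r.k1⁻¹) ?_ ?_ ?_
  · exact sub_mem (hr.map_le_component Cminus_apply m ⟨f, hf, rfl⟩)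
      (Submodule.smul_mem _ _ (hr.Pminus_mem hm))
  · rw [map_sub, map_smul, hr.T1_Cminus, hr.T1_Pminus hm]; module
  · rw [AddMonoidAlgebra.coeff_sub, AddMonoidAlgebra.coeff_smul, Finsupp.sub_apply,
      Finsupp.smul_apply, h1, smul_eq_mul, mul_one, sub_self]

/-- Split f = C₊f + C₋f. For m = 0 the component consists of constants, on which C₊ is the identity,
so no P₀⁻ is needed. -/
lemma component_le_span (m : ℕ) : r.component m ≤ Submodule.span ℂ (Set.range r.family) := by
  intro f hf
  obtain ⟨s, hs⟩ := hr.Cplus_mem_span hf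
  have h1 : r.Cplus f ∈ Submodule.span ℂ (Set.range r.family) := by
    rw [hs]
    exact Submodule.smul_mem _ _ (Submodule.subset_span ⟨Sum.inl m, rfl⟩)
  rcases Nat.eq_zero_or_pos m with rfl | hm
  · obtain ⟨s, t, rfl⟩ := eq_of_mem_component hf
    rw [Nat.cast_zero, neg_zero, hr.nonsymmetric_zero, ← add_smul] at h1 ⊢
    have hC : r.Cplus 1 = 1 := by
      rw [Cplus_apply, T1_one, smul_smul]
      have h1 := hr.one_add_ne
      match_scalars
      field_simp
    rwa [map_smul, hC] at h1
  · obtain ⟨t, ht⟩ := hr.Cminus_mem_span hm hf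
    rw [← hr.Cplus_add_Cminus f]
    refine add_mem h1 ?_
    rw [ht]
    refine Submodule.smul_mem _ _ (Submodule.subset_span ⟨Sum.inr (m - 1), ?_⟩)
    change r.Pminus (m - 1 + 1) = _
    rw [Nat.sub_add_cancel hm]

/-- Leading terms are eliminated with the P_j, each of which lies in 𝒜(|j|). Linear independence
comes later, from bi-orthogonality. -/
theorem span_family : Submodule.span ℂ (Set.range r.family) = ⊤ := by
  rw [eq_top_iff]
  rintro f -
  obtain ⟨N, hN⟩ := exists_mem_filt f
  induction N generalizing f with
  | zero => rw [filt_zero (f := f) (by simpa using hN)]; exact zero_mem _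
  | succ N ih =>
    obtain ⟨j, hj⟩ := exists_rank_eq N
    have h1 := sub_coeff_smul_mem_filt (f := f) (j := j) (by rw [hj]; exact_mod_cast hN)
      (isMonicOfDegree_iff.1 (hr.nonsymmetric_spec j).1)
    rw [hj] at h1
    rw [← sub_add_cancel f (f.coeff j • r.nonsymmetric j)]
    refine add_mem (ih h1) (Submodule.smul_mem _ _ (hr.component_le_span j.natAbs ?_))
    refine Submodule.subset_span ?_
    rcases Int.natAbs_eq j with h | h
    · left; rw [← h]
    · right; rw [Set.mem_singleton_iff, ← h]

end Admissible

end Params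

open MeasureTheory Filter Topology

/-! ### Integrals along closed Lipschitz curves -/

/-- A closed curve with a Lipschitz parametrization on `[0,1]`. -/
structure IsLoop (γ : ℝ → ℂ) : Prop where
  lipschitz : ∃ K, LipschitzOnWith K γ (Set.Icc 0 1)
  closed : γ 0 = γ 1

lemma IsJordanCurve.isLoop {γ : ℝ → ℂ} (h : IsJordanCurve γ) : IsLoop γ := ⟨h.lipschitz, h.closed⟩

lemma deriv_bound {g : ℝ → ℂ} {K : NNReal} (hg : LipschitzOnWith K g (Set.Icc 0 1)) {t : ℝ}
    (ht : t ∈ Set.Ioo (0 : ℝ) 1) : ‖deriv g t‖ ≤ K :=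
  norm_deriv_le_of_lipschitzOn (Icc_mem_nhds ht.1 ht.2) hg

lemma ae_differentiableAt {g : ℝ → ℂ} {K : NNReal} (hg : LipschitzOnWith K g (Set.Icc 0 1)) :
    ∀ᵐ t : ℝ, t ∈ Set.Ioo (0 : ℝ) 1 → DifferentiableAt ℝ g t := by
  filter_upwards [hg.ae_differentiableWithinAt_of_mem] with t h ht
  exact (h ⟨ht.1.le, ht.2.le⟩).differentiableAt (Icc_mem_nhds ht.1 ht.2)

lemma integral_congr_Ioo {f g : ℝ → ℂ} (h : ∀ᵐ t : ℝ, t ∈ Set.Ioo (0 : ℝ) 1 → f t = g t) :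
    ∫ t in (0 : ℝ)..1, f t = ∫ t in (0 : ℝ)..1, g t := by
  rw [intervalIntegral.integral_of_le zero_le_one, intervalIntegral.integral_of_le zero_le_one,
    integral_Ioc_eq_integral_Ioo, integral_Ioc_eq_integral_Ioo]
  exact setIntegral_congr_ae measurableSet_Ioo h

/-- Real and imaginary parts are absolutely continuous on [0,1], so the fundamental theorem of
calculus applies to each. -/
lemma integral_deriv_of_lipschitz {g : ℝ → ℂ} {K : NNReal} (hg : LipschitzOnWith K g (Set.Icc 0 1)) :
    ∫ t in (0 : ℝ)..1, deriv g t = g 1 - g 0 := by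
  have hint : IntervalIntegrable (deriv g) volume 0 1 := by
    rw [intervalIntegrable_iff_integrableOn_Ioo_of_le zero_le_one]
    refine Measure.integrableOn_of_bounded (M := K) (by simp)
      (measurable_deriv g).aestronglyMeasurable ?_
    rw [ae_restrict_iff' measurableSet_Ioo]
    exact Eventually.of_forall fun t ht => deriv_bound hg ht
  have key : ∀ L : ℂ →L[ℝ] ℝ, L (∫ t in (0 : ℝ)..1, deriv g t) = L (g 1 - g 0) := by
    intro L
    have h1 : AbsolutelyContinuousOnInterval (fun t => L (g t)) 0 1 := by
      refine LipschitzOnWith.absolutelyContinuousOnInterval (K := ‖L‖₊ * K) ?_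
      rw [Set.uIcc_of_le zero_le_one]
      exact L.lipschitz.comp_lipschitzOnWith hg
    rw [← L.intervalIntegral_comp_comm hint, map_sub, ← h1.integral_deriv_eq_sub]
    rw [intervalIntegral.integral_of_le zero_le_one, intervalIntegral.integral_of_le zero_le_one,
      integral_Ioc_eq_integral_Ioo, integral_Ioc_eq_integral_Ioo]
    refine setIntegral_congr_ae measurableSet_Ioo ?_
    filter_upwards [ae_differentiableAt hg] with t ht htm
    exact (L.hasFDerivAt.comp_hasDerivAt t (ht htm).hasDerivAt).deriv.symm
  exact Complex.ext (key Complex.reCLM) (key Complex.imCLM)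

namespace IsLoop

variable {γ : ℝ → ℂ} (hγ : IsLoop γ)
include hγ

lemma continuousOn : ContinuousOn γ (Set.Icc 0 1) := hγ.lipschitz.choose_spec.continuousOn

lemma isCompact_trace : IsCompact (trace γ) := isCompact_Icc.image_of_continuousOn hγ.continuousOn

lemma aestronglyMeasurable {F : ℂ → ℂ} (hF : ContinuousOn F (trace γ)) :
    AEStronglyMeasurable (fun t => F (γ t) * deriv γ t) (volume.restrict (Set.uIoc 0 1)) := by
  have h1 : ContinuousOn (fun t => F (γ t)) (Set.Icc 0 1) :=
    hF.comp hγ.continuousOn (Set.mapsTo_image _ _)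
  rw [Set.uIoc_of_le zero_le_one]
  refine AEStronglyMeasurable.mul ?_ (measurable_deriv γ).aestronglyMeasurable
  exact (h1.mono Set.Ioc_subset_Icc_self).aestronglyMeasurable measurableSet_Ioc

lemma integrand_bound : ∃ K : ℝ, 0 ≤ K ∧ ∀ (F : ℂ → ℂ) (C : ℝ), (∀ x ∈ trace γ, ‖F x‖ ≤ C) →
    ∀ᵐ t : ℝ, t ∈ Set.uIoc (0 : ℝ) 1 → ‖F (γ t) * deriv γ t‖ ≤ C * K := by
  obtain ⟨K, hK⟩ := hγ.lipschitz
  refine ⟨K, K.2, fun F C hC => ?_⟩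
  -- Outside [0,1] the curve is arbitrary, so its derivative at the endpoint 1 is not controlled.
  have h1 : ∀ᵐ t : ℝ, t ≠ 1 := by simp [ae_iff]
  filter_upwards [h1] with t ht1 ht
  rw [Set.uIoc_of_le zero_le_one] at ht
  rw [norm_mul]
  have h2 := hC (γ t) ⟨t, ⟨ht.1.le, ht.2⟩, rfl⟩
  exact mul_le_mul h2 (deriv_bound hK ⟨ht.1, lt_of_le_of_ne ht.2 ht1⟩) (norm_nonneg _)
    ((norm_nonneg _).trans h2)

lemma intervalIntegrable {F : ℂ → ℂ} (hF : ContinuousOn F (trace γ)) :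
    IntervalIntegrable (fun t => F (γ t) * deriv γ t) volume 0 1 := by
  obtain ⟨C, hC⟩ := hγ.isCompact_trace.exists_bound_of_continuousOn hF
  obtain ⟨K, -, hK⟩ := hγ.integrand_bound
  rw [intervalIntegrable_iff]
  have : IsFiniteMeasure (volume.restrict (Set.uIoc (0 : ℝ) 1)) := ⟨by simp⟩
  refine Integrable.of_bound (hγ.aestronglyMeasurable hF) (C * K) ?_
  · rw [ae_restrict_iff' measurableSet_uIoc]
    exact hK F C hC

lemma curveInt_add {F G : ℂ → ℂ} (hF : ContinuousOn F (trace γ)) (hG : ContinuousOn G (trace γ)) :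
    curveInt γ (fun x => F x + G x) = curveInt γ F + curveInt γ G := by
  unfold curveInt
  rw [← intervalIntegral.integral_add (hγ.intervalIntegrable hF) (hγ.intervalIntegrable hG)]
  simp only [add_mul]

lemma curveInt_sub {F G : ℂ → ℂ} (hF : ContinuousOn F (trace γ)) (hG : ContinuousOn G (trace γ)) :
    curveInt γ (fun x => F x - G x) = curveInt γ F - curveInt γ G := by
  unfold curveInt
  rw [← intervalIntegral.integral_sub (hγ.intervalIntegrable hF) (hγ.intervalIntegrable hG)]
  simp only [sub_mul]

omit hγ in
lemma curveInt_const_mul (c : ℂ) (F : ℂ → ℂ) :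
    curveInt γ (fun x => c * F x) = c * curveInt γ F := by
  unfold curveInt
  rw [← intervalIntegral.integral_const_mul]
  simp only [mul_assoc]

omit hγ in
lemma curveInt_congr {F G : ℂ → ℂ} (h : ∀ x ∈ trace γ, F x = G x) :
    curveInt γ F = curveInt γ G := by
  unfold curveInt
  refine intervalIntegral.integral_congr fun t ht => ?_
  rw [Set.uIcc_of_le zero_le_one] at ht
  exact congrArg (· * deriv γ t) (h _ ⟨t, ht, rfl⟩)

lemma curveInt_bound : ∃ K : ℝ, 0 ≤ K ∧ ∀ (F : ℂ → ℂ) (C : ℝ), (∀ x ∈ trace γ, ‖F x‖ ≤ C) →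
    ‖curveInt γ F‖ ≤ C * K := by
  obtain ⟨K, hK0, hK⟩ := hγ.integrand_bound
  refine ⟨K, hK0, fun F C hC => ?_⟩
  have := intervalIntegral.norm_integral_le_of_norm_le_const_ae (hK F C hC)
  simpa [curveInt] using this

lemma tendsto_curveInt {F : ℕ → ℂ → ℂ} {G : ℂ → ℂ} (hF : ∀ n, ContinuousOn (F n) (trace γ))
    (h : TendstoUniformlyOn F G atTop (trace γ)) :
    Tendsto (fun n => curveInt γ (F n)) atTop (𝓝 (curveInt γ G)) := by
  have hG : ContinuousOn G (trace γ) := h.continuousOn (Frequently.of_forall hF)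
  obtain ⟨K, hK0, hK⟩ := hγ.curveInt_bound
  rw [Metric.tendsto_atTop]
  intro ε hε
  rw [Metric.tendstoUniformlyOn_iff] at h
  have hε' : 0 < ε / (K + 1) := by positivity
  obtain ⟨N, hN⟩ := eventually_atTop.1 (h _ hε')
  refine ⟨N, fun n hn => ?_⟩
  rw [dist_eq_norm, ← hγ.curveInt_sub (hF n) hG]
  refine (hK _ (ε / (K + 1)) fun x hx => ?_).trans_lt ?_
  · rw [← dist_eq_norm, dist_comm]; exact (hN n hn x hx).le
  · rw [div_mul_eq_mul_div, div_lt_iff₀ (by positivity)]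
    nlinarith

lemma comp_lipschitz {g : ℂ → ℂ} (hg : LocallyLipschitzOn (trace γ) g) : IsLoop (fun t => g (γ t)) := by
  obtain ⟨K, hK⟩ := hγ.lipschitz
  obtain ⟨L, hL⟩ := hg.exists_lipschitzOnWith_of_compact hγ.isCompact_trace
  exact ⟨⟨L * K, hL.comp hK (Set.mapsTo_image _ _)⟩, by simp only [hγ.closed]⟩

lemma comp_analytic {g : ℂ → ℂ} (hg : ∀ x ∈ trace γ, ContDiffAt ℂ 1 g x) :
    IsLoop (fun t => g (γ t)) := by
  refine hγ.comp_lipschitz fun x hx => ?_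
  obtain ⟨K, t, ht, h⟩ := (hg x hx).exists_lipschitzOnWith
  exact ⟨K, t ∩ trace γ, inter_mem (mem_nhdsWithin_of_mem_nhds ht) self_mem_nhdsWithin,
    h.mono Set.inter_subset_left⟩

lemma ae_deriv_comp {g : ℂ → ℂ} (hg : ∀ x ∈ trace γ, ContDiffAt ℂ 1 g x) :
    ∀ᵐ t : ℝ, t ∈ Set.Ioo (0 : ℝ) 1 → deriv (fun t => g (γ t)) t = deriv g (γ t) * deriv γ t := by
  obtain ⟨K, hK⟩ := hγ.lipschitz
  filter_upwards [ae_differentiableAt hK] with t ht htm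
  have h1 := ((hg (γ t) ⟨t, ⟨htm.1.le, htm.2.le⟩, rfl⟩).differentiableAt one_ne_zero).hasDerivAt
  have h2 := (h1.scomp t (ht htm).hasDerivAt).deriv
  rw [smul_eq_mul, mul_comm] at h2
  exact h2

/-- Integrals of derivatives along loops vanish. -/
lemma curveInt_deriv {g : ℂ → ℂ} (hg : ∀ x ∈ trace γ, ContDiffAt ℂ 1 g x) :
    curveInt γ (deriv g) = 0 := by
  have h1 := hγ.comp_analytic hg
  obtain ⟨L, hL⟩ := h1.lipschitz
  have := integral_deriv_of_lipschitz hL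
  rw [integral_congr_Ioo (hγ.ae_deriv_comp hg), hγ.closed, sub_self] at this
  exact this

/-- Change of variables. -/
lemma curveInt_comp {g : ℂ → ℂ} (hg : ∀ x ∈ trace γ, ContDiffAt ℂ 1 g x) (F : ℂ → ℂ) :
    curveInt (fun t => g (γ t)) F = curveInt γ (fun x => F (g x) * deriv g x) := by
  refine integral_congr_Ioo ?_
  filter_upwards [hγ.ae_deriv_comp hg] with t ht htm
  rw [ht htm, mul_assoc]

end IsLoop

/-! ### Rational functions with prescribed poles -/

/-- The product of the `(x - z)⁻¹`, where `z` runs through a multiset. -/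
def poleProd (s : Multiset ℂ) (x : ℂ) : ℂ := (s.map fun z => (x - z)⁻¹).prod

lemma poleProd_zero (x : ℂ) : poleProd 0 x = 1 := by simp [poleProd]

lemma poleProd_cons (z : ℂ) (s : Multiset ℂ) (x : ℂ) :
    poleProd (z ::ₘ s) x = (x - z)⁻¹ * poleProd s x := by simp [poleProd]

lemma poleProd_add (s t : Multiset ℂ) (x : ℂ) :
    poleProd (s + t) x = poleProd s x * poleProd t x := by simp [poleProd]

lemma poleProd_replicate (n : ℕ) (z x : ℂ) :
    poleProd (Multiset.replicate n z) x = (x - z)⁻¹ ^ n := by simp [poleProd]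

lemma poleProd_mul_eval (s : Multiset ℂ) {x : ℂ} (hx : ∀ z ∈ s, x ≠ z) :
    poleProd s x * ((s.map fun z => (Polynomial.X - Polynomial.C z)).prod).eval x = 1 := by
  induction s using Multiset.induction_on with
  | empty => simp [poleProd_zero]
  | cons z s ih =>
    have h1 := ih fun z hz => hx z (Multiset.mem_cons_of_mem hz)
    have h2 := sub_ne_zero.2 (hx z (Multiset.mem_cons_self z s))
    rw [poleProd_cons, Multiset.map_cons, Multiset.prod_cons, Polynomial.eval_mul]
    simp only [Polynomial.eval_sub, Polynomial.eval_X, Polynomial.eval_C]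
    rw [mul_mul_mul_comm, h1, inv_mul_cancel₀ h2, mul_one]

lemma continuousOn_poleProd {K : Set ℂ} (s : Multiset ℂ) (hs : ∀ z ∈ s, z ∉ K) :
    ContinuousOn (poleProd s) K := by
  induction s using Multiset.induction_on with
  | empty => exact continuousOn_const.congr fun x _ => poleProd_zero x
  | cons z s ih =>
    refine ContinuousOn.congr (f := fun x => (x - z)⁻¹ * poleProd s x) ?_
      fun x _ => poleProd_cons z s x
    refine ContinuousOn.mul ?_ (ih fun z hz => hs z (Multiset.mem_cons_of_mem hz))
    refine (continuousOn_id.sub continuousOn_const).inv₀ fun x hx => sub_ne_zero.2 ?_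
    rintro rfl
    exact hs _ (Multiset.mem_cons_self _ s) hx

/-- On `K`, the function `F` is a rational function with poles in `S`. -/
def IsRational (K S : Set ℂ) (F : ℂ → ℂ) : Prop :=
  ∃ (P : Polynomial ℂ) (s : Multiset ℂ), (∀ z ∈ s, z ∈ S) ∧
    ∀ x ∈ K, F x = P.eval x * poleProd s x

namespace IsRational

variable {K S : Set ℂ} {F G : ℂ → ℂ}

lemma polynomial (P : Polynomial ℂ) : IsRational K S (fun x => P.eval x) :=
  ⟨P, 0, by simp, by simp [poleProd_zero]⟩

lemma const (c : ℂ) : IsRational K S (fun _ => c) := by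
  simpa using polynomial (K := K) (S := S) (Polynomial.C c)

lemma id : IsRational K S (fun x => x) := by
  simpa using polynomial (K := K) (S := S) Polynomial.X

lemma sub_inv {z : ℂ} (hz : z ∈ S) : IsRational K S (fun x => (x - z)⁻¹) :=
  ⟨1, {z}, by simpa using hz, by simp [poleProd]⟩

lemma congr (hF : IsRational K S F) (h : ∀ x ∈ K, G x = F x) : IsRational K S G := by
  obtain ⟨P, s, hs, hP⟩ := hF
  exact ⟨P, s, hs, fun x hx => by rw [h x hx, hP x hx]⟩

lemma mul (hF : IsRational K S F) (hG : IsRational K S G) :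
    IsRational K S (fun x => F x * G x) := by
  obtain ⟨P, s, hs, hP⟩ := hF
  obtain ⟨Q, t, ht, hQ⟩ := hG
  refine ⟨P * Q, s + t, fun z hz => ?_, fun x hx => ?_⟩
  · rcases Multiset.mem_add.1 hz with h | h
    exacts [hs z h, ht z h]
  · beta_reduce
    rw [hP x hx, hQ x hx, poleProd_add, Polynomial.eval_mul]; ring

lemma add (hKS : ∀ z ∈ S, z ∉ K) (hF : IsRational K S F) (hG : IsRational K S G) :
    IsRational K S (fun x => F x + G x) := by
  obtain ⟨P, s, hs, hP⟩ := hF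
  obtain ⟨Q, t, ht, hQ⟩ := hG
  refine ⟨P * (t.map fun z => (Polynomial.X - Polynomial.C z)).prod +
    Q * (s.map fun z => (Polynomial.X - Polynomial.C z)).prod, s + t, fun z hz => ?_,
    fun x hx => ?_⟩
  · rcases Multiset.mem_add.1 hz with h | h
    exacts [hs z h, ht z h]
  · have h1 := poleProd_mul_eval s (x := x) fun z hz h => hKS z (hs z hz) (h ▸ hx)
    have h2 := poleProd_mul_eval t (x := x) fun z hz h => hKS z (ht z hz) (h ▸ hx)
    beta_reduce
    rw [hP x hx, hQ x hx, poleProd_add, Polynomial.eval_add, Polynomial.eval_mul,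
      Polynomial.eval_mul]
    linear_combination (-P.eval x * poleProd s x) * h2 + (-Q.eval x * poleProd t x) * h1

lemma sub (hKS : ∀ z ∈ S, z ∉ K) (hF : IsRational K S F) (hG : IsRational K S G) :
    IsRational K S (fun x => F x - G x) :=
  (hF.add hKS ((const (-1)).mul hG)).congr fun x _ => by ring

lemma prod {ι : Type*} (s : Finset ι) {f : ι → ℂ → ℂ} (h : ∀ i ∈ s, IsRational K S (f i)) :
    IsRational K S (fun x => ∏ i ∈ s, f i x) := by
  classical
  induction s using Finset.induction_on with
  | empty => simpa using const (K := K) (S := S) 1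
  | insert a s ha ih =>
    refine ((h a (Finset.mem_insert_self a s)).mul
      (ih fun i hi => h i (Finset.mem_insert_of_mem hi))).congr fun x _ => ?_
    rw [Finset.prod_insert ha]

lemma continuousOn (hKS : ∀ z ∈ S, z ∉ K) (hF : IsRational K S F) : ContinuousOn F K := by
  obtain ⟨P, s, hs, hP⟩ := hF
  refine ContinuousOn.congr (P.continuous.continuousOn.mul
    (continuousOn_poleProd s fun z hz => hKS z (hs z hz))) hP

lemma mono {K' S' : Set ℂ} (hK : K' ⊆ K) (hS : S ⊆ S') (hF : IsRational K S F) :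
    IsRational K' S' F := by
  obtain ⟨P, s, hs, hP⟩ := hF
  exact ⟨P, s, fun z hz => hS (hs z hz), fun x hx => hP x (hK hx)⟩

lemma inv (h0 : (0 : ℂ) ∈ S) : IsRational K S (fun x => x⁻¹) := by
  simpa using sub_inv (K := K) h0

lemma laurent (h0 : (0 : ℂ) ∈ S) (hK : (0 : ℂ) ∉ K) (f : Laurent) :
    IsRational K S (fun x => evalAt f x) := by
  obtain ⟨n, P, -, hP⟩ := exists_polynomial_eval f
  refine ⟨P, Multiset.replicate n 0, fun z hz => Multiset.eq_of_mem_replicate hz ▸ h0,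
    fun x hx => ?_⟩
  have hx0 : x ≠ 0 := fun h => hK (h ▸ hx)
  rw [hP x hx0, poleProd_replicate, sub_zero, mul_assoc, ← mul_pow, mul_inv_cancel₀ hx0, one_pow,
    mul_one]

/-- `(1 - e x)⁻¹` -/
lemma one_sub_mul_inv {e : ℂ} (he : e ≠ 0) (h : e⁻¹ ∈ S) :
    IsRational K S (fun x => (1 - e * x)⁻¹) := by
  refine ((const (-e⁻¹)).mul (sub_inv h)).congr fun x _ => ?_
  rw [show 1 - e * x = (-e) * (x - e⁻¹) by field_simp; ring, mul_inv, inv_neg]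

/-- `(1 - e x⁻¹)⁻¹` -/
lemma one_sub_mul_inv_inv {e : ℂ} (hK : (0 : ℂ) ∉ K) (h : e ∈ S) :
    IsRational K S (fun x => (1 - e * x⁻¹)⁻¹) := by
  refine (id.mul (sub_inv h)).congr fun x hx => ?_
  have hx0 : x ≠ 0 := fun h => hK (h ▸ hx)
  rw [show 1 - e * x⁻¹ = x⁻¹ * (x - e) by field_simp, mul_inv, inv_inv]

end IsRational

/-! ### Integrals of rational functions by partial fractions -/

section Vanishing

variable {γ₁ γ₂ : ℝ → ℂ} {S : Set ℂ}

lemma curveInt_polynomial {γ : ℝ → ℂ} (h : IsLoop γ) (P : Polynomial ℂ) :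
    curveInt γ (fun x => P.eval x) = 0 := by
  induction P using Polynomial.induction_on' with
  | add p q hp hq =>
    simp only [Polynomial.eval_add]
    rw [h.curveInt_add p.continuous.continuousOn q.continuous.continuousOn, hp, hq, add_zero]
  | monomial n a =>
    have h1 := h.curveInt_deriv (g := fun x => (a / (n + 1)) * x ^ (n + 1))
      fun x _ => by fun_prop
    rw [← h1]
    refine IsLoop.curveInt_congr fun x _ => ?_
    have hn : ((n : ℂ) + 1) ≠ 0 := by exact_mod_cast n.succ_ne_zero
    rw [deriv_const_mul_field, deriv_pow_field, Polynomial.eval_monomial]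
    push_cast
    field_simp

lemma curveInt_sub_inv_pow {γ : ℝ → ℂ} (h : IsLoop γ) {z : ℂ} (hz : z ∉ trace γ) (n : ℕ) :
    curveInt γ (fun x => (x - z)⁻¹ ^ (n + 2)) = 0 := by
  have hne : ∀ x ∈ trace γ, x - z ≠ 0 := fun x hx => sub_ne_zero.2 fun e => hz (e ▸ hx)
  have h1 := h.curveInt_deriv (g := fun x => -((n : ℂ) + 1)⁻¹ * (x - z)⁻¹ ^ (n + 1))
    fun x hx => by
      have := hne x hx
      fun_prop (disch := assumption)
  rw [← h1]
  refine IsLoop.curveInt_congr fun x hx => ?_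
  have hx := hne x hx
  have hn : ((n : ℂ) + 1) ≠ 0 := by exact_mod_cast n.succ_ne_zero
  have h2 : HasDerivAt (fun x => (x - z)⁻¹ ^ (n + 1))
      (((n + 1 : ℕ) : ℂ) * (x - z)⁻¹ ^ n * (-1 / (x - z) ^ 2)) x := by
    exact (((hasDerivAt_id' x).sub_const z).fun_inv hx).fun_pow (n + 1)
  rw [(h2.const_mul _).deriv]
  push_cast
  rw [inv_pow, inv_pow, pow_add]
  field_simp

/-- A sum of two integrals of a rational function along loops vanishes, if the sum of the winding
numbers vanishes at the poles. -/
theorem curveInt_add_eq_zero (h₁ : IsLoop γ₁) (h₂ : IsLoop γ₂)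
    (hS : ∀ z ∈ S, z ∉ trace γ₁ ∪ trace γ₂)
    (hw : ∀ z ∈ S, curveInt γ₁ (fun x => (x - z)⁻¹) + curveInt γ₂ (fun x => (x - z)⁻¹) = 0)
    {F : ℂ → ℂ} (hF : IsRational (trace γ₁ ∪ trace γ₂) S F) :
    curveInt γ₁ F + curveInt γ₂ F = 0 := by
  set K := trace γ₁ ∪ trace γ₂ with hK
  have hadd : ∀ {F G H : ℂ → ℂ}, ContinuousOn F K → ContinuousOn G K →
      (∀ x ∈ K, H x = F x + G x) → curveInt γ₁ F + curveInt γ₂ F = 0 →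
      curveInt γ₁ G + curveInt γ₂ G = 0 → curveInt γ₁ H + curveInt γ₂ H = 0 := by
    intro F G H hF hG hH h h'
    rw [IsLoop.curveInt_congr fun x hx => hH x (Or.inl hx),
      IsLoop.curveInt_congr (γ := γ₂) fun x hx => hH x (Or.inr hx),
      h₁.curveInt_add (hF.mono Set.subset_union_left) (hG.mono Set.subset_union_left),
      h₂.curveInt_add (hF.mono Set.subset_union_right) (hG.mono Set.subset_union_right)]
    linear_combination h + h'
  have hsmul : ∀ (c : ℂ) {F : ℂ → ℂ}, curveInt γ₁ F + curveInt γ₂ F = 0 →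
      curveInt γ₁ (fun x => c * F x) + curveInt γ₂ (fun x => c * F x) = 0 := by
    intro c F h
    rw [IsLoop.curveInt_const_mul, IsLoop.curveInt_const_mul, ← mul_add, h, mul_zero]
  have hcong : ∀ {F G : ℂ → ℂ}, (∀ x ∈ K, F x = G x) → curveInt γ₁ F + curveInt γ₂ F = 0 →
      curveInt γ₁ G + curveInt γ₂ G = 0 := by
    intro F G h h'
    rwa [IsLoop.curveInt_congr fun x hx => h x (Or.inl hx),
      IsLoop.curveInt_congr (γ := γ₂) fun x hx => h x (Or.inr hx)] at h'
  -- Induction on the number of poles. If all poles equal z, a simple pole is covered by `hw`, and a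
  -- higher power of (x − z)⁻¹ has a primitive. Two distinct poles are separated by (x − z)⁻¹(x −
  -- w)⁻¹ = (z − w)⁻¹((x − z)⁻¹ − (x − w)⁻¹), which lowers the number of poles.
  have hpole : ∀ (n : ℕ) (s : Multiset ℂ), s.card = n → (∀ z ∈ s, z ∈ S) →
      curveInt γ₁ (poleProd s) + curveInt γ₂ (poleProd s) = 0 := by
    intro n
    induction n with
    | zero =>
      intro s hs _
      rw [Multiset.card_eq_zero.1 hs]
      refine hcong (F := fun x => (1 : Polynomial ℂ).eval x) (fun x _ => by simp [poleProd_zero]) ?_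
      rw [curveInt_polynomial h₁, curveInt_polynomial h₂, add_zero]
    | succ n ih =>
      intro s hs hsS
      obtain ⟨z, hz⟩ := Multiset.card_pos_iff_exists_mem.1 (by omega : 0 < s.card)
      obtain ⟨t, rfl⟩ := Multiset.exists_cons_of_mem hz
      rw [Multiset.card_cons, add_left_inj] at hs
      have hzS := hsS z hz
      have htS : ∀ w ∈ t, w ∈ S := fun w hw => hsS w (Multiset.mem_cons_of_mem hw)
      by_cases ht : ∀ w ∈ t, w = z
      · rw [Multiset.eq_replicate_card.2 ht, hs, ← Multiset.replicate_succ]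
        refine hcong (F := fun x => (x - z)⁻¹ ^ (n + 1))
          (fun x _ => (poleProd_replicate _ _ _).symm) ?_
        rcases n with - | n
        · simpa using hw z hzS
        · rw [curveInt_sub_inv_pow h₁ fun h => hS z hzS (Or.inl h),
            curveInt_sub_inv_pow h₂ fun h => hS z hzS (Or.inr h), add_zero]
      · push Not at ht
        obtain ⟨w, hwt, hwz⟩ := ht
        obtain ⟨u, rfl⟩ := Multiset.exists_cons_of_mem hwt
        rw [Multiset.card_cons] at hs
        have hwS := htS w hwt
        have huS : ∀ v ∈ u, v ∈ S := fun v hv => htS v (Multiset.mem_cons_of_mem hv)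
        have h1 : ∀ v ∈ z ::ₘ u, v ∈ S := by
          intro v hv
          rcases Multiset.mem_cons.1 hv with rfl | hv
          exacts [hzS, huS v hv]
        have h2 : ∀ v ∈ w ::ₘ u, v ∈ S := by
          intro v hv
          rcases Multiset.mem_cons.1 hv with rfl | hv
          exacts [hwS, huS v hv]
        refine hadd (F := fun x => (z - w)⁻¹ * poleProd (z ::ₘ u) x)
          (G := fun x => (-(z - w)⁻¹) * poleProd (w ::ₘ u) x)
          (continuousOn_const.mul (continuousOn_poleProd _ fun v hv => hS v (h1 v hv)))
          (continuousOn_const.mul (continuousOn_poleProd _ fun v hv => hS v (h2 v hv)))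
          ?_ (hsmul _ (ih _ (by simpa using hs) h1)) (hsmul _ (ih _ (by simpa using hs) h2))
        intro x hx
        have hxz : x - z ≠ 0 := sub_ne_zero.2 fun h => hS z hzS (h ▸ hx)
        have hxw : x - w ≠ 0 := sub_ne_zero.2 fun h => hS w hwS (h ▸ hx)
        have hzw : z - w ≠ 0 := sub_ne_zero.2 (Ne.symm hwz)
        simp only [poleProd_cons]
        field_simp
        ring
  obtain ⟨P, s, hs, hP⟩ := hF
  refine hcong (fun x hx => (hP x hx).symm) ?_
  clear hP
  induction s using Multiset.induction_on generalizing P with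
  | empty =>
    refine hcong (F := fun x => P.eval x) (fun x _ => by simp [poleProd_zero]) ?_
    rw [curveInt_polynomial h₁, curveInt_polynomial h₂, add_zero]
  | cons z s ih =>
    have hs' : ∀ w ∈ s, w ∈ S := fun w hw => hs w (Multiset.mem_cons_of_mem hw)
    have hz : z ∉ K := hS z (hs z (Multiset.mem_cons_self z s))
    -- P(x) = P(z) + (x − z)Q(x): the constant part falls under `hpole`, and in the other part one
    -- pole cancels.
    have hQ := Polynomial.mul_divByMonic_eq_iff_isRoot (p := P - Polynomial.C (P.eval z)) (a := z)
    set Q := (P - Polynomial.C (P.eval z)) /ₘ (Polynomial.X - Polynomial.C z)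
    have hQ' := hQ.2 (by simp)
    refine hadd (F := fun x => P.eval z * poleProd (z ::ₘ s) x)
      (G := fun x => Q.eval x * poleProd s x) ?_ ?_ ?_ ?_ (ih Q hs')
    · exact continuousOn_const.mul (continuousOn_poleProd _ fun w hw => hS w (hs w hw))
    · exact Q.continuous.continuousOn.mul (continuousOn_poleProd _ fun w hw => hS w (hs' w hw))
    · intro x hx
      have hxz : x - z ≠ 0 := sub_ne_zero.2 fun h => hz (h ▸ hx)
      have := congrArg (Polynomial.eval x) hQ'
      simp only [Polynomial.eval_mul, Polynomial.eval_sub, Polynomial.eval_X,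
        Polynomial.eval_C] at this
      rw [poleProd_cons, eq_add_of_sub_eq this.symm]
      field_simp
      ring
    · exact hsmul _ (hpole _ _ rfl hs)

end Vanishing

/-! ### Winding numbers -/

namespace IsLoop

variable {γ : ℝ → ℂ} (hγ : IsLoop γ)
include hγ

omit hγ in
lemma continuousOn_sub_inv {z : ℂ} (hz : z ∉ trace γ) :
    ContinuousOn (fun x => (x - z)⁻¹) (trace γ) :=
  (continuousOn_id.sub continuousOn_const).inv₀ fun x hx => sub_ne_zero.2 fun h =>
    hz ((show x = z from h) ▸ hx)

/-- The linear term of (x − w)⁻¹ in w − z is (w − z)(x − z)⁻², whose integral vanishes since (x −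
z)⁻² has a primitive. The remainder is quadratic in w − z, uniformly on the curve. -/
lemma hasDerivAt_winding {z : ℂ} (hz : z ∉ trace γ) :
    HasDerivAt (fun w => curveInt γ (fun x => (x - w)⁻¹)) 0 z := by
  have hopen : IsOpen (trace γ)ᶜ := hγ.isCompact_trace.isClosed.isOpen_compl
  obtain ⟨δ, hδ, hball⟩ := Metric.isOpen_iff.1 hopen z hz
  obtain ⟨K, hK0, hK⟩ := hγ.curveInt_bound
  have hfar : ∀ x ∈ trace γ, δ ≤ ‖x - z‖ := fun x hx => by
    by_contra h
    exact hball (by rw [Metric.mem_ball, dist_eq_norm]; exact not_le.1 h) hx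
  rw [hasDerivAt_iff_isLittleO]
  simp only [smul_zero, sub_zero]
  refine Asymptotics.IsBigO.trans_isLittleO ?_ (Asymptotics.isLittleO_pow_sub_sub z one_lt_two)
  refine Asymptotics.IsBigO.of_bound (2 / δ ^ 3 * K) ?_
  filter_upwards [Metric.ball_mem_nhds z (half_pos hδ)] with w hw
  rw [Metric.mem_ball, dist_eq_norm] at hw
  have hfar' : ∀ x ∈ trace γ, δ / 2 ≤ ‖x - w‖ := fun x hx => by
    have := norm_sub_le_norm_sub_add_norm_sub x w z
    linarith [hfar x hx]
  have hw' : w ∉ trace γ := fun h => by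
    have := hfar' w h
    simp at this; linarith
  have c1 := continuousOn_sub_inv hw'
  have c2 := continuousOn_sub_inv hz
  have hc3 : curveInt γ (fun x => (w - z) * (x - z)⁻¹ ^ 2) = 0 := by
    rw [curveInt_const_mul, curveInt_sub_inv_pow hγ hz 0, mul_zero]
  have e1 : curveInt γ (fun x => (x - w)⁻¹) - curveInt γ (fun x => (x - z)⁻¹) =
      curveInt γ (fun x => (x - w)⁻¹ - (x - z)⁻¹ - (w - z) * (x - z)⁻¹ ^ 2) := by
    rw [← sub_zero (_ - _), ← hc3, ← hγ.curveInt_sub c1 c2]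
    exact (hγ.curveInt_sub (c1.fun_sub c2) (continuousOn_const.fun_mul (c2.fun_pow 2))).symm
  rw [e1]
  refine (hK _ (‖w - z‖ ^ 2 * (2 / δ ^ 3)) fun x hx => ?_).trans (le_of_eq ?_)
  · have h1 := hfar x hx
    have h2 := hfar' x hx
    have hz0 : x - z ≠ 0 := norm_pos_iff.1 (hδ.trans_le h1)
    have hw0 : x - w ≠ 0 := norm_pos_iff.1 ((half_pos hδ).trans_le h2)
    have e2 : (x - w)⁻¹ - (x - z)⁻¹ - (w - z) * (x - z)⁻¹ ^ 2 =
        (w - z) ^ 2 * ((x - w) * (x - z) ^ 2)⁻¹ := by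
      field_simp; ring
    rw [e2, norm_mul, norm_pow, norm_inv, norm_mul, norm_pow]
    refine mul_le_mul_of_nonneg_left ?_ (by positivity)
    rw [show 2 / δ ^ 3 = (δ / 2 * δ ^ 2)⁻¹ by field_simp]
    gcongr
  · rw [norm_pow, norm_norm]; ring

/-- The integral is constant on the component of z. That component is unbounded, and the integral is
arbitrarily small for w far from the curve. -/
lemma winding_outside {z : ℂ} (hz : z ∈ outside γ) : curveInt γ (fun x => (x - z)⁻¹) = 0 := by
  have hopen : IsOpen (trace γ)ᶜ := hγ.isCompact_trace.isClosed.isOpen_compl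
  set U := connectedComponentIn (trace γ)ᶜ z with hU
  have hUo : IsOpen U := hopen.connectedComponentIn
  have hUc : IsPreconnected U := isPreconnected_connectedComponentIn
  have hUs : U ⊆ (trace γ)ᶜ := connectedComponentIn_subset _ _
  have hzU : z ∈ U := mem_connectedComponentIn hz.1
  have hconst : ∀ w ∈ U, curveInt γ (fun x => (x - w)⁻¹) = curveInt γ (fun x => (x - z)⁻¹) := by
    intro w hw
    refine hUo.is_const_of_deriv_eq_zero (f := fun w => curveInt γ (fun x => (x - w)⁻¹)) hUc
      (fun v hv => (hγ.hasDerivAt_winding (hUs hv)).differentiableAt.differentiableWithinAt)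
      (fun v hv => (hγ.hasDerivAt_winding (hUs hv)).deriv) hw hzU
  obtain ⟨K, hK0, hK⟩ := hγ.curveInt_bound
  obtain ⟨M, hM⟩ := hγ.isCompact_trace.isBounded.exists_norm_le
  by_contra hne
  set c := ‖curveInt γ (fun x => (x - z)⁻¹)‖ with hc
  have hc0 : 0 < c := norm_pos_iff.2 hne
  set ε := c / (2 * (K + 1)) with hε
  have hε0 : 0 < ε := by positivity
  obtain ⟨w, hw, hwM⟩ : ∃ w ∈ U, M + ε⁻¹ < ‖w‖ := by
    by_contra h
    push Not at h
    exact hz.2 (isBounded_iff_forall_norm_le.2 ⟨_, h⟩)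
  have h1 := hK (fun x => (x - w)⁻¹) ε fun x hx => by
    rw [norm_inv]
    refine inv_le_of_inv_le₀ hε0 ?_
    have h2 := norm_sub_norm_le w x
    rw [norm_sub_rev] at h2
    linarith [hM x hx]
  rw [hconst w hw, ← hc] at h1
  have h2 : ε * (2 * (K + 1)) = c := by rw [hε]; field_simp
  nlinarith

end IsLoop

/-! ### Integrals of antisymmetric rational functions -/

/-- Let γ′ = Q/γ. The substitution x ↦ Q/x changes the sign of dx/x, so by antisymmetry the
integrals over γ and γ′ agree. Their sum is zero: up to the factor 2πi, the winding number of γ′ at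
z ≠ 0 is that of γ at Q/z minus that of γ at 0, and at z = 0 it is the negative of that of γ; by
`hS` the winding numbers of γ and γ′ cancel at every pole. -/
lemma IsLoop.curveInt_div_eq_zero_of_antisymm {γ : ℝ → ℂ} (hγ : IsLoop γ) (h0 : (0 : ℂ) ∉ trace γ)
    {Q : ℂ} (hQ : Q ≠ 0) {S : Set ℂ} (hS0 : (0 : ℂ) ∈ S)
    (hS : ∀ z ∈ S, z ≠ 0 → z ∉ trace γ ∧ Q * z⁻¹ ∉ trace γ ∧
      curveInt γ (fun x => (x - z)⁻¹) + curveInt γ (fun x => (x - Q * z⁻¹)⁻¹) =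
        curveInt γ (fun x => x⁻¹))
    {R : ℂ → ℂ} (hR : IsRational Sᶜ S R) (hanti : ∀ x, x ≠ 0 → R (Q * x⁻¹) = -R x) :
    curveInt γ (fun x => R x / x) = 0 := by
  have hne : ∀ x ∈ trace γ, x ≠ 0 := fun x hx h => h0 (h ▸ hx)
  have hg : ∀ x ∈ trace γ, ContDiffAt ℂ 1 (fun x => Q * x⁻¹) x := fun x hx => by
    have := hne x hx
    fun_prop (disch := assumption)
  have hderiv : ∀ x ∈ trace γ, deriv (fun x => Q * x⁻¹) x = -(Q * (x ^ 2)⁻¹) := fun x hx => by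
    rw [deriv_const_mul_field, deriv_inv]; ring
  have hγ' : IsLoop (fun t => Q * (γ t)⁻¹) := hγ.comp_analytic hg
  have hcomp : ∀ F : ℂ → ℂ, curveInt (fun t => Q * (γ t)⁻¹) F =
      curveInt γ (fun x => F (Q * x⁻¹) * -(Q * (x ^ 2)⁻¹)) := fun F => by
    rw [hγ.curveInt_comp hg]
    exact IsLoop.curveInt_congr fun x hx => by rw [hderiv x hx]
  have htr : ∀ w, w ∈ trace (fun t => Q * (γ t)⁻¹) → w ≠ 0 ∧ Q * w⁻¹ ∈ trace γ := by
    rintro _ ⟨t, ht, rfl⟩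
    have h1 : γ t ∈ trace γ := ⟨t, ht, rfl⟩
    refine ⟨mul_ne_zero hQ (inv_ne_zero (hne _ h1)), ?_⟩
    simp only [mul_inv, inv_inv]
    rwa [mul_inv_cancel_left₀ hQ]
  have hdisj : ∀ z ∈ S, z ∉ trace γ ∪ trace (fun t => Q * (γ t)⁻¹) := by
    rintro z hz (h | h)
    · by_cases hz0 : z = 0
      · exact h0 (hz0 ▸ h)
      · exact (hS z hz hz0).1 h
    · obtain ⟨h1, h2⟩ := htr z h
      exact (hS z hz h1).2.1 h2
  have key : curveInt γ (fun x => R x / x) + curveInt (fun t => Q * (γ t)⁻¹) (fun x => R x / x) = 0 := by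
    refine curveInt_add_eq_zero (S := S) hγ hγ' hdisj ?_ ?_
    · intro z hz
      rw [hcomp]
      by_cases hz0 : z = 0
      · subst hz0
        have : curveInt γ (fun x => (Q * x⁻¹ - 0)⁻¹ * -(Q * (x ^ 2)⁻¹)) =
            curveInt γ (fun x => (-1) * (x - 0)⁻¹) := by
          refine IsLoop.curveInt_congr fun x hx => ?_
          have := hne x hx
          rw [sub_zero, sub_zero]
          field_simp
        rw [this, IsLoop.curveInt_const_mul]; ring
      · obtain ⟨h1, h2, h3⟩ := hS z hz hz0
        have : curveInt γ (fun x => (Q * x⁻¹ - z)⁻¹ * -(Q * (x ^ 2)⁻¹)) =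
            curveInt γ (fun x => (x - Q * z⁻¹)⁻¹ - (x - 0)⁻¹) := by
          refine IsLoop.curveInt_congr fun x hx => ?_
          have hx0 := hne x hx
          have hx1 : x - Q * z⁻¹ ≠ 0 := sub_ne_zero.2 fun h => h2 (h ▸ hx)
          have e : Q * x⁻¹ - z = -(x⁻¹ * (z * x - Q)) := by field_simp; ring
          have e' : x - Q * z⁻¹ = z⁻¹ * (z * x - Q) := by field_simp
          have hx2 : z * x - Q ≠ 0 := fun h => hx1 (by rw [e', h, mul_zero])
          rw [e, e', sub_zero]
          generalize hd : z * x - Q = d at hx2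
          rw [show Q = z * x - d by rw [← hd]; ring]
          field_simp
        rw [this, hγ.curveInt_sub (IsLoop.continuousOn_sub_inv h2) (IsLoop.continuousOn_sub_inv h0)]
        simp only [sub_zero]
        linear_combination h3
    · have h1 : IsRational (trace γ ∪ trace fun t => Q * (γ t)⁻¹) S R :=
        hR.mono (by
          rintro x hx hxS
          exact hdisj x hxS hx) subset_rfl
      exact (h1.mul (IsRational.inv hS0)).congr fun x _ => div_eq_mul_inv _ _
  rw [hcomp] at key
  have : curveInt γ (fun x => R (Q * x⁻¹) / (Q * x⁻¹) * -(Q * (x ^ 2)⁻¹)) =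
      curveInt γ (fun x => R x / x) := by
    refine IsLoop.curveInt_congr fun x hx => ?_
    have hx0 := hne x hx
    rw [hanti x hx0]
    field_simp
  rw [this] at key
  linear_combination key / 2

/-! ### Admissible contours -/

namespace Params

/-- The set `{a, b, c, d}` of the Askey-Wilson parameters. -/
def abcd (p : Params) : Set ℂ := {p.a, p.b, p.c, p.d}

/-- The points `e q ^ k` and `(e q ^ k)⁻¹`, together with `0`. -/
def polesOne (p : Params) : Set ℂ :=
  {0} ∪ {z | ∃ e ∈ p.abcd, ∃ k : ℕ, z = e * p.q ^ k ∨ z = (e * p.q ^ k)⁻¹}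

/-- The points `e q ^ (k + 1)` and `(e q ^ k)⁻¹`, together with `0`. -/
def polesQ (p : Params) : Set ℂ :=
  {0} ∪ {z | ∃ e ∈ p.abcd, ∃ k : ℕ, z = e * p.q ^ (k + 1) ∨ z = (e * p.q ^ k)⁻¹}

variable {p : Params} {γ : ℝ → ℂ}

lemma Generic.q_ne (hp : p.Generic) : p.q ≠ 0 := norm_pos_iff.1 hp.q_pos

lemma Generic.qh_lt (hp : p.Generic) : ‖p.qh‖ < 1 := by
  have := hp.q_lt
  rw [q, norm_pow] at this
  by_contra h
  have := one_le_pow₀ (not_lt.1 h) (n := 2)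
  linarith

lemma Generic.abcd_ne (hp : p.Generic) {e : ℂ} (he : e ∈ p.abcd) : e ≠ 0 := by
  have h0 := hp.k0_ne
  have h1 := hp.k1_ne
  have h2 := hp.u0_ne
  have h3 := hp.u1_ne
  have h4 := hp.qh_ne
  rcases he with rfl | rfl | rfl | rfl <;> simp [a, b, c, d, *]

namespace IsContour

variable (hγ : p.IsContour γ)
include hγ

lemma isLoop : IsLoop γ := hγ.jordan.isLoop

lemma winding_inner {e : ℂ} (he : e ∈ p.abcd) (k : ℕ) :
    curveInt γ (fun x => (x - e * p.q ^ k)⁻¹) = 2 * Real.pi * Complex.I := by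
  have := hγ.jordan.counterclockwise _ (hγ.inner e he k)
  rwa [inv_mul_eq_one₀ Complex.two_pi_I_ne_zero, eq_comm] at this

lemma winding_outer {e : ℂ} (he : e ∈ p.abcd) (k : ℕ) :
    curveInt γ (fun x => (x - (e * p.q ^ k)⁻¹)⁻¹) = 0 :=
  hγ.isLoop.winding_outside (hγ.outer e he k)

/-- The points a q^k tend to 0, so some of them lie in the component of 0. -/
lemma zero_inside (hp : p.Generic) : (0 : ℂ) ∈ inside γ := by
  refine ⟨hγ.zero_notMem, ?_⟩
  have hopen : IsOpen (trace γ)ᶜ := hγ.isLoop.isCompact_trace.isClosed.isOpen_compl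
  have h1 : Tendsto (fun k : ℕ => p.a * p.q ^ k) atTop (𝓝 0) := by
    simpa using (tendsto_pow_atTop_nhds_zero_of_norm_lt_one hp.q_lt).const_mul p.a
  have h2 : connectedComponentIn (trace γ)ᶜ 0 ∈ 𝓝 (0 : ℂ) :=
    hopen.connectedComponentIn.mem_nhds (mem_connectedComponentIn hγ.zero_notMem)
  obtain ⟨k, hk⟩ := (h1.eventually h2).exists
  rw [connectedComponentIn_eq hk]
  exact (hγ.inner p.a (by simp) k).2

lemma winding_zero (hp : p.Generic) : curveInt γ (fun x => x⁻¹) = 2 * Real.pi * Complex.I := by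
  have := hγ.jordan.counterclockwise _ (hγ.zero_inside hp)
  rw [inv_mul_eq_one₀ Complex.two_pi_I_ne_zero, eq_comm] at this
  simpa using this

/-- The integral of a rational function that is antisymmetric under `x ↦ x⁻¹`. -/
lemma curveInt_div_eq_zero_of_antisymm_one (hp : p.Generic) {R : ℂ → ℂ}
    (hR : IsRational p.polesOneᶜ p.polesOne R)
    (hanti : ∀ x, x ≠ 0 → R (1 * x⁻¹) = -R x) : curveInt γ (fun x => R x / x) = 0 := by
  refine hγ.isLoop.curveInt_div_eq_zero_of_antisymm hγ.zero_notMem one_ne_zero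
    (Or.inl rfl) ?_ hR hanti
  rintro z (rfl | ⟨e, he, k, rfl | rfl⟩) hz
  · exact absurd rfl hz
  · rw [one_mul, hγ.winding_inner he, hγ.winding_outer he, hγ.winding_zero hp]
    exact ⟨(hγ.inner e he k).1, (hγ.outer e he k).1, by ring⟩
  · rw [one_mul, inv_inv, hγ.winding_inner he, hγ.winding_outer he, hγ.winding_zero hp]
    exact ⟨(hγ.outer e he k).1, (hγ.inner e he k).1, by ring⟩

/-- The integral of a rational function that is antisymmetric under `x ↦ q x⁻¹`. -/
lemma curveInt_div_eq_zero_of_antisymm_q (hp : p.Generic) {R : ℂ → ℂ}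
    (hR : IsRational p.polesQᶜ p.polesQ R)
    (hanti : ∀ x, x ≠ 0 → R (p.q * x⁻¹) = -R x) : curveInt γ (fun x => R x / x) = 0 := by
  have hq := hp.q_ne
  refine hγ.isLoop.curveInt_div_eq_zero_of_antisymm hγ.zero_notMem hq
    (Or.inl rfl) ?_ hR hanti
  rintro z (rfl | ⟨e, he, k, rfl | rfl⟩) hz
  · exact absurd rfl hz
  · have h1 : p.q * (e * p.q ^ (k + 1))⁻¹ = (e * p.q ^ k)⁻¹ := by
      have := hp.abcd_ne he
      field_simp
      ring
    rw [h1, hγ.winding_inner he, hγ.winding_outer he, hγ.winding_zero hp]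
    exact ⟨(hγ.inner e he _).1, (hγ.outer e he k).1, by ring⟩
  · have h1 : p.q * ((e * p.q ^ k)⁻¹)⁻¹ = e * p.q ^ (k + 1) := by rw [inv_inv, pow_succ]; ring
    rw [h1, hγ.winding_inner he, hγ.winding_outer he, hγ.winding_zero hp]
    exact ⟨(hγ.outer e he k).1, (hγ.inner e he _).1, by ring⟩

end IsContour

end Params

/-! ### Uniform convergence of infinite products -/

section Uniform

variable {K : Set ℂ} {r : ℝ}

/-- The factors `f m` are continuous on `K` and converge to `1` at a geometric rate. -/
structure GeomClose (r : ℝ) (K : Set ℂ) (f : ℕ → ℂ → ℂ) : Prop where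
  continuousOn : ∀ m, ContinuousOn (f m) K
  bound : ∃ C : ℝ, 0 ≤ C ∧ ∀ᶠ m in atTop, ∀ x ∈ K, ‖f m x - 1‖ ≤ C * r ^ m

namespace GeomClose

variable {f g : ℕ → ℂ → ℂ}

lemma of_mul (hK : IsCompact K) {c : ℕ → ℂ} {φ : ℂ → ℂ} (hφ : ContinuousOn φ K) {C : ℝ}
    (hC : 0 ≤ C) (hc : ∀ m, ‖c m‖ ≤ C * r ^ m) : GeomClose r K (fun m x => 1 - c m * φ x) where
  continuousOn m := by fun_prop
  bound := by
    obtain ⟨B, hB⟩ := hK.exists_bound_of_continuousOn hφ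
    refine ⟨C * max B 0, by positivity, Eventually.of_forall fun m x hx => ?_⟩
    have h1 := hc m
    have h2 := (hB x hx).trans (le_max_left B 0)
    rw [sub_sub_cancel_left, norm_neg, norm_mul, mul_right_comm]
    exact mul_le_mul h1 h2 (norm_nonneg _) ((norm_nonneg _).trans h1)

lemma mul (hr0 : 0 ≤ r) (hr1 : r ≤ 1) (hf : GeomClose r K f) (hg : GeomClose r K g) :
    GeomClose r K (fun m x => f m x * g m x) where
  continuousOn m := (hf.continuousOn m).mul (hg.continuousOn m)
  bound := by
    obtain ⟨C, hC0, hC⟩ := hf.bound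
    obtain ⟨D, hD0, hD⟩ := hg.bound
    refine ⟨C * D + C + D, by positivity, ?_⟩
    filter_upwards [hC, hD] with m h1 h2 x hx
    have h1 := h1 x hx
    have h2 := h2 x hx
    have e : f m x * g m x - 1 = (f m x - 1) * (g m x - 1) + (f m x - 1) + (g m x - 1) := by ring
    have hr : r ^ m ≤ 1 := pow_le_one₀ hr0 hr1
    have hr' : 0 ≤ r ^ m := pow_nonneg hr0 m
    rw [e]
    refine (norm_add₃_le).trans ?_
    rw [norm_mul]
    have h3 : ‖f m x - 1‖ * ‖g m x - 1‖ ≤ (C * r ^ m) * (D * r ^ m) :=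
      mul_le_mul h1 h2 (norm_nonneg _) (by positivity)
    have h4 : (C * r ^ m) * (D * r ^ m) ≤ C * D * r ^ m := by
      have : C * D * r ^ m * r ^ m ≤ C * D * r ^ m * 1 :=
        mul_le_mul_of_nonneg_left hr (by positivity)
      linarith
    linarith

/-- The bound on the inverse needs |f m| ≥ 1/2, which is only available for large m; this is why
`GeomClose` asks for an eventual bound. -/
lemma inv (hr0 : 0 ≤ r) (hr1 : r < 1) (hf : GeomClose r K f) (hne : ∀ m, ∀ x ∈ K, f m x ≠ 0) :
    GeomClose r K (fun m x => (f m x)⁻¹) where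
  continuousOn m := (hf.continuousOn m).inv₀ (hne m)
  bound := by
    obtain ⟨C, hC0, hC⟩ := hf.bound
    refine ⟨2 * C, by positivity, ?_⟩
    have hlim : Tendsto (fun m : ℕ => C * r ^ m) atTop (𝓝 0) := by
      simpa using (tendsto_pow_atTop_nhds_zero_of_lt_one hr0 hr1).const_mul C
    filter_upwards [hC, hlim.eventually_le_const (by norm_num : (0 : ℝ) < 1 / 2)] with m h1 h2 x hx
    have h1 := h1 x hx
    have h3 : 1 / 2 ≤ ‖f m x‖ := by
      have := norm_sub_norm_le (1 : ℂ) (1 - f m x)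
      rw [sub_sub_cancel, norm_one, norm_sub_rev] at this
      linarith
    have h0 := hne m x hx
    rw [show (f m x)⁻¹ - 1 = -(f m x - 1) * (f m x)⁻¹ by field_simp; ring, norm_mul, norm_neg,
      norm_inv]
    have h4 : ‖f m x‖⁻¹ ≤ 2 := by
      rw [inv_le_comm₀ (by linarith) (by norm_num)]; linarith
    calc ‖f m x - 1‖ * ‖f m x‖⁻¹ ≤ (C * r ^ m) * 2 :=
          mul_le_mul h1 h4 (by positivity) ((norm_nonneg _).trans h1)
      _ = 2 * C * r ^ m := by ring

lemma succ (hr0 : 0 ≤ r) (hr1 : r ≤ 1) (hf : GeomClose r K f) :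
    GeomClose r K (fun m => f (m + 1)) where
  continuousOn m := hf.continuousOn (m + 1)
  bound := by
    obtain ⟨C, hC0, hC⟩ := hf.bound
    refine ⟨C, hC0, ?_⟩
    filter_upwards [(tendsto_add_atTop_nat 1).eventually hC] with m h x hx
    refine (h x hx).trans (mul_le_mul_of_nonneg_left ?_ hC0)
    exact pow_le_pow_of_le_one hr0 hr1 (Nat.le_succ m)

lemma tendstoUniformlyOn (hK : IsCompact K) (hr0 : 0 ≤ r) (hr1 : r < 1) (hf : GeomClose r K f) :
    TendstoUniformlyOn (fun N x => ∏ m ∈ Finset.range N, f m x) (fun x => ∏' m, f m x) atTop K := by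
  obtain ⟨C, hC0, hC⟩ := hf.bound
  have h := Summable.hasProdUniformlyOn_nat_one_add (f := fun m x => f m x - 1) hK
    ((summable_geometric_of_lt_one hr0 hr1).mul_left C) hC
    (fun m => (hf.continuousOn m).sub continuousOn_const)
  have h2 := h.tendstoUniformlyOn_finsetRange
  simpa using h2

lemma summable (hr0 : 0 ≤ r) (hr1 : r < 1) (hf : GeomClose r K f) {x : ℂ} (hx : x ∈ K) :
    Summable (fun m => ‖f m x - 1‖) := by
  obtain ⟨C, hC0, hC⟩ := hf.bound
  refine Summable.of_norm_bounded_eventually_nat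
    ((summable_geometric_of_lt_one hr0 hr1).mul_left C) ?_
  filter_upwards [hC] with m h
  simpa using h x hx

lemma tprod_ne_zero (hr0 : 0 ≤ r) (hr1 : r < 1) (hf : GeomClose r K f) {x : ℂ} (hx : x ∈ K)
    (hne : ∀ m, f m x ≠ 0) : ∏' m, f m x ≠ 0 := by
  have := tprod_one_add_ne_zero_of_summable (f := fun m => f m x - 1)
    (by simpa using hne) (hf.summable hr0 hr1 hx)
  simpa using this

end GeomClose

lemma TendstoUniformlyOn.mul_of_compact (hK : IsCompact K) {F G : ℕ → ℂ → ℂ} {f g : ℂ → ℂ}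
    (hF : TendstoUniformlyOn F f atTop K) (hG : TendstoUniformlyOn G g atTop K)
    (hFc : ∀ n, ContinuousOn (F n) K) (hGc : ∀ n, ContinuousOn (G n) K) :
    TendstoUniformlyOn (fun n x => F n x * G n x) (fun x => f x * g x) atTop K := by
  have hf := hF.continuousOn (Frequently.of_forall hFc)
  have hg := hG.continuousOn (Frequently.of_forall hGc)
  rw [← tendstoLocallyUniformlyOn_iff_tendstoUniformlyOn_of_compact hK] at *
  exact hF.mul₀ hG hf hg

lemma tendstoUniformlyOn_const_mul (hK : IsCompact K) {φ : ℂ → ℂ} (hφ : ContinuousOn φ K)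
    {G : ℕ → ℂ → ℂ} {g : ℂ → ℂ} (hG : TendstoUniformlyOn G g atTop K)
    (hGc : ∀ n, ContinuousOn (G n) K) :
    TendstoUniformlyOn (fun n x => φ x * G n x) (fun x => φ x * g x) atTop K := by
  have h1 : TendstoUniformlyOn (fun (_ : ℕ) => φ) φ atTop K :=
    fun u hu => Eventually.of_forall fun _ x _ => refl_mem_uniformity hu
  exact TendstoUniformlyOn.mul_of_compact hK h1 hG (fun _ => hφ) hGc

end Uniform

namespace Params

variable (p : Params)

/-! ### The factors of the weights -/

/-- The first pole `t u q ^ (m / 2)` of `y ↦ weightFactor m y⁻¹`. -/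
def pole₁ (m : ℕ) : ℂ := (if Even m then p.k1 else p.k0) * (if Even m then p.u1 else p.u0) * p.qh ^ m

/-- The second pole `-t u⁻¹ q ^ (m / 2)` of `y ↦ weightFactor m y⁻¹`. -/
def pole₂ (m : ℕ) : ℂ :=
  -((if Even m then p.k1 else p.k0) * (if Even m then p.u1 else p.u0)⁻¹ * p.qh ^ m)

/-- The denominator of `weightFactor`. -/
def weightDen (m : ℕ) (y : ℂ) : ℂ := (1 - p.pole₁ m * y) * (1 - p.pole₂ m * y)

lemma weightFactor_eq (m : ℕ) (y : ℂ) :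
    p.weightFactor m y = (1 - p.q ^ m * y ^ 2) / p.weightDen m y := by
  unfold weightFactor weightDen pole₁ pole₂
  ring

lemma pole₁_eq (m : ℕ) : ∃ e ∈ p.abcd, p.pole₁ m = e * p.q ^ (m / 2) := by
  obtain ⟨k, rfl | rfl⟩ := Nat.even_or_odd' m
  · refine ⟨p.a, by simp [abcd], ?_⟩
    rw [Nat.mul_div_cancel_left k two_pos, pole₁, if_pos (by simp), if_pos (by simp), a, q, pow_mul]
  · refine ⟨p.c, by simp [abcd], ?_⟩
    have h : ¬ Even (2 * k + 1) := by simp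
    rw [show (2 * k + 1) / 2 = k by omega, pole₁, if_neg h, if_neg h, c, q, pow_succ, pow_mul]
    ring

lemma pole₂_eq (m : ℕ) : ∃ e ∈ p.abcd, p.pole₂ m = e * p.q ^ (m / 2) := by
  obtain ⟨k, rfl | rfl⟩ := Nat.even_or_odd' m
  · refine ⟨p.b, by simp [abcd], ?_⟩
    rw [Nat.mul_div_cancel_left k two_pos, pole₂, if_pos (by simp), if_pos (by simp), b, q, pow_mul]
    ring
  · refine ⟨p.d, by simp [abcd], ?_⟩
    have h : ¬ Even (2 * k + 1) := by simp
    rw [show (2 * k + 1) / 2 = k by omega, pole₂, if_neg h, if_neg h, d, q, pow_succ, pow_mul]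
    ring

lemma weightDen_add_two (m : ℕ) (y : ℂ) : p.weightDen (m + 2) y = p.weightDen m (p.q * y) := by
  have h : Even (m + 2) ↔ Even m := by simp [Nat.even_add]
  simp only [weightDen, pole₁, pole₂, h, q]
  ring

/-- Turns ∏ w_m(x) w_{m+2}(x⁻¹) into ∏ w_m(x) w_m(q x⁻¹), which is visibly invariant under x ↦ q
x⁻¹. -/
lemma weightFactor_add_two (m : ℕ) (y : ℂ) :
    p.weightFactor (m + 2) y = p.weightFactor m (p.q * y) := by
  rw [weightFactor_eq, weightFactor_eq, weightDen_add_two]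
  ring

variable {p} {K S : Set ℂ}

lemma Generic.pole₁_ne (hp : p.Generic) (m : ℕ) : p.pole₁ m ≠ 0 := by
  obtain ⟨e, he, h⟩ := p.pole₁_eq m
  rw [h]
  exact mul_ne_zero (hp.abcd_ne he) (pow_ne_zero _ hp.q_ne)

lemma Generic.pole₂_ne (hp : p.Generic) (m : ℕ) : p.pole₂ m ≠ 0 := by
  obtain ⟨e, he, h⟩ := p.pole₂_eq m
  rw [h]
  exact mul_ne_zero (hp.abcd_ne he) (pow_ne_zero _ hp.q_ne)

lemma isRational_weightFactor (hp : p.Generic) {m : ℕ} (h₁ : (p.pole₁ m)⁻¹ ∈ S)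
    (h₂ : (p.pole₂ m)⁻¹ ∈ S) : IsRational K S (fun x => p.weightFactor m x) := by
  refine ((IsRational.polynomial (1 - Polynomial.C (p.q ^ m) * Polynomial.X ^ 2)).mul
    ((IsRational.one_sub_mul_inv (hp.pole₁_ne m) h₁).mul
      (IsRational.one_sub_mul_inv (hp.pole₂_ne m) h₂))).congr fun x _ => ?_
  rw [weightFactor_eq, weightDen, div_eq_mul_inv, mul_inv]
  simp

lemma isRational_weightFactor_inv (hK : (0 : ℂ) ∉ K) (h0 : (0 : ℂ) ∈ S) {m : ℕ}
    (h₁ : p.pole₁ m ∈ S) (h₂ : p.pole₂ m ∈ S) :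
    IsRational K S (fun x => p.weightFactor m x⁻¹) := by
  refine ((IsRational.laurent h0 hK (1 - C (p.q ^ m) * T (-2))).mul
    ((IsRational.one_sub_mul_inv_inv hK h₁).mul
      (IsRational.one_sub_mul_inv_inv hK h₂))).congr fun x _ => ?_
  rw [weightFactor_eq, weightDen, div_eq_mul_inv, mul_inv, evalAt_sub, evalAt_one, evalAt_C_mul_T,
    zpow_neg, inv_pow]
  norm_cast

lemma geomClose_num (hp : p.Generic) (hK : IsCompact K) {φ : ℂ → ℂ} (hφ : ContinuousOn φ K) :
    GeomClose ‖p.qh‖ K (fun m x => 1 - p.q ^ m * φ x ^ 2) := by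
  refine GeomClose.of_mul hK (hφ.pow 2) (C := 1) zero_le_one fun m => ?_
  rw [one_mul, q, ← pow_mul, norm_pow]
  exact pow_le_pow_of_le_one (norm_nonneg _) hp.qh_lt.le (by omega)

lemma geomClose_den (hp : p.Generic) (hK : IsCompact K) {φ : ℂ → ℂ} (hφ : ContinuousOn φ K) :
    GeomClose ‖p.qh‖ K (fun m x => p.weightDen m (φ x)) := by
  have hmax : ∀ (m : ℕ) (s t : ℂ), ‖(if Even m then s else t)‖ ≤ max ‖s‖ ‖t‖ := by
    intro m s t; split_ifs <;> simp
  refine GeomClose.mul (norm_nonneg _) hp.qh_lt.le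
    (GeomClose.of_mul hK hφ (C := max ‖p.k1‖ ‖p.k0‖ * max ‖p.u1‖ ‖p.u0‖) (by positivity) fun m => ?_)
    (GeomClose.of_mul hK hφ (C := max ‖p.k1‖ ‖p.k0‖ * max ‖p.u1⁻¹‖ ‖p.u0⁻¹‖) (by positivity) fun m => ?_)
  · rw [pole₁, norm_mul, norm_mul, norm_pow]
    gcongr
    exacts [hmax _ _ _, hmax _ _ _]
  · rw [pole₂, norm_neg, norm_mul, norm_mul, norm_pow, apply_ite Inv.inv]
    gcongr
    exacts [hmax _ _ _, hmax _ _ _]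

lemma geomClose_weightFactor (hp : p.Generic) (hK : IsCompact K) {φ : ℂ → ℂ}
    (hφ : ContinuousOn φ K) (hne : ∀ m, ∀ x ∈ K, p.weightDen m (φ x) ≠ 0) :
    GeomClose ‖p.qh‖ K (fun m x => p.weightFactor m (φ x)) := by
  simp only [weightFactor_eq, div_eq_mul_inv]
  exact (geomClose_num hp hK hφ).mul (norm_nonneg _) hp.qh_lt.le
    ((geomClose_den hp hK hφ).inv (norm_nonneg _) hp.qh_lt hne)

/-! ### Convergence of the truncated weights on the contour -/

namespace IsContour

variable {γ : ℝ → ℂ} (hγ : p.IsContour γ)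
include hγ

lemma ne_zero {x : ℂ} (hx : x ∈ trace γ) : x ≠ 0 := fun h => hγ.zero_notMem (h ▸ hx)

lemma continuousOn_inv : ContinuousOn (fun x : ℂ => x⁻¹) (trace γ) :=
  continuousOn_id.inv₀ fun _ hx => hγ.ne_zero hx

lemma one_sub_ne_zero (hp : p.Generic) {e : ℂ} (he : e ∈ p.abcd) (k : ℕ) {x : ℂ}
    (hx : x ∈ trace γ) : 1 - e * p.q ^ k * x ≠ 0 ∧ 1 - e * p.q ^ k * x⁻¹ ≠ 0 := by
  have hx0 := hγ.ne_zero hx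
  have he0 : e * p.q ^ k ≠ 0 := mul_ne_zero (hp.abcd_ne he) (pow_ne_zero _ hp.q_ne)
  constructor
  · intro h
    refine (hγ.outer e he k).1 ?_
    convert hx
    rw [inv_eq_iff_eq_inv, ← one_div, eq_div_iff hx0]
    linear_combination -h
  · intro h
    refine (hγ.inner e he k).1 ?_
    convert hx
    field_simp at h
    linear_combination -h

lemma weightDen_ne (hp : p.Generic) (m : ℕ) {x : ℂ} (hx : x ∈ trace γ) : p.weightDen m x ≠ 0 := by
  obtain ⟨e, he, h⟩ := p.pole₁_eq m
  obtain ⟨f, hf, h'⟩ := p.pole₂_eq m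
  rw [weightDen, h, h']
  exact mul_ne_zero (hγ.one_sub_ne_zero hp he _ hx).1 (hγ.one_sub_ne_zero hp hf _ hx).1

lemma weightDen_inv_ne (hp : p.Generic) (m : ℕ) {x : ℂ} (hx : x ∈ trace γ) :
    p.weightDen m x⁻¹ ≠ 0 := by
  obtain ⟨e, he, h⟩ := p.pole₁_eq m
  obtain ⟨f, hf, h'⟩ := p.pole₂_eq m
  rw [weightDen, h, h']
  exact mul_ne_zero (hγ.one_sub_ne_zero hp he _ hx).2 (hγ.one_sub_ne_zero hp hf _ hx).2

lemma isCompact : IsCompact (trace γ) := hγ.isLoop.isCompact_trace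

lemma geomClose (hp : p.Generic) : GeomClose ‖p.qh‖ (trace γ) (fun m x => p.weightFactor m x) :=
  geomClose_weightFactor hp hγ.isCompact continuousOn_id fun m _ hx => hγ.weightDen_ne hp m hx

lemma geomClose_inv (hp : p.Generic) :
    GeomClose ‖p.qh‖ (trace γ) (fun m x => p.weightFactor m x⁻¹) :=
  geomClose_weightFactor hp hγ.isCompact hγ.continuousOn_inv fun m _ hx => hγ.weightDen_inv_ne hp m hx

/-- The partial products of the weight. -/
lemma tendsto_weight (hp : p.Generic) {M N : ℕ → ℕ} (hM : Tendsto M atTop atTop)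
    (hN : Tendsto N atTop atTop) :
    TendstoUniformlyOn (fun n x => (∏ m ∈ Finset.range (M n), p.weightFactor m x) *
      ∏ m ∈ Finset.range (N n), p.weightFactor (m + 1) x⁻¹) p.weight atTop (trace γ) := by
  have h1 := hγ.geomClose hp
  have h2 := (hγ.geomClose_inv hp).succ (norm_nonneg _) hp.qh_lt.le
  have t1 := h1.tendstoUniformlyOn hγ.isCompact (norm_nonneg _) hp.qh_lt
  have t2 := h2.tendstoUniformlyOn hγ.isCompact (norm_nonneg _) hp.qh_lt
  exact TendstoUniformlyOn.mul_of_compact hγ.isCompact (fun u hu => hM.eventually (t1 u hu))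
    (fun u hu => hN.eventually (t2 u hu))
    (fun n => continuousOn_finsetProd _ fun m _ => h1.continuousOn m)
    (fun n => continuousOn_finsetProd _ fun m _ => h2.continuousOn m)

lemma tendsto_weightPlus (hp : p.Generic) {M : ℕ → ℕ} (hM : Tendsto M atTop atTop) :
    TendstoUniformlyOn (fun n x => (∏ m ∈ Finset.range (M n), p.weightFactor m x) *
      ∏ m ∈ Finset.range (M n), p.weightFactor m x⁻¹) p.weightPlus atTop (trace γ) := by
  have h1 := hγ.geomClose hp
  have h2 := hγ.geomClose_inv hp
  have t1 := h1.tendstoUniformlyOn hγ.isCompact (norm_nonneg _) hp.qh_lt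
  have t2 := h2.tendstoUniformlyOn hγ.isCompact (norm_nonneg _) hp.qh_lt
  exact TendstoUniformlyOn.mul_of_compact hγ.isCompact (fun u hu => hM.eventually (t1 u hu))
    (fun u hu => hM.eventually (t2 u hu))
    (fun n => continuousOn_finsetProd _ fun m _ => h1.continuousOn m)
    (fun n => continuousOn_finsetProd _ fun m _ => h2.continuousOn m)

lemma continuousOn_prod (hp : p.Generic) (M N : ℕ) :
    ContinuousOn (fun x => (∏ m ∈ Finset.range M, p.weightFactor m x) *
      ∏ m ∈ Finset.range N, p.weightFactor (m + 1) x⁻¹) (trace γ) :=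
  (continuousOn_finsetProd _ fun m _ => (hγ.geomClose hp).continuousOn m).mul
    (continuousOn_finsetProd _ fun m _ => (hγ.geomClose_inv hp).continuousOn (m + 1))

lemma continuousOn_prod_plus (hp : p.Generic) (M : ℕ) :
    ContinuousOn (fun x => (∏ m ∈ Finset.range M, p.weightFactor m x) *
      ∏ m ∈ Finset.range M, p.weightFactor m x⁻¹) (trace γ) :=
  (continuousOn_finsetProd _ fun m _ => (hγ.geomClose hp).continuousOn m).mul
    (continuousOn_finsetProd _ fun m _ => (hγ.geomClose_inv hp).continuousOn m)

lemma continuousOn_weight (hp : p.Generic) : ContinuousOn p.weight (trace γ) :=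
  (hγ.tendsto_weight hp tendsto_id tendsto_id).continuousOn
    (Frequently.of_forall fun n => hγ.continuousOn_prod hp n n)

lemma continuousOn_weightPlus (hp : p.Generic) : ContinuousOn p.weightPlus (trace γ) :=
  (hγ.tendsto_weightPlus hp tendsto_id).continuousOn
    (Frequently.of_forall fun n => hγ.continuousOn_prod_plus hp n)

end IsContour

end Params

/-! ### The bilinear forms -/

lemma continuousOn_evalAt (f : Laurent) {K : Set ℂ} (hK : (0 : ℂ) ∉ K) :
    ContinuousOn (fun x => evalAt f x) K := by
  have h : IsRational K {0} (fun x => evalAt f x) := IsRational.laurent (Set.mem_singleton 0) hK f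
  refine h.continuousOn ?_
  rintro z rfl
  exact hK

lemma continuousOn_evalAt_inv (f : Laurent) {K : Set ℂ} (hK : (0 : ℂ) ∉ K) :
    ContinuousOn (fun x => evalAt f x⁻¹) K := by
  simpa only [evalAt_invert] using continuousOn_evalAt (invert f) hK

lemma continuousOn_div {φ : ℂ → ℂ} {K : Set ℂ} (hK : (0 : ℂ) ∉ K) (hφ : ContinuousOn φ K) :
    ContinuousOn (fun x => φ x / x) K :=
  hφ.div continuousOn_id fun x hx h => hK ((show x = 0 from h) ▸ hx)

/-- The form `(f, g) ↦ (2πi)⁻¹ ∫ f(x) g(x⁻¹) ω(x) dx/x`. -/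
def formOf {γ : ℝ → ℂ} (hγ : IsLoop γ) (h0 : (0 : ℂ) ∉ trace γ) {ω : ℂ → ℂ}
    (hω : ContinuousOn ω (trace γ)) : LinearMap.BilinForm ℂ Laurent :=
  LinearMap.mk₂ ℂ (fun f g => (2 * Real.pi * Complex.I)⁻¹ *
      curveInt γ fun x => evalAt f x * evalAt g x⁻¹ * ω x / x)
    (fun f f' g => by
      have hc : ∀ f : Laurent, ContinuousOn (fun x => evalAt f x * evalAt g x⁻¹ * ω x / x) (trace γ) :=
        fun f => continuousOn_div h0
          (((continuousOn_evalAt f h0).mul (continuousOn_evalAt_inv g h0)).mul hω)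
      rw [← mul_add, ← hγ.curveInt_add (hc f) (hc f')]
      congr 2
      funext x
      rw [evalAt_add]; ring)
    (fun c f g => by
      rw [smul_eq_mul, mul_left_comm c, ← IsLoop.curveInt_const_mul c]
      congr 2
      funext x
      rw [evalAt_smul]; ring)
    (fun f g g' => by
      have hc : ∀ g : Laurent, ContinuousOn (fun x => evalAt f x * evalAt g x⁻¹ * ω x / x) (trace γ) :=
        fun g => continuousOn_div h0
          (((continuousOn_evalAt f h0).mul (continuousOn_evalAt_inv g h0)).mul hω)
      rw [← mul_add, ← hγ.curveInt_add (hc g) (hc g')]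
      congr 2
      funext x
      rw [evalAt_add]; ring)
    (fun c f g => by
      rw [smul_eq_mul, mul_left_comm c, ← IsLoop.curveInt_const_mul c]
      congr 2
      funext x
      rw [evalAt_smul]; ring)

lemma formOf_apply {γ : ℝ → ℂ} (hγ : IsLoop γ) (h0 : (0 : ℂ) ∉ trace γ) {ω : ℂ → ℂ}
    (hω : ContinuousOn ω (trace γ)) (f g : Laurent) : formOf hγ h0 hω f g =
      (2 * Real.pi * Complex.I)⁻¹ * curveInt γ fun x => evalAt f x * evalAt g x⁻¹ * ω x / x := rfl

/-! ### Adjoints of the Hecke operators -/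

section Hecke

variable {σ : ℤ} {h k u : ℂ}

/-- On g(x⁻¹) the operator T′ + (k − k⁻¹) acts by the same formula k + k⁻¹w⁻¹(s − 1) as T does on f.
In the difference the terms with k and with −k⁻¹w⁻¹ cancel, and what remains is antisymmetric under
s. -/
lemma weight_mul_heckeOperator (hσ : σ = 1 ∨ σ = -1) (hh : h ≠ 0) (hk : k ≠ 0) (hu : u ≠ 0)
    (f g : Laurent) {x : ℂ} (hx : x ≠ 0)
    (hden : (1 - k * u * (h * x ^ σ)) * (1 + k * u⁻¹ * (h * x ^ σ)) ≠ 0) :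
    (evalAt (heckeOperator σ h k u f) x * evalAt g x⁻¹ - evalAt f x *
        evalAt (heckeOperator σ h⁻¹ k⁻¹ u⁻¹ g + (k - k⁻¹) • g) x⁻¹) *
      ((1 - (h * x ^ σ) ^ 2) / ((1 - k * u * (h * x ^ σ)) * (1 + k * u⁻¹ * (h * x ^ σ)))) =
    k⁻¹ * (evalAt (reflection σ h f) x * evalAt (invert g) x -
      evalAt f x * evalAt (reflection σ h (invert g)) x) := by
  have e1 := evalAt_heckeOperator hσ hh hk hu f hx
  have e2 := evalAt_heckeOperator hσ (inv_ne_zero hh) (inv_ne_zero hk) (inv_ne_zero hu) g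
    (inv_ne_zero hx)
  rw [show h⁻¹ * x⁻¹ ^ σ = (h * x ^ σ)⁻¹ by rw [inv_zpow, mul_inv],
    show h⁻¹ ^ (-2 * σ) * x⁻¹⁻¹ = (h ^ (-2 * σ) * x⁻¹)⁻¹ by rw [inv_zpow, mul_inv]] at e2
  have hz : h * x ^ σ ≠ 0 := mul_ne_zero hh (zpow_ne_zero _ hx)
  rw [evalAt_reflection, evalAt_reflection, evalAt_invert, evalAt_invert, evalAt_add, evalAt_smul]
  generalize evalAt (heckeOperator σ h k u f) x = A at *
  generalize evalAt (heckeOperator σ h⁻¹ k⁻¹ u⁻¹ g) x⁻¹ = B at *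
  generalize evalAt f (h ^ (-2 * σ) * x⁻¹) = f' at *
  generalize evalAt g (h ^ (-2 * σ) * x⁻¹)⁻¹ = g' at *
  generalize evalAt f x = f at *
  generalize evalAt g x⁻¹ = g at *
  generalize h * x ^ σ = z at *
  have e2' : (1 - z ^ 2) * B = (1 - z ^ 2) * (k⁻¹ * g) +
      k⁻¹ * ((1 - k * u * z) * (1 + k * u⁻¹ * z)) * (g' - g) := by
    linear_combination (norm := (field_simp; ring)) (-z ^ 2) * e2
  rw [mul_div_assoc', div_eq_iff hden]
  linear_combination g * e1 - f * e2'

end Hecke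

/-! ### Adjointness of T₁, T₀, Y and comparison of the two forms -/

namespace Params

variable {p : Params} {γ : ℝ → ℂ}

namespace IsContour

variable (hγ : p.IsContour γ)
include hγ

/-- The form `⟨·,·⟩` as a bilinear form. -/
def form (hp : p.Generic) : LinearMap.BilinForm ℂ Laurent :=
  formOf hγ.isLoop hγ.zero_notMem (hγ.continuousOn_weight hp)

/-- The form `(·,·)` as a bilinear form. -/
def formPlus (hp : p.Generic) : LinearMap.BilinForm ℂ Laurent :=
  formOf hγ.isLoop hγ.zero_notMem (hγ.continuousOn_weightPlus hp)

lemma form_apply (hp : p.Generic) (f g : Laurent) : hγ.form hp f g = p.pairing γ f g := rfl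

lemma formPlus_apply (hp : p.Generic) (f g : Laurent) :
    hγ.formPlus hp f g = p.pairingPlus γ f g := rfl

lemma curveInt_mul_eq_zero {W : ℕ → ℂ → ℂ} {ω φ : ℂ → ℂ} (hW : TendstoUniformlyOn W ω atTop (trace γ))
    (hWc : ∀ n, ContinuousOn (W n) (trace γ)) (hφ : ContinuousOn φ (trace γ))
    (h : ∀ n, curveInt γ (fun x => φ x * W n x / x) = 0) :
    curveInt γ (fun x => φ x * ω x / x) = 0 := by
  have h1 := hγ.isLoop.tendsto_curveInt
    (fun n => (continuousOn_div hγ.zero_notMem hφ).mul (hWc n))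
    (tendstoUniformlyOn_const_mul hγ.isCompact (continuousOn_div hγ.zero_notMem hφ) hW hWc)
  have h2 : ∀ n, curveInt γ (fun x => φ x / x * W n x) = 0 := fun n => by
    rw [← h n]; congr 1; funext x; ring
  have h3 := tendsto_nhds_unique (h1.congr h2) tendsto_const_nhds
  rw [← h3]; congr 1; funext x; ring

/-- A criterion for adjointness in terms of partial products. -/
lemma form_eq_of_forall (hp : p.Generic) {f g f' g' : Laurent} {M N : ℕ → ℕ}
    (hM : Tendsto M atTop atTop) (hN : Tendsto N atTop atTop)
    (h : ∀ n, curveInt γ (fun x => (evalAt f x * evalAt g x⁻¹ - evalAt f' x * evalAt g' x⁻¹) *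
      ((∏ m ∈ Finset.range (M n), p.weightFactor m x) *
        ∏ m ∈ Finset.range (N n), p.weightFactor (m + 1) x⁻¹) / x) = 0) :
    hγ.form hp f g = hγ.form hp f' g' := by
  have hc : ∀ f g : Laurent, ContinuousOn (fun x => evalAt f x * evalAt g x⁻¹) (trace γ) :=
    fun f g => (continuousOn_evalAt f hγ.zero_notMem).mul
      (continuousOn_evalAt_inv g hγ.zero_notMem)
  have h1 := hγ.curveInt_mul_eq_zero (hγ.tendsto_weight hp hM hN)
    (fun n => hγ.continuousOn_prod hp _ _) ((hc f g).fun_sub (hc f' g')) h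
  have hcw : ∀ f g : Laurent, ContinuousOn (fun x => evalAt f x * evalAt g x⁻¹ * p.weight x / x)
      (trace γ) := fun f g =>
    continuousOn_div hγ.zero_notMem ((hc f g).mul (hγ.continuousOn_weight hp))
  rw [form, formOf_apply, formOf_apply, ← sub_eq_zero, ← mul_sub,
    ← hγ.isLoop.curveInt_sub (hcw f g) (hcw f' g')]
  rw [← mul_zero (2 * Real.pi * Complex.I)⁻¹, ← h1]
  congr 2
  funext x
  ring

end IsContour

variable (p) in
lemma pole₁_mem_polesOne (m : ℕ) : p.pole₁ m ∈ p.polesOne ∧ (p.pole₁ m)⁻¹ ∈ p.polesOne := by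
  obtain ⟨e, he, h⟩ := p.pole₁_eq m
  exact ⟨Or.inr ⟨e, he, _, Or.inl h⟩, Or.inr ⟨e, he, _, Or.inr (by rw [h])⟩⟩

variable (p) in
lemma pole₂_mem_polesOne (m : ℕ) : p.pole₂ m ∈ p.polesOne ∧ (p.pole₂ m)⁻¹ ∈ p.polesOne := by
  obtain ⟨e, he, h⟩ := p.pole₂_eq m
  exact ⟨Or.inr ⟨e, he, _, Or.inl h⟩, Or.inr ⟨e, he, _, Or.inr (by rw [h])⟩⟩

variable (p) in
lemma pole₁_mem_polesQ (m : ℕ) : p.pole₁ (m + 2) ∈ p.polesQ ∧ (p.pole₁ m)⁻¹ ∈ p.polesQ := by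
  obtain ⟨e, he, h⟩ := p.pole₁_eq m
  obtain ⟨e', he', h'⟩ := p.pole₁_eq (m + 2)
  exact ⟨Or.inr ⟨e', he', m / 2, Or.inl (by rw [h', Nat.add_div_right _ two_pos])⟩,
    Or.inr ⟨e, he, _, Or.inr (by rw [h])⟩⟩

variable (p) in
lemma pole₂_mem_polesQ (m : ℕ) : p.pole₂ (m + 2) ∈ p.polesQ ∧ (p.pole₂ m)⁻¹ ∈ p.polesQ := by
  obtain ⟨e, he, h⟩ := p.pole₂_eq m
  obtain ⟨e', he', h'⟩ := p.pole₂_eq (m + 2)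
  exact ⟨Or.inr ⟨e', he', m / 2, Or.inl (by rw [h', Nat.add_div_right _ two_pos])⟩,
    Or.inr ⟨e, he, _, Or.inr (by rw [h])⟩⟩

lemma zero_mem_polesOne : (0 : ℂ) ∈ p.polesOne := Or.inl rfl

lemma zero_mem_polesQ : (0 : ℂ) ∈ p.polesQ := Or.inl rfl

lemma isRational_polesOne (hp : p.Generic) (m : ℕ) :
    IsRational p.polesOneᶜ p.polesOne (fun x => p.weightFactor m x) ∧
      IsRational p.polesOneᶜ p.polesOne (fun x => p.weightFactor m x⁻¹) :=
  ⟨isRational_weightFactor hp (p.pole₁_mem_polesOne m).2 (p.pole₂_mem_polesOne m).2,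
    isRational_weightFactor_inv (Set.notMem_compl_iff.2 zero_mem_polesOne) zero_mem_polesOne (p.pole₁_mem_polesOne m).1
      (p.pole₂_mem_polesOne m).1⟩

lemma isRational_polesQ (hp : p.Generic) (m : ℕ) :
    IsRational p.polesQᶜ p.polesQ (fun x => p.weightFactor m x) ∧
      IsRational p.polesQᶜ p.polesQ (fun x => p.weightFactor (m + 2) x⁻¹) :=
  ⟨isRational_weightFactor hp (p.pole₁_mem_polesQ m).2 (p.pole₂_mem_polesQ m).2,
    isRational_weightFactor_inv (Set.notMem_compl_iff.2 zero_mem_polesQ) zero_mem_polesQ (p.pole₁_mem_polesQ m).1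
      (p.pole₂_mem_polesQ m).1⟩

lemma weightFactor_zero (x : ℂ) : p.weightFactor 0 x = (1 - (1 * x ^ (1 : ℤ)) ^ 2) /
    ((1 - p.k1 * p.u1 * (1 * x ^ (1 : ℤ))) * (1 + p.k1 * p.u1⁻¹ * (1 * x ^ (1 : ℤ)))) := by
  simp [weightFactor]

lemma weightFactor_one (x : ℂ) : p.weightFactor 1 x⁻¹ = (1 - (p.qh * x ^ (-1 : ℤ)) ^ 2) /
    ((1 - p.k0 * p.u0 * (p.qh * x ^ (-1 : ℤ))) *
      (1 + p.k0 * p.u0⁻¹ * (p.qh * x ^ (-1 : ℤ)))) := by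
  simp [weightFactor, q, mul_pow]

lemma weightDen_zero (x : ℂ) : p.weightDen 0 x =
    (1 - p.k1 * p.u1 * (1 * x ^ (1 : ℤ))) * (1 + p.k1 * p.u1⁻¹ * (1 * x ^ (1 : ℤ))) := by
  simp [weightDen, pole₁, pole₂]

lemma weightDen_one (x : ℂ) : p.weightDen 1 x⁻¹ =
    (1 - p.k0 * p.u0 * (p.qh * x ^ (-1 : ℤ))) *
      (1 + p.k0 * p.u0⁻¹ * (p.qh * x ^ (-1 : ℤ))) := by
  simp [weightDen, pole₁, pole₂, mul_assoc]

namespace IsContour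

variable (hγ : p.IsContour γ)
include hγ

/-- The truncation with one more factor in x than in x⁻¹ is w₀(x)ρ(x) with ρ(x⁻¹) = ρ(x). By
`weight_mul_heckeOperator` the integrand is then antisymmetric under x ↦ x⁻¹. -/
lemma form_T1 (hp : p.Generic) (f g : Laurent) :
    hγ.form hp (p.T1 f) g = hγ.form hp f (p.inv.T1 g + (p.k1 - p.k1⁻¹) • g) := by
  refine hγ.form_eq_of_forall hp (tendsto_add_atTop_nat 1) tendsto_id fun n => ?_
  set ρ : ℂ → ℂ := fun x => (∏ m ∈ Finset.range n, p.weightFactor (m + 1) x) *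
    ∏ m ∈ Finset.range n, p.weightFactor (m + 1) x⁻¹ with hρ
  have hrat : IsRational p.polesOneᶜ p.polesOne (fun x => p.k1⁻¹ *
      (evalAt (reflection 1 1 f * invert g - f * reflection 1 1 (invert g)) x) * ρ x) :=
    ((IsRational.const _).mul (IsRational.laurent zero_mem_polesOne (Set.notMem_compl_iff.2 zero_mem_polesOne) _)).mul
      ((IsRational.prod _ fun m _ => (isRational_polesOne hp (m + 1)).1).mul
        (IsRational.prod _ fun m _ => (isRational_polesOne hp (m + 1)).2))
  refine Eq.trans (IsLoop.curveInt_congr fun x hx => ?_)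
    (hγ.curveInt_div_eq_zero_of_antisymm_one hp hrat fun x hx => ?_)
  · have hx0 := hγ.ne_zero hx
    have key := weight_mul_heckeOperator (σ := 1) (Or.inl rfl) one_ne_zero hp.k1_ne hp.u1_ne f g hx0
      (by rw [← weightDen_zero]; exact hγ.weightDen_ne hp 0 hx)
    rw [← weightFactor_zero] at key
    have e : p.inv.T1 = heckeOperator 1 1⁻¹ p.k1⁻¹ p.u1⁻¹ := by rw [inv_one]; rfl
    rw [Finset.prod_range_succ', evalAt_sub, evalAt_mul _ _ hx0, evalAt_mul _ _ hx0, ← key, e, T1,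
      hρ]
    simp only [id]
    ring
  · simp only [hρ, evalAt_sub, evalAt_mul _ _ hx, evalAt_mul _ _ (inv_ne_zero hx), evalAt_reflection, one_zpow,
      one_mul, inv_inv]
    ring

/-- Now the extra factor is in x⁻¹: the truncation is w₁(x⁻¹)ρ(x) with ρ(q x⁻¹) = ρ(x). Removing
w₁(x⁻¹) also removes the poles c and d, so only poles in `polesQ` and its symmetric partners remain.
-/
lemma form_T0 (hp : p.Generic) (f g : Laurent) :
    hγ.form hp (p.T0 f) g = hγ.form hp f (p.inv.T0 g + (p.k0 - p.k0⁻¹) • g) := by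
  refine hγ.form_eq_of_forall hp tendsto_id (tendsto_add_atTop_nat 1) fun n => ?_
  set ρ : ℂ → ℂ := fun x => (∏ m ∈ Finset.range n, p.weightFactor m x) *
    ∏ m ∈ Finset.range n, p.weightFactor (m + 2) x⁻¹ with hρ
  have hrat : IsRational p.polesQᶜ p.polesQ (fun x => p.k0⁻¹ *
      (evalAt (reflection (-1) p.qh f * invert g - f * reflection (-1) p.qh (invert g)) x) * ρ x) :=
    ((IsRational.const _).mul (IsRational.laurent zero_mem_polesQ (Set.notMem_compl_iff.2 zero_mem_polesQ) _)).mul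
      ((IsRational.prod _ fun m _ => (isRational_polesQ hp m).1).mul
        (IsRational.prod _ fun m _ => (isRational_polesQ hp m).2))
  refine Eq.trans (IsLoop.curveInt_congr fun x hx => ?_)
    (hγ.curveInt_div_eq_zero_of_antisymm_q hp hrat fun x hx => ?_)
  · have hx0 := hγ.ne_zero hx
    have key := weight_mul_heckeOperator (σ := -1) (Or.inr rfl) hp.qh_ne hp.k0_ne hp.u0_ne f g hx0
      (by rw [← weightDen_one]; exact hγ.weightDen_inv_ne hp 1 hx)
    rw [← weightFactor_one] at key
    have e : p.inv.T0 = heckeOperator (-1) p.qh⁻¹ p.k0⁻¹ p.u0⁻¹ := rfl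
    rw [Finset.prod_range_succ', evalAt_sub, evalAt_mul _ _ hx0, evalAt_mul _ _ hx0, ← key, e, T0,
      hρ]
    simp only [id]
    ring
  · have hq := hp.q_ne
    have hx' : p.q * x⁻¹ ≠ 0 := mul_ne_zero hq (inv_ne_zero hx)
    have e1 : p.qh ^ (-2 * (-1) : ℤ) = p.q := by norm_num [q]
    have e2 : p.q * (p.q * x⁻¹)⁻¹ = x := by field_simp
    simp only [hρ, evalAt_sub, evalAt_mul _ _ hx, evalAt_mul _ _ hx', evalAt_reflection, e1, e2,
      weightFactor_add_two]
    ring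

/-- The adjoint of `T₁` is the inverse of `T₁'`. -/
lemma form_T1_T1 (hp : p.Generic) (f g : Laurent) :
    hγ.form hp (p.T1 f) (p.inv.T1 g) = hγ.form hp f g := by
  rw [hγ.form_T1 hp, hp.admissible.inv.T1_sq]
  congr 1
  simp only [Params.inv, inv_inv]
  module

/-- The adjoint of `T₀` is the inverse of `T₀'`. -/
lemma form_T0_T0 (hp : p.Generic) (f g : Laurent) :
    hγ.form hp (p.T0 f) (p.inv.T0 g) = hγ.form hp f g := by
  rw [hγ.form_T0 hp, hp.admissible.inv.T0_sq]
  congr 1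
  simp only [Params.inv, inv_inv]
  module

/-- The adjoint of `Y` is the inverse of `Y'`. -/
lemma form_Y_Y (hp : p.Generic) (f g : Laurent) :
    hγ.form hp (p.Y f) (p.inv.Y g) = hγ.form hp f g := by
  rw [Y, Y, LinearMap.comp_apply, LinearMap.comp_apply, hγ.form_T1_T1, hγ.form_T0_T0]

lemma weightFactor_zero_add (hp : p.Generic) {x : ℂ} (hx : x ∈ trace γ) :
    p.weightFactor 0 x + p.weightFactor 0 x⁻¹ =
      (1 + p.k1 ^ 2) * (p.weightFactor 0 x * p.weightFactor 0 x⁻¹) := by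
  have hx0 := hγ.ne_zero hx
  have h1 := hγ.weightDen_ne hp 0 hx
  have h2 := hγ.weightDen_inv_ne hp 0 hx
  have hu := hp.u1_ne
  have key : (1 - x ^ 2) * p.weightDen 0 x⁻¹ + (1 - x⁻¹ ^ 2) * p.weightDen 0 x =
      (1 + p.k1 ^ 2) * ((1 - x ^ 2) * (1 - x⁻¹ ^ 2)) := by
    simp only [weightDen, pole₁, pole₂, Even.zero, if_true, pow_zero, mul_one]
    field_simp
    ring
  rw [weightFactor_eq, weightFactor_eq, pow_zero, one_mul, one_mul]
  rw [div_add_div _ _ h1 h2, div_mul_div_comm, mul_div_assoc', div_left_inj' (mul_ne_zero h1 h2)]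
  linear_combination key

/-- On symmetric Laurent polynomials the two forms are proportional. -/
lemma formPlus_eq (hp : p.Generic) {f g : Laurent} (hf : reflection 1 1 f = f)
    (hg : reflection 1 1 g = g) :
    (1 + p.k1 ^ 2) * hγ.formPlus hp f g = 2 * hγ.form hp f g := by
  have hinv : ∀ {f : Laurent}, reflection 1 1 f = f → ∀ x, evalAt f x⁻¹ = evalAt f x := by
    intro f hf x
    conv_rhs => rw [← hf, evalAt_reflection]
    simp
  have hcF : ContinuousOn (fun x => evalAt f x * evalAt g x) (trace γ) :=
    (continuousOn_evalAt f hγ.zero_notMem).mul (continuousOn_evalAt g hγ.zero_notMem)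
  have hW := (tendstoUniformlyOn_const_mul hγ.isCompact (φ := fun _ => 1 + p.k1 ^ 2)
      continuousOn_const (hγ.tendsto_weightPlus hp (tendsto_add_atTop_nat 1))
      (fun n => hγ.continuousOn_prod_plus hp (n + 1))).fun_sub
    (tendstoUniformlyOn_const_mul hγ.isCompact (φ := fun _ => 2)
      continuousOn_const (hγ.tendsto_weight hp (tendsto_add_atTop_nat 1) tendsto_id)
      (fun n => hγ.continuousOn_prod hp (n + 1) n))
  have h0 := hγ.curveInt_mul_eq_zero hW
    (fun n => (continuousOn_const.mul (hγ.continuousOn_prod_plus hp (n + 1))).sub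
      (continuousOn_const.mul (hγ.continuousOn_prod hp (n + 1) n))) hcF fun n => by
    set ρ : ℂ → ℂ := fun x => (∏ m ∈ Finset.range n, p.weightFactor (m + 1) x) *
      ∏ m ∈ Finset.range n, p.weightFactor (m + 1) x⁻¹ with hρ
    -- By `weightFactor_zero_add` the truncation of (1 + k₁²)Δ₊ − 2Δ is (w₀(x⁻¹) − w₀(x))ρ(x) with ρ
    -- symmetric, hence antisymmetric under x ↦ x⁻¹.
    have hrat : IsRational p.polesOneᶜ p.polesOne (fun x => evalAt (f * g) x *
        (p.weightFactor 0 x⁻¹ - p.weightFactor 0 x) * ρ x) := by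
      refine ((IsRational.laurent zero_mem_polesOne (Set.notMem_compl_iff.2 zero_mem_polesOne) _).mul ?_).mul
        ((IsRational.prod _ fun m _ => (isRational_polesOne hp (m + 1)).1).mul
          (IsRational.prod _ fun m _ => (isRational_polesOne hp (m + 1)).2))
      exact (isRational_polesOne hp 0).2.sub (fun z hz h => h hz) (isRational_polesOne hp 0).1
    refine Eq.trans (IsLoop.curveInt_congr fun x hx => ?_)
      (hγ.curveInt_div_eq_zero_of_antisymm_one hp hrat fun x hx => ?_)
    · have hx0 := hγ.ne_zero hx
      rw [Finset.prod_range_succ', Finset.prod_range_succ', evalAt_mul _ _ hx0, hρ]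
      simp only [id]
      linear_combination (-(evalAt f x * evalAt g x *
        ((∏ m ∈ Finset.range n, p.weightFactor (m + 1) x) *
        ∏ m ∈ Finset.range n, p.weightFactor (m + 1) x⁻¹) / x)) * hγ.weightFactor_zero_add hp hx
    · simp only [hρ, one_mul, evalAt_mul _ _ hx, evalAt_mul _ _ (inv_ne_zero hx), hinv hf, hinv hg,
        inv_inv]
      ring
  have hcw : ∀ {ω : ℂ → ℂ}, ContinuousOn ω (trace γ) →
      ContinuousOn (fun x => evalAt f x * evalAt g x⁻¹ * ω x / x) (trace γ) := fun hω =>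
    continuousOn_div hγ.zero_notMem (((continuousOn_evalAt f hγ.zero_notMem).mul
      (continuousOn_evalAt_inv g hγ.zero_notMem)).mul hω)
  have h1 : curveInt γ (fun x => (1 + p.k1 ^ 2) * (evalAt f x * evalAt g x⁻¹ * p.weightPlus x / x)) -
      curveInt γ (fun x => 2 * (evalAt f x * evalAt g x⁻¹ * p.weight x / x)) = 0 := by
    rw [← hγ.isLoop.curveInt_sub (continuousOn_const.fun_mul (hcw (hγ.continuousOn_weightPlus hp)))
      (continuousOn_const.fun_mul (hcw (hγ.continuousOn_weight hp))), ← h0]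
    congr 1
    funext x
    rw [hinv hg]
    ring
  rw [IsLoop.curveInt_const_mul, IsLoop.curveInt_const_mul] at h1
  rw [form, formPlus, formOf_apply, formOf_apply]
  linear_combination (2 * Real.pi * Complex.I)⁻¹ * h1

end IsContour

end Params

/-! ### Integration of Laurent polynomials -/

/-- For n ≠ 0 the function x^(n−1) has the primitive x^n/n. As the value does not depend on the
curve, integrals of Laurent polynomials can be moved from C to the unit circle. -/
lemma IsLoop.curveInt_evalAt_div {γ : ℝ → ℂ} (hγ : IsLoop γ) (h0 : (0 : ℂ) ∉ trace γ)
    (hw : curveInt γ (fun x => x⁻¹) = 2 * Real.pi * Complex.I) (f : Laurent) :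
    curveInt γ (fun x => evalAt f x / x) = 2 * Real.pi * Complex.I * f.coeff 0 := by
  have hne : ∀ x ∈ trace γ, x ≠ 0 := fun x hx h => h0 (h ▸ hx)
  induction f using LaurentPolynomial.induction_on' with
  | add f g hf hg =>
    simp only [evalAt_add, add_div]
    rw [hγ.curveInt_add (continuousOn_div h0 (continuousOn_evalAt f h0))
      (continuousOn_div h0 (continuousOn_evalAt g h0)), hf, hg, AddMonoidAlgebra.coeff_add,
      Finsupp.add_apply]
    ring
  | C_mul_T n r =>
    have hc : (C r * T n : Laurent).coeff 0 = if n = 0 then r else 0 := by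
      rw [← single_eq_C_mul_T, AddMonoidAlgebra.coeff_single, Finsupp.single_apply]
    simp only [evalAt_C_mul_T, mul_div_assoc]
    rw [IsLoop.curveInt_const_mul, hc]
    split_ifs with hn
    · subst hn
      simp only [zpow_zero, one_div, hw]
      ring
    · rw [mul_zero]
      have h1 := hγ.curveInt_deriv (g := fun x => (n : ℂ)⁻¹ * x ^ n) fun x hx => by
        have := hne x hx
        exact contDiffAt_const.mul (AnalyticAt.zpow analyticAt_id this).contDiffAt
      have hn' : (n : ℂ) ≠ 0 := by exact_mod_cast hn
      rw [IsLoop.curveInt_congr (G := deriv fun x => (n : ℂ)⁻¹ * x ^ n), h1, mul_zero]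
      intro x hx
      rw [deriv_const_mul_field, deriv_zpow, zpow_sub_one₀ (hne x hx), inv_mul_cancel_left₀ hn',
        div_eq_mul_inv]

/-! ### The unit circle -/

/-- The unit circle as a loop. -/
def unitCircle (t : ℝ) : ℂ := Complex.exp (2 * Real.pi * Complex.I * t)

lemma norm_unitCircle (t : ℝ) : ‖unitCircle t‖ = 1 := by
  rw [unitCircle, show (2 * Real.pi * Complex.I * t : ℂ) = ((2 * Real.pi * t : ℝ) : ℂ) * Complex.I by
    push_cast; ring]
  exact Complex.norm_exp_ofReal_mul_I _

lemma hasDerivAt_unitCircle (t : ℝ) :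
    HasDerivAt unitCircle (unitCircle t * (2 * Real.pi * Complex.I)) t := by
  have h : HasDerivAt (fun t : ℝ => 2 * Real.pi * Complex.I * (t : ℂ)) (2 * Real.pi * Complex.I) t := by
    simpa using (Complex.ofRealCLM.hasDerivAt (x := t)).const_mul (2 * Real.pi * Complex.I)
  exact h.cexp

lemma continuous_unitCircle : Continuous unitCircle :=
  continuous_iff_continuousAt.2 fun t => (hasDerivAt_unitCircle t).continuousAt

lemma isLoop_unitCircle : IsLoop unitCircle where
  lipschitz := by
    refine ⟨Real.toNNReal (2 * Real.pi), (convex_Icc (0 : ℝ) 1).lipschitzOnWith_of_nnnorm_hasDerivWithin_le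
      (fun t _ => (hasDerivAt_unitCircle t).hasDerivWithinAt) fun t _ => ?_⟩
    rw [← NNReal.coe_le_coe, coe_nnnorm, norm_mul, norm_unitCircle,
      Real.coe_toNNReal _ (by positivity)]
    simp [abs_of_pos Real.pi_pos]
  closed := by simp [unitCircle, Complex.exp_two_pi_mul_I]

lemma norm_of_mem_unitCircle {x : ℂ} (hx : x ∈ trace unitCircle) : ‖x‖ = 1 := by
  obtain ⟨t, -, rfl⟩ := hx
  exact norm_unitCircle t

lemma zero_notMem_unitCircle : (0 : ℂ) ∉ trace unitCircle := fun h => by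
  simpa using norm_of_mem_unitCircle h

lemma curveInt_unitCircle_div (F : ℂ → ℂ) : curveInt unitCircle (fun x => F x / x) =
    2 * Real.pi * Complex.I * ∫ t in (0 : ℝ)..1, F (unitCircle t) := by
  rw [curveInt, ← intervalIntegral.integral_const_mul]
  congr 1
  funext t
  have : unitCircle t ≠ 0 := norm_pos_iff.1 (by rw [norm_unitCircle]; exact one_pos)
  rw [(hasDerivAt_unitCircle t).deriv]
  field_simp

lemma curveInt_unitCircle_evalAt_div (f : Laurent) :
    curveInt unitCircle (fun x => evalAt f x / x) = 2 * Real.pi * Complex.I * f.coeff 0 := by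
  refine isLoop_unitCircle.curveInt_evalAt_div zero_notMem_unitCircle ?_ f
  have := curveInt_unitCircle_div fun _ => 1
  simpa [one_div] using this

lemma infinite_unitCircle : (trace unitCircle).Infinite := by
  refine IsPreconnected.infinite_of_nontrivial
    (isPreconnected_Icc.image _ continuous_unitCircle.continuousOn)
    ⟨1, ⟨0, by simp, by simp [unitCircle]⟩, -1, ⟨1 / 2, by norm_num, ?_⟩, by norm_num⟩
  rw [unitCircle, ← Complex.exp_pi_mul_I]
  congr 1
  push_cast
  ring

/-- The complex conjugate of a Laurent polynomial on the unit circle. -/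
lemma exists_evalAt_eq_conj (f : Laurent) :
    ∃ g : Laurent, ∀ x : ℂ, ‖x‖ = 1 → evalAt g x = starRingEnd ℂ (evalAt f x) := by
  induction f using LaurentPolynomial.induction_on' with
  | add f g hf hg =>
    obtain ⟨f', hf⟩ := hf
    obtain ⟨g', hg⟩ := hg
    exact ⟨f' + g', fun x hx => by rw [evalAt_add, evalAt_add, map_add, hf x hx, hg x hx]⟩
  | C_mul_T n r =>
    refine ⟨C (starRingEnd ℂ r) * T (-n), fun x hx => ?_⟩
    rw [evalAt_C_mul_T, evalAt_C_mul_T, map_mul, map_zpow₀, zpow_neg, ← inv_zpow,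
      Complex.inv_eq_conj hx]

/-- A function on the unit circle which is a uniform limit of Laurent polynomials and
orthogonal to all of these vanishes. -/
lemma eq_zero_of_forall_curveInt_unitCircle {F : ℕ → Laurent} {φ : ℂ → ℂ}
    (hF : TendstoUniformlyOn (fun n x => evalAt (F n) x) φ atTop (trace unitCircle))
    (h : ∀ g : Laurent, curveInt unitCircle (fun x => φ x * evalAt g x / x) = 0)
    {x : ℂ} (hx : x ∈ trace unitCircle) : φ x = 0 := by
  have hFc : ∀ n, ContinuousOn (fun x => evalAt (F n) x) (trace unitCircle) :=
    fun n => continuousOn_evalAt _ zero_notMem_unitCircle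
  have hφ : ContinuousOn φ (trace unitCircle) := hF.continuousOn (Frequently.of_forall hFc)
  choose G hG using fun n => exists_evalAt_eq_conj (F n)
  have hconj : TendstoUniformlyOn (fun n x => starRingEnd ℂ (evalAt (F n) x))
      (fun x => starRingEnd ℂ (φ x)) atTop (trace unitCircle) := by
    rw [Metric.tendstoUniformlyOn_iff] at hF ⊢
    intro ε hε
    filter_upwards [hF ε hε] with n hn x hx
    rw [Complex.dist_conj_conj]
    exact hn x hx
  have hcc : ∀ n, ContinuousOn (fun x => starRingEnd ℂ (evalAt (F n) x)) (trace unitCircle) :=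
    fun n => Complex.continuous_conj.comp_continuousOn (hFc n)
  have hφx := continuousOn_div zero_notMem_unitCircle hφ
  have h1 := isLoop_unitCircle.tendsto_curveInt (fun n => hφx.mul (hcc n))
    (tendstoUniformlyOn_const_mul isLoop_unitCircle.isCompact_trace hφx hconj hcc)
  have h2 : ∀ n, curveInt unitCircle (fun x => φ x / x * starRingEnd ℂ (evalAt (F n) x)) = 0 := by
    intro n
    rw [← h (G n)]
    refine IsLoop.curveInt_congr fun x hx => ?_
    rw [hG n x (norm_of_mem_unitCircle hx)]
    ring
  have h3 := tendsto_nhds_unique (h1.congr h2) tendsto_const_nhds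
  have h4 : curveInt unitCircle (fun x => (Complex.normSq (φ x) : ℂ) / x) = 0 := by
    rw [← h3]
    congr 1
    funext x
    rw [← Complex.mul_conj]
    ring
  rw [curveInt_unitCircle_div, mul_eq_zero, or_iff_right Complex.two_pi_I_ne_zero,
    intervalIntegral.integral_ofReal, Complex.ofReal_eq_zero] at h4
  by_contra hne
  obtain ⟨t, ht, rfl⟩ := hx
  refine (intervalIntegral.integral_pos (f := fun t => Complex.normSq (φ (unitCircle t))) zero_lt_one ?_
    (fun t _ => Complex.normSq_nonneg _)
    ⟨t, ht, Complex.normSq_pos.2 hne⟩).ne' h4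
  exact Complex.continuous_normSq.comp_continuousOn
    (hφ.comp continuous_unitCircle.continuousOn (Set.mapsTo_image _ _))

namespace Params

variable (p : Params)

/-! ### Truncated numerators and denominators of the weight -/

/-- The numerator of the truncated weight. -/
def numerator (N : ℕ) : Laurent :=
  (∏ m ∈ Finset.range N, (1 - C (p.q ^ m) * T 2)) *
    ∏ m ∈ Finset.range N, (1 - C (p.q ^ (m + 1)) * T (-2))

/-- The denominator of the truncated weight. -/
def denominator (N : ℕ) : Laurent :=
  (∏ m ∈ Finset.range N, ((1 - C (p.pole₁ m) * T 1) * (1 - C (p.pole₂ m) * T 1))) *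
    ∏ m ∈ Finset.range N, ((1 - C (p.pole₁ (m + 1)) * T (-1)) * (1 - C (p.pole₂ (m + 1)) * T (-1)))

variable {p}

lemma evalAt_numerator (N : ℕ) {x : ℂ} (hx : x ≠ 0) : evalAt (p.numerator N) x =
    (∏ m ∈ Finset.range N, (1 - p.q ^ m * x ^ 2)) *
      ∏ m ∈ Finset.range N, (1 - p.q ^ (m + 1) * x⁻¹ ^ 2) := by
  have h : x ^ (-2 : ℤ) = x⁻¹ ^ 2 := by rw [zpow_neg, inv_pow]; norm_cast
  have h' : x ^ (2 : ℤ) = x ^ 2 := by norm_cast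
  simp only [numerator, evalAt_mul _ _ hx, evalAt_prod _ _ hx, evalAt_sub, evalAt_one, evalAt_C,
    evalAt_T, h, h']

lemma evalAt_denominator (N : ℕ) {x : ℂ} (hx : x ≠ 0) : evalAt (p.denominator N) x =
    (∏ m ∈ Finset.range N, p.weightDen m x) *
      ∏ m ∈ Finset.range N, p.weightDen (m + 1) x⁻¹ := by
  simp only [denominator, evalAt_mul _ _ hx, evalAt_prod _ _ hx, evalAt_sub, evalAt_one, evalAt_C,
    evalAt_T, zpow_neg_one, zpow_one, weightDen]

/-- Numerator limit on compact sets. -/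
lemma exists_tendsto_numerator (hp : p.Generic) {K : Set ℂ} (hK : IsCompact K) (h0 : (0 : ℂ) ∉ K) :
    ∃ θ : ℂ → ℂ, TendstoUniformlyOn (fun N x => evalAt (p.numerator N) x) θ atTop K ∧
      ∀ x ∈ K, ‖x‖ = 1 → x ^ 2 ≠ 1 → θ x ≠ 0 := by
  have hne : ∀ x ∈ K, x ≠ 0 := fun x hx h => h0 (h ▸ hx)
  have hr := norm_nonneg p.qh
  have h1 := geomClose_num hp hK continuousOn_id
  have h2 := (geomClose_num hp hK (continuousOn_id.inv₀ hne)).succ hr hp.qh_lt.le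
  have t := TendstoUniformlyOn.mul_of_compact hK (h1.tendstoUniformlyOn hK hr hp.qh_lt)
    (h2.tendstoUniformlyOn hK hr hp.qh_lt)
    (fun n => continuousOn_finsetProd _ fun m _ => h1.continuousOn m)
    (fun n => continuousOn_finsetProd _ fun m _ => h2.continuousOn m)
  refine ⟨_, t.congr (Eventually.of_forall fun N x hx => (evalAt_numerator N (hne x hx)).symm),
    fun x hx hx1 hx2 => ?_⟩
  -- Since |q| < 1, on the unit circle only the factor 1 − x² with m = 0 can vanish.
  have hpow : ∀ (m : ℕ) (y : ℂ), ‖y‖ = 1 → 1 - p.q ^ (m + 1) * y ^ 2 ≠ 0 := fun m y hy h => by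
    have h3 : ‖p.q ^ (m + 1) * y ^ 2‖ = 1 := by rw [← sub_eq_zero.1 h, norm_one]
    rw [norm_mul, norm_pow, norm_pow, hy, one_pow, mul_one] at h3
    exact (pow_lt_one₀ (norm_nonneg _) hp.q_lt m.succ_ne_zero).ne h3
  refine mul_ne_zero (h1.tprod_ne_zero hr hp.qh_lt hx fun m => ?_)
    (h2.tprod_ne_zero hr hp.qh_lt hx fun m => hpow m _ (by simp [hx1]))
  cases m with
  | zero =>
    rw [pow_zero, one_mul]
    exact sub_ne_zero.2 (Ne.symm hx2)
  | succ m => exact hpow m _ hx1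

/-! ### Non-degeneracy -/

namespace IsContour

variable {γ : ℝ → ℂ} (hγ : p.IsContour γ)
include hγ

lemma denominator_mul (hp : p.Generic) (N : ℕ) {x : ℂ} (hx : x ∈ trace γ) :
    evalAt (p.denominator N) x * ((∏ m ∈ Finset.range N, p.weightFactor m x) *
      ∏ m ∈ Finset.range N, p.weightFactor (m + 1) x⁻¹) = evalAt (p.numerator N) x := by
  rw [evalAt_denominator N (hγ.ne_zero hx), evalAt_numerator N (hγ.ne_zero hx), mul_mul_mul_comm,
    ← Finset.prod_mul_distrib, ← Finset.prod_mul_distrib]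
  congr 1 <;> refine Finset.prod_congr rfl fun m _ => ?_
  · rw [weightFactor_eq, mul_div_cancel₀ _ (hγ.weightDen_ne hp m hx)]
  · rw [weightFactor_eq, mul_div_cancel₀ _ (hγ.weightDen_inv_ne hp (m + 1) hx)]

lemma exists_tendsto_denominator (hp : p.Generic) : ∃ D : ℂ → ℂ,
    TendstoUniformlyOn (fun N x => evalAt (p.denominator N) x) D atTop (trace γ) := by
  have hr := norm_nonneg p.qh
  have hK := hγ.isCompact
  have h1 := geomClose_den hp hK continuousOn_id
  have h2 := (geomClose_den hp hK hγ.continuousOn_inv).succ hr hp.qh_lt.le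
  have t := TendstoUniformlyOn.mul_of_compact hK (h1.tendstoUniformlyOn hK hr hp.qh_lt)
    (h2.tendstoUniformlyOn hK hr hp.qh_lt)
    (fun n => continuousOn_finsetProd _ fun m _ => h1.continuousOn m)
    (fun n => continuousOn_finsetProd _ fun m _ => h2.continuousOn m)
  exact ⟨_, t.congr (Eventually.of_forall fun N x hx =>
    (evalAt_denominator N (hγ.ne_zero hx)).symm)⟩

/-- The integral of a Laurent polynomial against the numerator of the weight, as a limit. -/
lemma tendsto_coeff_mul_numerator (hp : p.Generic) {f : Laurent}
    (h : ∀ g : Laurent, curveInt γ (fun x => evalAt (f * g) x * p.weight x / x) = 0) (g : Laurent) :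
    Tendsto (fun N => 2 * Real.pi * Complex.I * (f * g * p.numerator N).coeff 0) atTop (𝓝 0) := by
  obtain ⟨D, hD⟩ := hγ.exists_tendsto_denominator hp
  have hK := hγ.isCompact
  have hW := hγ.tendsto_weight hp tendsto_id tendsto_id
  have hWc := fun n => hγ.continuousOn_prod hp n n
  have hDc : ∀ n, ContinuousOn (fun x => evalAt (p.denominator n) x) (trace γ) :=
    fun n => continuousOn_evalAt _ hγ.zero_notMem
  have hφ : ContinuousOn (fun x => evalAt (f * g) x / x) (trace γ) :=
    continuousOn_div hγ.zero_notMem (continuousOn_evalAt _ hγ.zero_notMem)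
  have hconst : TendstoUniformlyOn (fun _ : ℕ => p.weight) p.weight atTop (trace γ) :=
    fun u hu => Eventually.of_forall fun _ x _ => refl_mem_uniformity hu
  have hwc := fun _ : ℕ => hγ.continuousOn_weight hp
  -- Let D_N be the truncated denominator and Δ_N the truncated weight. D_N Δ_N, which is the
  -- numerator, and D_N Δ have the same limit. The integrals against D_N Δ are zero because D_N can
  -- be absorbed into g.
  have t1 := hγ.isLoop.tendsto_curveInt (fun n => hφ.fun_mul ((hDc n).fun_mul (hWc n)))
    (tendstoUniformlyOn_const_mul hK hφ (TendstoUniformlyOn.mul_of_compact hK hD hW hDc hWc)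
      fun n => (hDc n).mul (hWc n))
  have t2 := hγ.isLoop.tendsto_curveInt (fun n => hφ.fun_mul ((hDc n).fun_mul (hwc n)))
    (tendstoUniformlyOn_const_mul hK hφ (TendstoUniformlyOn.mul_of_compact hK hD hconst hDc hwc)
      fun n => (hDc n).mul (hwc n))
  have e2 : ∀ n, curveInt γ (fun x => evalAt (f * g) x / x *
      (evalAt (p.denominator n) x * p.weight x)) = 0 := fun n => by
    rw [← h (g * p.denominator n)]
    refine IsLoop.curveInt_congr fun x hx => ?_
    rw [← mul_assoc f, evalAt_mul _ (p.denominator n) (hγ.ne_zero hx)]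
    ring
  rw [tendsto_nhds_unique (t2.congr e2) tendsto_const_nhds] at t1
  refine t1.congr fun n => ?_
  rw [← hγ.isLoop.curveInt_evalAt_div hγ.zero_notMem (hγ.winding_zero hp)]
  refine IsLoop.curveInt_congr fun x hx => ?_
  rw [evalAt_mul _ (p.numerator n) (hγ.ne_zero hx), ← hγ.denominator_mul hp n hx]
  ring

/-- A Laurent polynomial orthogonal to all Laurent polynomials with respect to the weight
vanishes. -/
lemma eq_zero_of_forall_curveInt (hp : p.Generic) {f : Laurent}
    (h : ∀ g : Laurent, curveInt γ (fun x => evalAt (f * g) x * p.weight x / x) = 0) : f = 0 := by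
  have hK := isLoop_unitCircle.isCompact_trace
  have h0 := zero_notMem_unitCircle
  obtain ⟨θ, hθ, hθ0⟩ := exists_tendsto_numerator hp hK h0
  have hθc : ∀ n, ContinuousOn (fun x => evalAt (p.numerator n) x) (trace unitCircle) :=
    fun n => continuousOn_evalAt _ h0
  have hFφ := tendstoUniformlyOn_const_mul hK (continuousOn_evalAt f h0) hθ hθc
  -- The integrals over C of f g times the numerators tend to 0. They are constant terms, so the
  -- same holds on the unit circle, where fθ is therefore orthogonal to all Laurent polynomials.
  have hzero : ∀ x ∈ trace unitCircle, evalAt f x * θ x = 0 := by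
    intro x hx
    refine eq_zero_of_forall_curveInt_unitCircle (F := fun n => f * p.numerator n)
      (φ := fun x => evalAt f x * θ x) (hFφ.congr (Eventually.of_forall fun n x hx =>
        (evalAt_mul _ _ fun e => h0 (e ▸ hx)).symm)) (fun g => ?_) hx
    have hφ : ContinuousOn (fun x => evalAt (f * g) x / x) (trace unitCircle) :=
      continuousOn_div h0 (continuousOn_evalAt _ h0)
    have t := isLoop_unitCircle.tendsto_curveInt (fun n => hφ.mul (hθc n))
      (tendstoUniformlyOn_const_mul hK hφ hθ hθc)
    have t' := hγ.tendsto_coeff_mul_numerator hp h g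
    have e : ∀ n, curveInt unitCircle (fun x => evalAt (f * g) x / x * evalAt (p.numerator n) x) =
        2 * Real.pi * Complex.I * (f * g * p.numerator n).coeff 0 := fun n => by
      rw [← curveInt_unitCircle_evalAt_div]
      refine IsLoop.curveInt_congr fun x hx => ?_
      rw [evalAt_mul _ (p.numerator n) fun e => h0 (e ▸ hx)]
      ring
    rw [← tendsto_nhds_unique (t.congr e) t']
    refine IsLoop.curveInt_congr fun x hx => ?_
    rw [evalAt_mul _ _ fun e => h0 (e ▸ hx)]
    ring
  refine eq_zero_of_infinite
    (infinite_unitCircle.sdiff (Set.toFinite ({1, -1} : Set ℂ))) fun x hx _ => ?_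
  refine (mul_eq_zero.1 (hzero x hx.1)).resolve_right
    (hθ0 x hx.1 (norm_of_mem_unitCircle hx.1) fun h1 => hx.2 ?_)
  simpa using h1

lemma form_separatingLeft (hp : p.Generic) {f : Laurent} (h : ∀ g, hγ.form hp f g = 0) : f = 0 := by
  refine hγ.eq_zero_of_forall_curveInt hp fun g => ?_
  have h1 := h (invert g)
  rw [form, formOf_apply, mul_eq_zero, or_iff_right (inv_ne_zero Complex.two_pi_I_ne_zero)] at h1
  rw [← h1]
  refine IsLoop.curveInt_congr fun x hx => ?_
  rw [evalAt_mul _ _ (hγ.ne_zero hx), evalAt_invert, inv_inv]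

lemma form_separatingRight (hp : p.Generic) {g : Laurent} (h : ∀ f, hγ.form hp f g = 0) : g = 0 := by
  refine (map_eq_zero_iff invert invert.injective).1 (hγ.eq_zero_of_forall_curveInt hp fun f => ?_)
  have h1 := h f
  rw [form, formOf_apply, mul_eq_zero, or_iff_right (inv_ne_zero Complex.two_pi_I_ne_zero)] at h1
  rw [← h1]
  refine IsLoop.curveInt_congr fun x hx => ?_
  rw [evalAt_mul _ _ (hγ.ne_zero hx), evalAt_invert, mul_comm (evalAt g x⁻¹)]

lemma form_nondegenerate (hp : p.Generic) : (hγ.form hp).Nondegenerate :=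
  ⟨fun _ h => hγ.form_separatingLeft hp h, fun _ h => hγ.form_separatingRight hp h⟩

end IsContour

end Params

/-! ### Symmetric Laurent polynomials -/

lemma coeff_reflection_one (f : Laurent) (j : ℤ) : (reflection 1 1 f).coeff j = f.coeff (-j) := by
  induction f using LaurentPolynomial.induction_on' with
  | add f g hf hg => simp only [map_add, AddMonoidAlgebra.coeff_add, Finsupp.add_apply, hf, hg]
  | C_mul_T n r =>
    rw [reflection, ofMonomials_C_mul_T, one_zpow, C.map_one, one_mul, ← single_eq_C_mul_T,
      ← single_eq_C_mul_T, AddMonoidAlgebra.coeff_single, AddMonoidAlgebra.coeff_single,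
      Finsupp.single_apply, Finsupp.single_apply]
    simp only [neg_eq_iff_eq_neg]

/-- By symmetry, the absence of x^m forces that of x^(-m). -/
lemma mem_filt_of_symmetric {m : ℕ} {f : Laurent} (hf : reflection 1 1 f = f)
    (h : f ∈ filt (2 * m)) : f ∈ filt (2 * m - 1) := by
  intro j hj
  rcases (show 2 * (m : ℤ) ≤ rank j ∨ rank j = 2 * m - 1 by omega) with h1 | h1
  · exact h j h1
  · have hm : 1 ≤ m := by have := rank_nonneg j; omega
    rw [rank_injective (h1.trans (rank_neg_coe hm).symm), ← coeff_reflection_one, hf]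
    exact h m (by rw [rank_coe])

namespace Params

namespace Admissible

variable {r : Params} (hr : r.Admissible)
include hr

lemma reflection_Pplus (m : ℕ) : reflection 1 1 (r.Pplus m) = r.Pplus m :=
  reflection_eq_self_of_eigen (Or.inl rfl) one_ne_zero hr.k1_ne hr.u1_ne (hr.T1_Pplus m)

lemma Pplus_sub_mem_filt (m : ℕ) : r.Pplus m - T m ∈ filt (2 * m) := by
  rw [← rank_coe]
  exact isMonicOfDegree_iff.1 (hr.Pplus_spec m).2

lemma Pplus_mem_filt {m n : ℕ} (h : m < n) : r.Pplus m ∈ filt (2 * n - 1) := by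
  have := (hr.Pplus_spec m).2.mem_filt
  rw [rank_coe] at this
  exact filt_mono (by omega) this

/-- The symmetric Laurent polynomials of degree less than `m` are spanned by the symmetric
Askey-Wilson polynomials. -/
lemma mem_span_Pplus {m : ℕ} {f : Laurent} (hf : reflection 1 1 f = f)
    (h : f ∈ filt (2 * m - 1)) : f ∈ Submodule.span ℂ (r.Pplus '' Set.Iio m) := by
  induction m generalizing f with
  | zero => rw [filt_zero (f := f) (filt_mono (by simp) h)]; exact zero_mem _
  | succ m ih =>
    have h1 : f - f.coeff m • r.Pplus m ∈ filt (2 * m) := by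
      rw [← rank_coe]
      refine sub_coeff_smul_mem_filt ?_ (by rw [rank_coe]; exact hr.Pplus_sub_mem_filt m)
      rw [rank_coe]
      exact filt_mono (by push_cast; omega) h
    have h2 : reflection 1 1 (f - f.coeff m • r.Pplus m) = f - f.coeff m • r.Pplus m := by
      rw [map_sub, map_smul, hf, hr.reflection_Pplus]
    have h3 := ih h2 (mem_filt_of_symmetric h2 h1)
    rw [← sub_add_cancel f (f.coeff m • r.Pplus m)]
    exact add_mem (Submodule.span_mono (Set.image_mono (Set.Iio_subset_Iio m.le_succ)) h3)
      (Submodule.smul_mem _ _ (Submodule.subset_span ⟨m, by simp, rfl⟩))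

lemma family_ne_zero (i : ℕ ⊕ ℕ) : r.family i ≠ 0 := by
  have h : ∀ {m : ℤ} {f : Laurent}, IsMonicOfDegree m f → f ≠ 0 := by
    rintro m _ h rfl
    simpa using h.1
  rcases i with m | n
  · exact h (hr.Pplus_spec m).2
  · exact h (hr.Pminus_spec n.succ_pos).2

end Admissible

namespace IsContour

variable {p : Params} {γ : ℝ → ℂ} (hγ : p.IsContour γ) (hp : p.Generic)
include hγ hp

/-! ### Orthogonality -/

/-- As γ′_j = γ_j⁻¹, invariance under (Y, Y′) gives γ_i γ_j⁻¹ ⟨P_i, P_j′⟩ = ⟨P_i, P_j′⟩. -/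
lemma form_nonsymmetric {i j : ℤ} (h : i ≠ j) :
    hγ.form hp (p.nonsymmetric i) (p.inv.nonsymmetric j) = 0 := by
  have hr := hp.admissible
  have h1 := hγ.form_Y_Y hp (p.nonsymmetric i) (p.inv.nonsymmetric j)
  rw [(hr.nonsymmetric_spec i).2, (hr.inv.nonsymmetric_spec j).2, gam_inv, map_smul, map_smul,
    LinearMap.smul_apply, smul_eq_mul, smul_eq_mul, ← sub_eq_zero] at h1
  have h2 := hr.gam_ne_zero j
  have h3 : p.gam i - p.gam j ≠ 0 := sub_ne_zero.2 (hp.gam_injective.ne h)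
  refine (mul_eq_zero.1 (?_ : (p.gam i - p.gam j) * _ = 0)).resolve_left h3
  field_simp at h1
  linear_combination h1

lemma form_component {m n : ℕ} (h : m ≠ n) {f g : Laurent} (hf : f ∈ p.component m)
    (hg : g ∈ p.inv.component n) : hγ.form hp f g = 0 := by
  have hr := hp.admissible
  obtain ⟨s, t, rfl⟩ := Admissible.eq_of_mem_component hf
  obtain ⟨s', t', rfl⟩ := Admissible.eq_of_mem_component hg
  have e := fun {i j : ℤ} (h : i ≠ j) => hγ.form_nonsymmetric hp h
  simp only [map_add, map_smul, LinearMap.add_apply, LinearMap.smul_apply]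
  rw [e (by omega), e (by omega), e (by omega), e (by omega)]
  simp

/-- Separates the signs: for P⁺ against P⁻′ the product of the eigenvalues is −k₁², for P⁻ against
P⁺′ it is −k₁⁻², and neither is 1. -/
lemma form_eq_zero_of_T1 {f g : Laurent} {s t : ℂ} (hf : p.T1 f = s • f) (hg : p.inv.T1 g = t • g)
    (hst : s * t ≠ 1) : hγ.form hp f g = 0 := by
  have h1 := hγ.form_T1_T1 hp f g
  rw [hf, hg, map_smul, map_smul, LinearMap.smul_apply, smul_eq_mul, smul_eq_mul] at h1
  refine (mul_eq_zero.1 (?_ : (s * t - 1) * hγ.form hp f g = 0)).resolve_left (sub_ne_zero.2 hst)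
  linear_combination h1

lemma form_Pplus_Pminus (m : ℕ) {n : ℕ} (hn : 1 ≤ n) :
    hγ.form hp (p.Pplus m) (p.inv.Pminus n) = 0 := by
  have hr := hp.admissible
  refine hγ.form_eq_zero_of_T1 hp (hr.T1_Pplus m) (hr.inv.T1_Pminus hn) fun h => hr.one_add_ne ?_
  simp only [Params.inv, inv_inv] at h
  linear_combination -h

lemma form_Pminus_Pplus {n : ℕ} (hn : 1 ≤ n) (m : ℕ) :
    hγ.form hp (p.Pminus n) (p.inv.Pplus m) = 0 := by
  have hr := hp.admissible
  refine hγ.form_eq_zero_of_T1 hp (hr.T1_Pminus hn) (hr.inv.T1_Pplus m) fun h =>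
    hr.inv.one_add_ne ?_
  simp only [Params.inv] at h ⊢
  linear_combination -h

theorem form_family {i j : ℕ ⊕ ℕ} (h : i ≠ j) : hγ.form hp (p.family i) (p.inv.family j) = 0 := by
  have hr := hp.admissible
  rcases i with m | m <;> rcases j with n | n
  · exact hγ.form_component hp (fun e => h (by rw [e])) (hr.Pplus_mem m) (hr.inv.Pplus_mem n)
  · exact hγ.form_Pplus_Pminus hp m n.succ_pos
  · exact hγ.form_Pminus_Pplus hp m.succ_pos n
  · exact hγ.form_component hp (fun e => h (by rw [Nat.succ_injective e]))
      (hr.Pminus_mem m.succ_pos) (hr.inv.Pminus_mem n.succ_pos)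

lemma eq_zero_of_form_family {f : Laurent} (h : ∀ i, hγ.form hp f (p.inv.family i) = 0) : f = 0 := by
  refine hγ.form_separatingLeft hp fun g => ?_
  have hg : g ∈ Submodule.span ℂ (Set.range p.inv.family) := by
    rw [hp.admissible.inv.span_family]; trivial
  induction hg using Submodule.span_induction with
  | mem g hg => obtain ⟨i, rfl⟩ := hg; exact h i
  | zero => exact map_zero _
  | add g g' _ _ hg hg' => rw [map_add, hg, hg', add_zero]
  | smul c g _ hg => rw [map_smul, hg, smul_zero]

/-- Otherwise the i-th member would be orthogonal to the whole spanning family of the inverse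
parameters, against non-degeneracy. -/
lemma form_family_self (i : ℕ ⊕ ℕ) : hγ.form hp (p.family i) (p.inv.family i) ≠ 0 := by
  intro h
  refine hp.admissible.family_ne_zero i (hγ.eq_zero_of_form_family hp fun j => ?_)
  by_cases hij : i = j
  · rw [← hij, h]
  · exact hγ.form_family hp hij

theorem isBiorthogonalSystem : IsBiorthogonalSystem (hγ.form hp) p.family p.inv.family := by
  have hr := hp.admissible
  refine ⟨⟨?_, hr.span_family⟩, ⟨?_, hr.inv.span_family⟩, fun i j h => hγ.form_family hp h⟩
  · rw [linearIndependent_iff']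
    intro s c hc i hi
    have h1 := congrArg (fun f => hγ.form hp f (p.inv.family i)) hc
    simp only [map_sum, map_smul, LinearMap.sum_apply, LinearMap.smul_apply, map_zero,
      LinearMap.zero_apply] at h1
    rw [Finset.sum_eq_single_of_mem i hi fun j _ hj => by rw [hγ.form_family hp hj, smul_zero]] at h1
    exact (mul_eq_zero.1 h1).resolve_right (hγ.form_family_self hp i)
  · rw [linearIndependent_iff']
    intro s c hc i hi
    have h1 := congrArg (hγ.form hp (p.family i)) hc
    simp only [map_sum, map_smul, map_zero] at h1
    rw [Finset.sum_eq_single_of_mem i hi fun j _ hj => by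
      rw [hγ.form_family hp hj.symm, smul_zero]] at h1
    exact (mul_eq_zero.1 h1).resolve_right (hγ.form_family_self hp i)

/-! ### Symmetric Askey-Wilson polynomials of the inverse parameters -/

lemma form_comm {f g : Laurent} (hf : reflection 1 1 f = f) (hg : reflection 1 1 g = g) :
    hγ.form hp f g = hγ.form hp g f := by
  have hinv : ∀ {f : Laurent}, reflection 1 1 f = f → ∀ x, evalAt f x⁻¹ = evalAt f x := by
    intro f hf x
    conv_rhs => rw [← hf, evalAt_reflection]
    simp
  rw [form, formOf_apply, formOf_apply]
  congr 2
  funext x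
  rw [hinv hf, hinv hg, mul_comm (evalAt f x)]

/-- f is a combination of the P_n⁺ with n < m. Allowing any symmetric f makes this applicable to the
P_n⁺′ as well. -/
lemma form_left_Pplus {m : ℕ} {f : Laurent} (hf : reflection 1 1 f = f) (h : f ∈ filt (2 * m - 1)) :
    hγ.form hp f (p.inv.Pplus m) = 0 := by
  have := hp.admissible.mem_span_Pplus hf h
  clear hf h
  induction this using Submodule.span_induction with
  | mem g hg =>
    obtain ⟨n, hn, rfl⟩ := hg
    exact hγ.form_family hp (i := Sum.inl n) (j := Sum.inl m)
      (by simpa using (Set.mem_Iio.1 hn).ne)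
  | zero => rw [map_zero, LinearMap.zero_apply]
  | add g g' _ _ hg hg' => rw [map_add, LinearMap.add_apply, hg, hg', add_zero]
  | smul c g _ hg => rw [map_smul, LinearMap.smul_apply, hg, smul_zero]

lemma form_right_Pplus {m : ℕ} {f : Laurent} (hf : reflection 1 1 f = f) (h : f ∈ filt (2 * m - 1)) :
    hγ.form hp (p.Pplus m) f = 0 := by
  have := hp.admissible.inv.mem_span_Pplus hf h
  clear hf h
  induction this using Submodule.span_induction with
  | mem g hg =>
    obtain ⟨n, hn, rfl⟩ := hg
    exact hγ.form_family hp (i := Sum.inl m) (j := Sum.inl n)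
      (by simpa using (Set.mem_Iio.1 hn).ne')
  | zero => rw [map_zero]
  | add g g' _ _ hg hg' => rw [map_add, hg, hg', add_zero]
  | smul c g _ hg => rw [map_smul, hg, smul_zero]

lemma form_symmetric_Pminus {f : Laurent} (hf : reflection 1 1 f = f) {n : ℕ} (hn : 1 ≤ n) :
    hγ.form hp f (p.inv.Pminus n) = 0 := by
  obtain ⟨N, hN⟩ := exists_mem_filt f
  have := hp.admissible.mem_span_Pplus (m := N + 1) hf (filt_mono (by push_cast; omega) hN)
  clear hf hN
  induction this using Submodule.span_induction with
  | mem g hg => obtain ⟨m, -, rfl⟩ := hg; exact hγ.form_Pplus_Pminus hp m hn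
  | zero => rw [map_zero, LinearMap.zero_apply]
  | add g g' _ _ hg hg' => rw [map_add, LinearMap.add_apply, hg, hg', add_zero]
  | smul c g _ hg => rw [map_smul, LinearMap.smul_apply, hg, smul_zero]

/-- The difference D is symmetric of degree below m, as the leading terms cancel. It is orthogonal
to all P_n⁻′ as a symmetric polynomial and to P_n⁺′ with n ≥ m by degree. For n < m both terms of D
are orthogonal to P_n⁺′, and non-degeneracy gives D = 0. -/
theorem Pplus_inv (m : ℕ) : p.inv.Pplus m = p.Pplus m := by
  have hr := hp.admissible
  rw [← sub_eq_zero]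
  set D := p.inv.Pplus m - p.Pplus m with hD
  have hDs : reflection 1 1 D = D := by
    rw [hD, map_sub, hr.reflection_Pplus, hr.inv.reflection_Pplus]
  have hDf : D ∈ filt (2 * m - 1) := mem_filt_of_symmetric hDs <| by
    rw [hD, ← sub_sub_sub_cancel_right _ _ (T m)]
    exact sub_mem (hr.inv.Pplus_sub_mem_filt m) (hr.Pplus_sub_mem_filt m)
  refine hγ.eq_zero_of_form_family hp fun i => ?_
  rcases i with n | n
  · have hn := hr.inv.reflection_Pplus n
    change hγ.form hp D (p.inv.Pplus n) = 0
    rcases lt_or_ge n m with h | h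
    · have hf := hr.inv.Pplus_mem_filt h
      -- The orthogonality of P_m⁺′ is known only in the second argument and that of P_m⁺ only in
      -- the first, hence the exchanges by `form_comm`.
      rw [hγ.form_comm hp hDs hn, hD, map_sub, hγ.form_left_Pplus hp hn hf,
        hγ.form_comm hp hn (hr.reflection_Pplus m), hγ.form_right_Pplus hp hn hf, sub_zero]
    · exact hγ.form_left_Pplus hp hDs (filt_mono (by omega) hDf)
  · exact hγ.form_symmetric_Pminus hp hDs n.succ_pos

lemma form_Pplus_Pplus {m n : ℕ} (h : m ≠ n) : hγ.form hp (p.Pplus m) (p.Pplus n) = 0 := by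
  rw [← hγ.Pplus_inv hp n]
  exact hγ.form_family hp (i := Sum.inl m) (j := Sum.inl n) (by simpa using h)

lemma formPlus_Pplus_Pplus {m n : ℕ} (h : m ≠ n) :
    hγ.formPlus hp (p.Pplus m) (p.Pplus n) = 0 := by
  have hr := hp.admissible
  have h1 := hγ.formPlus_eq hp (hr.reflection_Pplus m) (hr.reflection_Pplus n)
  rw [hγ.form_Pplus_Pplus hp h, mul_zero] at h1
  exact (mul_eq_zero.1 h1).resolve_left hr.one_add_ne

end IsContour

end Params

end AskeyWilson

end
theorem proposition6p8 (p : AskeyWilson.Params) (hp : p.Generic) (γ : ℝ → ℂ)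
    (hγ : p.IsContour γ) :
    -- the polynomials are well defined, for the parameters and for the inverse parameters
    (∀ r ∈ ({p, p.inv} : Set AskeyWilson.Params),
      (∀ m : ℤ, ∃! f, r.IsNonsymmetric m f) ∧
      (∀ m : ℕ, ∃! f, r.IsSymmetric m f) ∧
      (∀ m : ℕ, 1 ≤ m → ∃! f, r.IsAntisymmetric m f)) ∧
    ∃ B Bplus : LinearMap.BilinForm ℂ AskeyWilson.Laurent,
      (∀ f g, B f g = p.pairing γ f g) ∧
      (∀ f g, Bplus f g = p.pairingPlus γ f g) ∧
      B.Nondegenerate ∧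
      AskeyWilson.IsBiorthogonalSystem B p.family p.inv.family ∧
      (∀ m : ℕ, p.inv.Pplus m = p.Pplus m) ∧
      (∀ m n : ℕ, m ≠ n → B (p.Pplus m) (p.Pplus n) = 0 ∧ Bplus (p.Pplus m) (p.Pplus n) = 0) := by
  have hr : ∀ r ∈ ({p, p.inv} : Set AskeyWilson.Params), r.Admissible := by
    rintro r (rfl | rfl)
    exacts [hp.admissible, hp.admissible.inv]
  refine ⟨fun r h => ⟨(hr r h).existsUnique_nonsymmetric, (hr r h).existsUnique_symmetric,
    fun m hm => (hr r h).existsUnique_antisymmetric hm⟩, hγ.form hp, hγ.formPlus hp,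
    hγ.form_apply hp, hγ.formPlus_apply hp, hγ.form_nondegenerate hp, hγ.isBiorthogonalSystem hp,
    hγ.Pplus_inv hp, fun m n h => ⟨hγ.form_Pplus_Pplus hp h, hγ.formPlus_Pplus_Pplus hp h⟩⟩
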